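/- Let $n\ge 0$ be an integer. **Wooded triangulations.** A *size-$n$ triangulation* is a simple plane triangulation $M$ (no loops, no multiple edges, every face including the unbounded one bounded by three edges) whose unbounded face has vertices $A_{\mathrm b},A_{\mathrm r},A_{\mathrm g}$ in counterclockwise order and which has exactly $n$ further vertices, called inner vertices. An edge is inner if it is not one of $\overline{A_{\mathrm b}A_{\mathrm r}},\overline{A_{\mathrm r}A_{\mathrm g}},\overline{A_{\mathrm g}A_{\mathrm b}}$. A *Schnyder wood* on $M$ is an orientation of the inner edges for which every inner vertex has out-degree $3$, together with a colouring of the inner edges by blue, red and green, such that 1. clockwise around each inner vertex one sees: one outgoing blue edge, some (possibly zero) incoming red edges, one outgoing green edge, some incoming blue edges, one outgoing red edge, some incoming green edges; 2. all inner edges at $A_{\mathrm b}$, $A_{\mathrm r}$, $A_{\mathrm g}$ enter that vertex and are blue, red, green respectively. Let $\mathcal S_n$ be the set of pairs $S=(M,\mathcal O)$, where $M$ is a size-$n$ triangulation and $\mathcal O$ is a Schnyder wood on $M$, considered up to orientation-preserving homeomorphisms that preserve the unbounded face, the names of the outer vertices, the orientation and the colours. The blue edges form a plane tree $T_{\mathrm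 b}(S)$ containing $A_{\mathrm b}$ and all inner vertices. **The walk.** For $S\in\mathcal S_n$ let $\mathcal P_S$ be the closed path that starts in the outer face, enters an inner face through $\overline{A_{\mathrm r}A_{\mathrm g}}$, crosses all edges incident to $A_{\mathrm g}$ in clockwise order, enters the outer face through $\overline{A_{\mathrm g}A_{\mathrm b}}$, enters an inner face through $\overline{A_{\mathrm g}A_{\mathrm b}}$, follows the contour of $T_{\mathrm b}(S)$ clockwise (traversing each blue edge once along each of its sides, and crossing every other edge it meets), enters the outer face through $\overline{A_{\mathrm b}A_{\mathrm r}}$, enters an inner face through $\overline{A_{\mathrm b}A_{\mathrm r}}$, crosses the edges incident to $A_{\mathrm r}$ in clockwise order, enters the outer face through $\overline{A_{\mathrm r}A_{\mathrm g}}$, and returns to its starting point. Let $\varphi(S)$ be the walk on $\mathbb Z^2$ that starts at $(0,0)$ and makes a step $(1,-1)$ whenever $\mathcal P_S$ traverses a blue edge for the second time, a step $(-1,0)$ whenever $\mathcal P_S$ crosses a red edge for the second time, and a step $(0,1)$ whenever $\mathcal P_S$ crosses a green edge for the second time. Let $\mathcal W_n$ be the set of walks on $\mathbb Z^2$ with $3n$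 steps, each equal to $(0,1)$, $(-1,0)$ or $(1,-1)$, that start and end at $(0,0)$, stay in the closed first quadrant, and have no $(1,-1)$-step immediately preceded by a $(-1,0)$-step. **Theorem.** We have $\varphi(S)\in\mathcal W_n$ for all $S\in\mathcal S_n$, and $\varphi:\mathcal S_n\to\mathcal W_n$ is a bijection. -/

import Mathlib

/-- The three colours of a Schnyder wood. -/
inductive WoodColor
  | blue
  | red
  | green
  deriving DecidableEq

/-- The cyclic order blue, green, red, which is the clockwise order of the outgoing edges at an
inner vertex and of the three outer vertices. -/
def WoodColor.cw : WoodColor → WoodColor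
  | .blue => .green
  | .green => .red
  | .red => .blue

/-- A combinatorial map, given by its darts (half-edges, equivalently directed edges).
`rev d` is the dart `d` reversed, and `rot d` is the dart which follows `d` in the clockwise
cyclic order of the darts that leave the tail of `d`. -/
structure CombinatorialMap (D : Type) where
  rot : Equiv.Perm D
  rev : Equiv.Perm D
  rev_rev : ∀ d, rev (rev d) = d
  rev_ne : ∀ d, rev d ≠ d

namespace CombinatorialMap

variable {D : Type} (M : CombinatorialMap D)

/-- The permutation `d ↦ rot (rev d)`. Its cycles are the boundaries of the faces: `d` is followed
by the next dart along the face which lies on the left of `d`. -/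
def face : Equiv.Perm D := M.rev.trans M.rot

/-- The vertices are the cycles of `rot`. -/
abbrev Vertex : Type := Quotient (Equiv.Perm.SameCycle.setoid M.rot)

/-- The edges are the cycles of `rev`. -/
abbrev Edge : Type := Quotient (Equiv.Perm.SameCycle.setoid M.rev)

/-- The faces are the cycles of `face`. -/
abbrev Face : Type := Quotient (Equiv.Perm.SameCycle.setoid M.face)

/-- The vertex from which a dart leaves. -/
def tail (d : D) : M.Vertex := Quotient.mk _ d

/-- The vertex to which a dart points. -/
def head (d : D) : M.Vertex := M.tail (M.rev d)

/-- The underlying graph is connected: `rot` and `rev` generate a transitive group. -/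
def IsConnected : Prop :=
  ∀ d d' : D, ∃ g ∈ Subgroup.closure {M.rot, M.rev}, g d = d'

/-- The map is planar (drawn on the sphere): it is connected and Euler's formula
`V - E + F = 2` holds. -/
def IsPlanar : Prop :=
  M.IsConnected ∧ Nat.card M.Vertex + Nat.card M.Face = Nat.card M.Edge + 2

/-- No loops and no multiple edges. -/
def IsSimple : Prop :=
  (∀ d, M.tail d ≠ M.head d) ∧
    ∀ d d', M.tail d = M.tail d' → M.head d = M.head d' → d = d'

/-- Every face is bounded by three edges, that is, every cycle of `face` has length three. -/
def IsTriangulation : Prop :=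
  ∀ d, M.face d ≠ d ∧ M.face (M.face (M.face d)) = d

end CombinatorialMap

/-- A simple plane triangulation with darts `D`, with outer vertices `A_b`, `A_r`, `A_g` in
counterclockwise order. The outer face and the names of its three vertices are recorded by the dart
`root` from `A_b` to `A_g`, on whose left the outer face lies. -/
structure PlaneTriangulation (D : Type) extends CombinatorialMap D where
  finite : Finite D
  planar : toCombinatorialMap.IsPlanar
  simple : toCombinatorialMap.IsSimple
  triangulation : toCombinatorialMap.IsTriangulation
  root : D

namespace PlaneTriangulation

variable {D : Type} (T : PlaneTriangulation D)

/-- The three darts `A_b → A_g`, `A_g → A_r`, `A_r → A_b` which have the outer face on their left,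
indexed by the colour of their tail. -/
def outerDart : WoodColor → D
  | .blue => T.root
  | .green => T.face T.root
  | .red => T.face (T.face T.root)

/-- The outer vertices `A_b`, `A_r`, `A_g`. -/
def outerVertex (c : WoodColor) : T.Vertex := T.tail (T.outerDart c)

/-- An inner vertex is a vertex other than `A_b`, `A_r`, `A_g`. -/
def IsInnerVertex (v : T.Vertex) : Prop := ∀ c, v ≠ T.outerVertex c

/-- The dart `d` belongs to one of the three outer edges. -/
def IsOuterEdge (d : D) : Prop := ∃ c, d = T.outerDart c ∨ d = T.rev (T.outerDart c)

/-- The size is the number of inner vertices. -/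
noncomputable def size : ℕ := Nat.card {v : T.Vertex // T.IsInnerVertex v}

end PlaneTriangulation

/-- A Schnyder wood on a plane triangulation: a 3-orientation of the inner edges together with a
colouring of the inner edges which satisfies Schnyder's rule. -/
structure SchnyderWood {D : Type} (T : PlaneTriangulation D) where
  /-- The set of darts that are directed along the orientation. -/
  out : Set D
  /-- The colour of the edge of a dart; `none` for the outer edges. -/
  color : D → Option WoodColor
  color_eq_none_iff : ∀ d, color d = none ↔ T.IsOuterEdge d
  color_rev : ∀ d, color (T.rev d) = color d
  not_out_of_outer : ∀ d, T.IsOuterEdge d → d ∉ out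
  /-- Each inner edge is directed in exactly one of the two ways. -/
  out_rev_iff : ∀ d, ¬ T.IsOuterEdge d → (T.rev d ∈ out ↔ d ∉ out)
  /-- Every inner vertex has out-degree three. -/
  out_degree : ∀ v, T.IsInnerVertex v → {d | T.tail d = v ∧ d ∈ out}.ncard = 3
  /-- Clockwise around an inner vertex, an outgoing edge of colour `c` is followed by some number
  `m ≥ 0` of incoming edges of colour `c.cw.cw` and then by an outgoing edge of colour `c.cw`.
  So the clockwise order is: the outgoing blue edge, the incoming red edges, the outgoing green
  edge, the incoming blue edges, the outgoing red edge, the incoming green edges. -/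
  rule : ∀ d c, T.IsInnerVertex (T.tail d) → d ∈ out → color d = some c →
    ∃ m : ℕ,
      (∀ j, 0 < j → j ≤ m →
        (T.rot ^ j) d ∉ out ∧ color ((T.rot ^ j) d) = some c.cw.cw) ∧
      (T.rot ^ (m + 1)) d ∈ out ∧ color ((T.rot ^ (m + 1)) d) = some c.cw
  /-- The inner edges at the outer vertex of colour `c` enter it and have colour `c`. -/
  outer_rule : ∀ d c, ¬ T.IsOuterEdge d → T.tail d = T.outerVertex c →
    d ∉ out ∧ color d = some c

namespace SchnyderWood

variable {D : Type} {T : PlaneTriangulation D} (O : SchnyderWood T)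

open Classical in
/-- One move of the exploration path `P_S`. The path meets the darts one after the other; to meet
the dart `d` is to come to the left side of `d`, near its tail.
* If `d` is one of the outer darts `A_g → A_b`, `A_b → A_r`, `A_r → A_g`, which have the outer face
  on their right, the path crosses the edge of `d` into the outer face and then meets the same edge
  at its other end.
* If the edge of `d` is blue, the path follows it to its other end, keeping it on the right, and
  there meets the next dart in clockwise order.
* In all other cases the path crosses the edge of `d` and meets the next dart in clockwise order
  around the same vertex. -/
noncomputable def move (d : D) : D :=
  if ∃ c, T.rev d = T.outerDart c then T.rev d
  else if O.color d = some .blue then T.rot (T.rev d)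
  else T.rot d

/-- The dart met by `P_S` at time `k`. The path starts in the outer face and first crosses the
outer edge `A_g → A_r` near `A_g`. -/
noncomputable def path (k : ℕ) : D := O.move^[k] (T.outerDart .green)

/-- The number of darts met by `P_S` before it returns to its starting point. -/
noncomputable def pathLength : ℕ := Function.minimalPeriod O.move (T.outerDart .green)

/-- The edge met at time `k` is met for the second time: the path has met its other dart before. -/
def IsSecondVisit (k : ℕ) : Prop := ∃ j < k, O.path j = T.rev (O.path k)

/-- The lattice step which corresponds to a colour. -/
def colorStep : WoodColor → ℤ × ℤ
  | .blue => (1, -1)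
  | .red => (-1, 0)
  | .green => (0, 1)

open Classical in
/-- The steps of the walk: whenever `P_S` crosses or traverses an inner edge for the second time,
the walk makes the step which corresponds to the colour of that edge. -/
noncomputable def steps : List (ℤ × ℤ) :=
  (List.range O.pathLength).filterMap fun k =>
    if O.IsSecondVisit k then (O.color (O.path k)).map colorStep else none

/-- The successive positions of the walk, which starts at the origin. -/
noncomputable def walk : List (ℤ × ℤ) := O.steps.scanl (· + ·) (0, 0)

end SchnyderWood

/-- A size-`n` triangulation together with a Schnyder wood on it, before identifying maps that
differ by a homeomorphism. -/
structure WoodedTriangulation (n : ℕ) where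
  Dart : Type
  map : PlaneTriangulation Dart
  size_eq : map.size = n
  wood : SchnyderWood map

namespace WoodedTriangulation

variable {n : ℕ}

/-- An isomorphism of wooded triangulations: a bijection of the darts which preserves the clockwise
order at the vertices, the edges, the outer face with its named vertices, the orientation and the
colours. It corresponds to an orientation-preserving homeomorphism. -/
structure Iso (S S' : WoodedTriangulation n) where
  toEquiv : S.Dart ≃ S'.Dart
  rot : ∀ d, toEquiv (S.map.rot d) = S'.map.rot (toEquiv d)
  rev : ∀ d, toEquiv (S.map.rev d) = S'.map.rev (toEquiv d)
  root : toEquiv S.map.root = S'.map.root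
  out : ∀ d, d ∈ S.wood.out ↔ toEquiv d ∈ S'.wood.out
  color : ∀ d, S'.wood.color (toEquiv d) = S.wood.color d

namespace Iso

variable {S S' : WoodedTriangulation n}

theorem outerDart (e : Iso S S') (c : WoodColor) : e.toEquiv (S.map.outerDart c) = S'.map.outerDart c := by
  cases c <;>
    simp [PlaneTriangulation.outerDart, CombinatorialMap.face, e.rot, e.rev, e.root]

theorem move (e : Iso S S') (d : S.Dart) : e.toEquiv (S.wood.move d) = S'.wood.move (e.toEquiv d) := by
  have h : (∃ c, S.map.rev d = S.map.outerDart c) ↔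
      ∃ c, S'.map.rev (e.toEquiv d) = S'.map.outerDart c := by
    refine exists_congr fun c => ?_
    rw [← e.outerDart, ← e.rev, e.toEquiv.apply_eq_iff_eq]
  unfold SchnyderWood.move
  rw [e.color]
  by_cases h1 : ∃ c, S.map.rev d = S.map.outerDart c
  · rw [if_pos h1, if_pos (h.1 h1), e.rev]
  · rw [if_neg h1, if_neg (mt h.2 h1)]
    split_ifs <;> simp [e.rot, e.rev]

theorem iterate (e : Iso S S') (k : ℕ) (d : S.Dart) :
    e.toEquiv (S.wood.move^[k] d) = S'.wood.move^[k] (e.toEquiv d) := by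
  induction k with
  | zero => rfl
  | succ k ih => rw [Function.iterate_succ_apply', Function.iterate_succ_apply', e.move, ih]

theorem path (e : Iso S S') (k : ℕ) : e.toEquiv (S.wood.path k) = S'.wood.path k := by
  unfold SchnyderWood.path
  rw [e.iterate, e.outerDart]

theorem pathLength (e : Iso S S') : S.wood.pathLength = S'.wood.pathLength := by
  unfold SchnyderWood.pathLength
  rw [Function.minimalPeriod_eq_minimalPeriod_iff]
  intro k
  unfold Function.IsPeriodicPt Function.IsFixedPt
  rw [← e.outerDart, ← e.iterate, e.toEquiv.apply_eq_iff_eq]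

theorem isSecondVisit (e : Iso S S') (k : ℕ) : S.wood.IsSecondVisit k ↔ S'.wood.IsSecondVisit k := by
  unfold SchnyderWood.IsSecondVisit
  refine exists_congr fun j => and_congr_right fun _ => ?_
  rw [← e.path, ← e.path, ← e.rev, e.toEquiv.apply_eq_iff_eq]

theorem walk (e : Iso S S') : S.wood.walk = S'.wood.walk := by
  unfold SchnyderWood.walk SchnyderWood.steps
  rw [e.pathLength]
  congr 2
  funext k
  rw [← e.path k, e.color]
  by_cases hk : S.wood.IsSecondVisit k
  · rw [if_pos hk, if_pos ((e.isSecondVisit k).1 hk)]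
  · rw [if_neg hk, if_neg (mt (e.isSecondVisit k).2 hk)]

end Iso

/-- Two wooded triangulations are identified if there is an isomorphism between them. -/
instance isoSetoid (n : ℕ) : Setoid (WoodedTriangulation n) where
  r S S' := Nonempty (Iso S S')
  iseqv :=
    { refl := fun _ => ⟨⟨Equiv.refl _, fun _ => rfl, fun _ => rfl, rfl, fun _ => Iff.rfl,
        fun _ => rfl⟩⟩
      symm := by
        rintro S S' ⟨e⟩
        refine ⟨⟨e.toEquiv.symm, fun d => ?_, fun d => ?_, ?_, fun d => ?_, fun d => ?_⟩⟩
        · rw [Equiv.symm_apply_eq, e.rot, Equiv.apply_symm_apply]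
        · rw [Equiv.symm_apply_eq, e.rev, Equiv.apply_symm_apply]
        · rw [Equiv.symm_apply_eq, e.root]
        · rw [e.out, Equiv.apply_symm_apply]
        · rw [← e.color, Equiv.apply_symm_apply]
      trans := by
        rintro S S' S'' ⟨e⟩ ⟨f⟩
        refine ⟨⟨e.toEquiv.trans f.toEquiv, fun d => ?_, fun d => ?_, ?_, fun d => ?_,
          fun d => ?_⟩⟩
        · simp [e.rot, f.rot]
        · simp [e.rev, f.rev]
        · simp [e.root, f.root]
        · simp [e.out, f.out]
        · simp [e.color, f.color] }

end WoodedTriangulation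

/-- The set `𝒮ₙ` of wooded triangulations of size `n`. -/
def WoodedMaps (n : ℕ) : Type 1 := Quotient (WoodedTriangulation.isoSetoid n)

/-- The map `φ`, which sends a wooded triangulation to its walk. -/
noncomputable def woodToWalk (n : ℕ) : WoodedMaps n → List (ℤ × ℤ) :=
  Quotient.lift (fun S : WoodedTriangulation n => S.wood.walk)
    fun _ _ ⟨e⟩ => e.walk

/-- The set `𝒲ₙ` of walks `Z₀, Z₁, …, Z₃ₙ` on `ℤ²`, given by their lists of positions. -/
def latticeWalks (n : ℕ) : Set (List (ℤ × ℤ)) :=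
  {Z | ∃ h : Z.length = 3 * n + 1,
    -- it starts and ends at the origin
    Z[0] = (0, 0) ∧ Z[3 * n] = (0, 0) ∧
    -- it stays in the closed first quadrant
    (∀ p ∈ Z, 0 ≤ p.1 ∧ 0 ≤ p.2) ∧
    -- it has steps of three types
    (∀ (k : ℕ) (hk : k < 3 * n),
      Z[k + 1] - Z[k] = (0, 1) ∨ Z[k + 1] - Z[k] = (-1, 0) ∨ Z[k + 1] - Z[k] = (1, -1)) ∧
    -- no step `(1, -1)` comes immediately after a step `(-1, 0)`
    ∀ (k : ℕ) (hk : k + 1 < 3 * n),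
      ¬ (Z[k + 1] - Z[k] = (-1, 0) ∧ Z[k + 2] - Z[k + 1] = (1, -1))}

/-! Schnyder's rule cuts the surroundings of an inner vertex into three sectors, each bounded by
outgoing edges and named after the colour of the incoming edges that it may contain. Give every
corner of an inner face the colour of its sector, and every inner corner at an outer vertex the
colour of that vertex. Each inner face then carries each of the three labels exactly once
(`SchnyderWood.Corner.face`). A dart is determined by the corner at the left of its tail, so the map
is known once every dart has been assigned its corner.

Call the second meeting of an edge its closing. The path closes an edge when it meets an incoming
red, an outgoing green or an outgoing blue dart. Closing a green or blue edge leads into a new face,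
numbered by that closing; closing a red edge leads back into an older one. Two stacks record the
edges met once: `blues` grows when a green letter confirms that the path has climbed to a new vertex
and shrinks when the path returns along its outgoing blue edge; `reds` grows at the same blue
letter, since the path has just turned from the outgoing red to the outgoing blue edge of that
vertex, and shrinks at red letters. Which pending edge is closed is forced locally: its end is the
vertex on top of the stack, and a vertex has only one outgoing edge of each colour
(`IsOut.eq_of_tail_eq`, `IsExploredBy.invariant`). No Jordan curve argument is needed. The two
coordinates of the walk are the heights of `reds` and `blues`, so it stays in the quadrant; both
stacks are empty at the end. A blue closing always follows the discovery of a face, so never a red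
closing.

Injectivity: the sequence of colours determines the corner of each dart (`wordDart_eq_keyDart`),
hence the face permutation. By connectedness the closed edges and the outer edges are all the edges,
so two wooded triangulations with the same word are isomorphic.

Surjectivity: for a word satisfying the stack conditions, the same rules assign corners to abstract
darts. A count shows that this is a bijection (`IsGoodWord.cornerKey_injective`), which defines a
map. Explicit vertex labels, again read off the stacks, show that it is simple; counting gives
Euler's formula; the corner labels give Schnyder's rule. Exploring this map reproduces the word
(`IsGoodWord.closingDart_eq`). -/

theorem WoodColor.cw_cw_cw (c : WoodColor) : c.cw.cw.cw = c := by cases c <;> rfl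

theorem WoodColor.cw_injective : Function.Injective WoodColor.cw := by
  intro a b; cases a <;> cases b <;> simp [WoodColor.cw]

theorem WoodColor.cw_ne (c : WoodColor) : c.cw ≠ c := by cases c <;> simp [WoodColor.cw]

theorem WoodColor.cw_cw_ne (c : WoodColor) : c.cw.cw ≠ c := by cases c <;> simp [WoodColor.cw]

instance : Fintype WoodColor :=
  ⟨{.blue, .red, .green}, by intro c; cases c <;> simp⟩

/-! ### Words and the two stacks of the exploration -/

/-- The state of the exploration of a wooded triangulation. The inner faces are numbered in the
order in which they are discovered. `last` is the face discovered last, `top` the face which is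
about to be left, `reds` the faces with a pending red edge, `blues` the faces with a pending blue
edge, together with the time at which the tail of that edge was discovered. -/
structure ExplorationState where
  last : ℕ
  top : ℕ
  reds : List ℕ
  blues : List (ℕ × ℕ)

namespace ExplorationState

/-- The effect of the letter number `j` on the state of the exploration. -/
def step (s : ExplorationState) (j : ℕ) : WoodColor → ExplorationState
  | .green => ⟨j + 1, j + 1, s.reds, (s.last, j) :: s.blues⟩
  | .blue => ⟨j + 1, j + 1, j :: s.reds, s.blues.tail⟩
  | .red => ⟨s.last, s.reds.headD 0, s.reds.tail, s.blues⟩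

end ExplorationState

open ExplorationState

/-- The state after `j` letters of the word `w`. -/
def explState (w : ℕ → WoodColor) : ℕ → ExplorationState
  | 0 => ⟨0, 0, [], []⟩
  | j + 1 => (explState w j).step j (w j)

/-- The words of length `N` which encode wooded triangulations. -/
structure IsGoodWord (w : ℕ → WoodColor) (N : ℕ) : Prop where
  red_ne : ∀ j < N, w j = .red → (explState w j).reds ≠ []
  blue_ne : ∀ j < N, w j = .blue → (explState w j).blues ≠ []
  no_red_blue : ∀ j, j + 1 < N → w j = .red → w (j + 1) ≠ .blue
  reds_end : (explState w N).reds = []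
  blues_end : (explState w N).blues = []

section State

variable {w : ℕ → WoodColor} {j : ℕ}

theorem explState_green (h : w j = .green) : explState w (j + 1) =
    ⟨j + 1, j + 1, (explState w j).reds, ((explState w j).last, j) :: (explState w j).blues⟩ := by
  simp [explState, h, step]

theorem explState_blue (h : w j = .blue) : explState w (j + 1) =
    ⟨j + 1, j + 1, j :: (explState w j).reds, (explState w j).blues.tail⟩ := by
  simp [explState, h, step]

theorem explState_red (h : w j = .red) : explState w (j + 1) =
    ⟨(explState w j).last, (explState w j).reds.headD 0, (explState w j).reds.tail,
      (explState w j).blues⟩ := by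
  simp [explState, h, step]

theorem explState_congr {w' : ℕ → WoodColor} {N : ℕ} (h : ∀ j < N, w j = w' j) :
    ∀ j ≤ N, explState w j = explState w' j := by
  intro j
  induction j with
  | zero => intro _; rfl
  | succ j ih => intro hj; simp only [explState]; rw [ih (by omega), h j (by omega)]

theorem last_eq_of_ne_red (h : w j ≠ .red) : (explState w (j + 1)).last = j + 1 := by
  cases hw : w j
  · rw [explState_blue hw]
  · exact absurd hw h
  · rw [explState_green hw]

theorem top_eq_of_ne_red (h : w j ≠ .red) : (explState w (j + 1)).top = j + 1 := by
  cases hw : w j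
  · rw [explState_blue hw]
  · exact absurd hw h
  · rw [explState_green hw]

/-- Only red letters fail to discover a face, and they leave `blues` and `last` unchanged. So the
state at the time of the last discovery still describes these two components. -/
theorem last_spec (w : ℕ → WoodColor) (j : ℕ) :
    (explState w j).last ≤ j ∧
      (explState w (explState w j).last).blues = (explState w j).blues ∧
      (∀ i, (explState w j).last ≤ i → i < j → w i = .red) ∧
      (explState w (explState w j).last).last = (explState w j).last := by
  induction j with
  | zero => simp [explState]
  | succ j ih =>
    by_cases h : w j = .red
    · rw [explState_red h]
      refine ⟨by have := ih.1; simp only; omega, ih.2.1, fun i hi hij => ?_, ih.2.2.2⟩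
      rcases Nat.lt_succ_iff_lt_or_eq.1 hij with h' | rfl
      · exact ih.2.2.1 i hi h'
      · exact h
    · rw [last_eq_of_ne_red h]
      refine ⟨le_rfl, rfl, fun i hi hij => by omega, last_eq_of_ne_red h⟩

/-- What lies below an entry of a stack is untouched as long as the entry is there, so it is the
stack as it was when the entry was pushed. This lets facts about time `k` be used again when `k` is
popped. -/
theorem reds_spec {k : ℕ} {R : List ℕ} (h : k :: R <:+ (explState w j).reds) :
    k < j ∧ w k = .blue ∧ (explState w k).reds = R := by
  induction j with
  | zero => simp [explState] at h
  | succ j ih =>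
    cases hw : w j
    · rw [explState_blue hw] at h
      rcases List.suffix_cons_iff.1 h with h | h
      · rw [List.cons.injEq] at h
        obtain ⟨rfl, rfl⟩ := h
        exact ⟨by omega, hw, rfl⟩
      · have := ih h; exact ⟨by omega, this.2⟩
    · rw [explState_red hw] at h
      have := ih (h.trans (List.tail_suffix _)); exact ⟨by omega, this.2⟩
    · rw [explState_green hw] at h
      have := ih h; exact ⟨by omega, this.2⟩

theorem blues_spec {k i : ℕ} {B : List (ℕ × ℕ)} (h : (k, i) :: B <:+ (explState w j).blues) :
    i < j ∧ w i = .green ∧ (explState w i).last = k ∧ (explState w i).blues = B := by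
  induction j with
  | zero => simp [explState] at h
  | succ j ih =>
    cases hw : w j
    · rw [explState_blue hw] at h
      have := ih (h.trans (List.tail_suffix _)); exact ⟨by omega, this.2⟩
    · rw [explState_red hw] at h
      have := ih h; exact ⟨by omega, this.2⟩
    · rw [explState_green hw] at h
      rcases List.suffix_cons_iff.1 h with h | h
      · rw [List.cons.injEq, Prod.mk.injEq] at h
        obtain ⟨⟨rfl, rfl⟩, rfl⟩ := h
        exact ⟨by omega, hw, rfl, rfl⟩
      · have := ih h; exact ⟨by omega, this.2⟩

theorem exists_suffix_of_mem {α : Type*} {a : α} {l : List α} (h : a ∈ l) : ∃ t, a :: t <:+ l := by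
  obtain ⟨s, t, rfl⟩ := List.append_of_mem h
  exact ⟨t, List.suffix_append _ _⟩

theorem mem_reds {k : ℕ} (h : k ∈ (explState w j).reds) : k < j ∧ w k = .blue := by
  obtain ⟨t, ht⟩ := exists_suffix_of_mem h
  exact ⟨(reds_spec ht).1, (reds_spec ht).2.1⟩

theorem blues_cons_spec {k i : ℕ} {B : List (ℕ × ℕ)} (h : (explState w j).blues = (k, i) :: B) :
    k ≤ i ∧ i < j ∧ w i = .green ∧ (explState w i).last = k ∧ (explState w k).last = k ∧
      (explState w i).blues = B ∧ (explState w k).blues = B ∧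
      ∀ i', k ≤ i' → i' < i → w i' = .red := by
  obtain ⟨h1, h2, h3, h4⟩ := blues_spec (w := w) (j := j) ⟨[], h.symm⟩
  obtain ⟨l1, l2, l3, l4⟩ := last_spec w i
  rw [h3] at l1 l2 l3 l4
  exact ⟨l1, h1, h2, h3, l4, h4, l2.trans h4, l3⟩

theorem mem_blues_of_le {j' : ℕ} (hj : j ≤ j') {x : ℕ × ℕ} (hx : x ∈ (explState w j').blues) :
    x ∈ (explState w j).blues ∨ j ≤ x.2 := by
  induction j', hj using Nat.le_induction with
  | base => exact Or.inl hx
  | succ j' hj ih =>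
    cases hw : w j'
    · rw [explState_blue hw] at hx
      exact ih (List.mem_of_mem_tail hx)
    · rw [explState_red hw] at hx
      exact ih hx
    · rw [explState_green hw] at hx
      rcases List.mem_cons.1 hx with rfl | hx
      · exact Or.inr hj
      · exact ih hx

theorem mem_blues_lt {x : ℕ × ℕ} (hx : x ∈ (explState w j).blues) : x.2 < j := by
  obtain ⟨t, ht⟩ := exists_suffix_of_mem hx
  exact (blues_spec ht).1

end State

namespace IsGoodWord

variable {w : ℕ → WoodColor} {N j : ℕ} (hw : IsGoodWord w N)

include hw

/-- This is where the ban on a blue letter after a red one enters: a blue letter finds the path in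
the face that has just been discovered. -/
theorem fresh_of_blue (hj : j < N) (h : w j = .blue) :
    (explState w j).last = j ∧ (explState w j).top = j := by
  cases j with
  | zero => exact ⟨rfl, rfl⟩
  | succ j =>
    have h' : w j ≠ .red := fun h' => hw.no_red_blue j hj h' h
    exact ⟨last_eq_of_ne_red h', top_eq_of_ne_red h'⟩

theorem exists_reds (hj : j < N) (h : w j = .red) :
    ∃ k R, (explState w j).reds = k :: R ∧ k < j ∧ w k = .blue ∧ (explState w k).reds = R ∧
      (explState w k).last = k ∧ (explState w k).top = k := by
  obtain ⟨k, R, h'⟩ := List.exists_cons_of_ne_nil (hw.red_ne j hj h)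
  obtain ⟨h1, h2, h3⟩ := reds_spec (w := w) (j := j) ⟨[], h'.symm⟩
  obtain ⟨h4, h5⟩ := hw.fresh_of_blue (h1.trans hj) h2
  exact ⟨k, R, h', h1, h2, h3, h4, h5⟩

/-- After a red letter `top` is the popped face, and by `reds_spec` the remaining stack is the one
of the time of its discovery. -/
theorem top_spec (hj : j ≤ N) : (explState w j).top ≤ j ∧
    (explState w (explState w j).top).reds = (explState w j).reds := by
  cases j with
  | zero => simp [explState]
  | succ j =>
    by_cases h : w j = .red
    · obtain ⟨k, R, h1, h2, -, h3, -, -⟩ := hw.exists_reds hj h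
      rw [explState_red h, h1]
      exact ⟨by simp only [List.headD_cons]; omega, h3⟩
    · rw [top_eq_of_ne_red h]
      exact ⟨le_rfl, rfl⟩

end IsGoodWord

/-! ### Darts and corners of a word, matched by counting -/

/-- The darts of the wooded triangulation encoded by a word of length `N`. The inner edges are
numbered in the order in which the exploration path closes them. The dart `(e, true)` is the one
at which it does so. -/
abbrev WordDart (N : ℕ) : Type := (Fin N ⊕ WoodColor) × Bool

/-- The corners of the inner faces, given by the number of the face and the label of the corner,
and the corners of the outer face. -/
abbrev CornerKey : Type := (ℕ × WoodColor) ⊕ WoodColor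

/-- The next corner along the same face. -/
def CornerKey.next : CornerKey → CornerKey
  | .inl (k, c) => .inl (k, c.cw.cw)
  | .inr c => .inr c.cw

theorem CornerKey.next_injective : Function.Injective CornerKey.next := by
  rintro (⟨k, c⟩ | c) (⟨k', c'⟩ | c') h <;> simp [CornerKey.next] at h ⊢
  · exact ⟨h.1, WoodColor.cw_injective (WoodColor.cw_injective h.2)⟩
  · exact WoodColor.cw_injective h

/-- The corner at the left of the tail of a dart. -/
def cornerKey (w : ℕ → WoodColor) (N : ℕ) : WordDart N → CornerKey
  | (.inl j, true) =>
    if w j = .blue then .inl (j + 1, .green) else .inl ((explState w j).top, .red)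
  | (.inl j, false) =>
    match w j with
    | .green => .inl (j + 1, .green)
    | .blue => .inl (((explState w j).blues.headD (0, 0)).1, .blue)
    | .red => .inl ((explState w j).reds.headD 0, .blue)
  | (.inr .blue, true) => .inl (0, .green)
  | (.inr .red, true) => .inl ((explState w N).last, .blue)
  | (.inr .green, true) => .inl ((explState w N).top, .red)
  | (.inr c, false) => .inr c

/-- The numbers of the inner faces. -/
def wordFaces (w : ℕ → WoodColor) (N : ℕ) : Finset ℕ :=
  insert 0 (((Finset.range N).filter fun j => w j ≠ .red).map ⟨Nat.succ, Nat.succ_injective⟩)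

/-- The corners of the faces of the wooded triangulation encoded by a word. -/
def wordCorners (w : ℕ → WoodColor) (N : ℕ) : Finset CornerKey :=
  (wordFaces w N ×ˢ Finset.univ).disjSum Finset.univ

theorem mem_wordFaces {w : ℕ → WoodColor} {N k : ℕ} :
    k ∈ wordFaces w N ↔ k = 0 ∨ ∃ j < N, w j ≠ .red ∧ j + 1 = k := by
  simp [wordFaces, and_assoc]

theorem next_mem_wordCorners {w : ℕ → WoodColor} {N : ℕ} {x : CornerKey}
    (hx : x ∈ wordCorners w N) : x.next ∈ wordCorners w N := by
  rcases x with ⟨k, c⟩ | c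
  · simpa [wordCorners, CornerKey.next] using hx
  · simp [wordCorners, CornerKey.next]

section Counting

variable {w : ℕ → WoodColor} {N : ℕ}

theorem IsGoodWord.length_spec (hw : IsGoodWord w N) : ∀ j ≤ N,
    (explState w j).reds.length + ((Finset.range j).filter fun i => w i = .red).card =
        ((Finset.range j).filter fun i => w i = .blue).card ∧
      (explState w j).blues.length + ((Finset.range j).filter fun i => w i = .blue).card =
        ((Finset.range j).filter fun i => w i = .green).card := by
  intro j
  induction j with
  | zero => simp [explState]
  | succ j ih =>
    intro hj
    obtain ⟨h1, h2⟩ := ih (by omega)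
    simp only [Finset.range_add_one, Finset.filter_insert]
    cases h : w j
    · have := List.length_pos_iff.2 (hw.blue_ne j (by omega) h)
      rw [explState_blue h]
      simp
      omega
    · have := List.length_pos_iff.2 (hw.red_ne j (by omega) h)
      rw [explState_red h]
      simp
      omega
    · rw [explState_green h]
      simp
      omega

theorem card_filter_add (w : ℕ → WoodColor) (j : ℕ) :
    ((Finset.range j).filter fun i => w i = .red).card +
      ((Finset.range j).filter fun i => w i = .blue).card +
        ((Finset.range j).filter fun i => w i = .green).card = j := by
  induction j with
  | zero => simp
  | succ j ih =>
    simp only [Finset.range_add_one, Finset.filter_insert]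
    cases h : w j <;> simp <;> omega

/-- Both stacks end empty, so each has as many pushes as pops: there are as many greens as blues and
as many blues as reds. -/
theorem IsGoodWord.card_eq (hw : IsGoodWord w N) :
    3 * ((Finset.range N).filter fun i => w i = .red).card = N ∧
    3 * ((Finset.range N).filter fun i => w i = .green).card = N := by
  have h := hw.length_spec N le_rfl
  rw [hw.reds_end, hw.blues_end] at h
  have h' := card_filter_add w N
  simp only [List.length_nil] at h
  omega

/-- With `N = 3n` there are `2n + 1` inner faces, hence `3(2n + 1) + 3` corners, and `2(3n + 3)`
darts. -/
theorem IsGoodWord.card_wordCorners (hw : IsGoodWord w N) :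
    (wordCorners w N).card = Fintype.card (WordDart N) := by
  have h : ((Finset.range N).filter fun i => w i = .red).card +
      ((Finset.range N).filter fun i => w i ≠ .red).card = N := by
    rw [Finset.card_filter_add_card_filter_not, Finset.card_range]
  have hC : Fintype.card WoodColor = 3 := rfl
  have h0 : (0 : ℕ) ∉ ((Finset.range N).filter fun j => w j ≠ .red).map
      ⟨Nat.succ, Nat.succ_injective⟩ := by simp
  have h3 := hw.card_eq.1
  simp only [wordCorners, wordFaces, Finset.card_disjSum, Finset.card_product, Finset.card_univ, hC,
    Finset.card_insert_of_notMem h0, Finset.card_map, Fintype.card_prod, Fintype.card_sum,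
    Fintype.card_fin, Fintype.card_bool]
  omega

end Counting

section Bijection

variable {w : ℕ → WoodColor} {N : ℕ}

/-- The corner `x` is the corner of one of the edges closed before time `j`. -/
def IsCovered (w : ℕ → WoodColor) (N j : ℕ) (x : CornerKey) : Prop :=
  ∃ i : Fin N, i.1 < j ∧ ∃ b, cornerKey w N (.inl i, b) = x

theorem IsCovered.succ {j : ℕ} {x : CornerKey} (h : IsCovered w N j x) :
    IsCovered w N (j + 1) x := by
  obtain ⟨i, hi, h⟩ := h
  exact ⟨i, by omega, h⟩

theorem cornerKey_true_of_blue {j : Fin N} (h : w j = .blue) :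
    cornerKey w N (.inl j, true) = .inl (j + 1, .green) := by simp [cornerKey, h]

theorem cornerKey_true_of_ne_blue {j : Fin N} (h : w j ≠ .blue) :
    cornerKey w N (.inl j, true) = .inl ((explState w j).top, .red) := by simp [cornerKey, h]

theorem cornerKey_false_of_green {j : Fin N} (h : w j = .green) :
    cornerKey w N (.inl j, false) = .inl (j + 1, .green) := by simp [cornerKey, h]

theorem cornerKey_false_of_blue {j : Fin N} (h : w j = .blue) :
    cornerKey w N (.inl j, false) = .inl (((explState w j).blues.headD (0, 0)).1, .blue) := by
  simp [cornerKey, h]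

theorem cornerKey_false_of_red {j : Fin N} (h : w j = .red) :
    cornerKey w N (.inl j, false) = .inl ((explState w j).reds.headD 0, .blue) := by
  simp [cornerKey, h]

/-- The state lists exactly the corners that still wait for a dart. A face on `reds` waits for both
its blue and its red corner: popping it fills the blue one and makes it `top`, whose red corner is
filled next. When the stacks are empty only the blue corner of `last` and the red corner of `top`
are left, and these go to outer edges. -/
theorem IsGoodWord.covered_spec (hw : IsGoodWord w N) (j : ℕ) (hj : j ≤ N) (k : ℕ)
    (hk : k = 0 ∨ ∃ i < j, w i ≠ .red ∧ i + 1 = k) :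
    (IsCovered w N j (.inl (k, .blue)) ∨ k = (explState w j).last ∨ k ∈ (explState w j).reds ∨
      ∃ x ∈ (explState w j).blues, x.1 = k) ∧
    (IsCovered w N j (.inl (k, .red)) ∨ k = (explState w j).top ∨ k ∈ (explState w j).reds) := by
  induction j with
  | zero =>
    obtain rfl : k = 0 := by simpa using hk
    simp [explState]
  | succ j ih =>
    by_cases hk' : k = 0 ∨ ∃ i < j, w i ≠ .red ∧ i + 1 = k
    · obtain ⟨h1, h2⟩ := ih (by omega) hk'
      cases h : w j
      · obtain ⟨f1, f2⟩ := hw.fresh_of_blue (by omega) h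
        obtain ⟨⟨k', i⟩, B, hB⟩ := List.exists_cons_of_ne_nil (hw.blue_ne j (by omega) h)
        rw [explState_blue h]
        rw [f1, hB] at h1
        rw [f2] at h2
        simp only [hB, List.tail_cons, List.mem_cons] at h1 ⊢
        constructor
        · rcases h1 with h1 | h1 | h1 | ⟨x, rfl | hx, hx'⟩
          · exact Or.inl h1.succ
          · exact Or.inr (Or.inr (Or.inl (Or.inl h1)))
          · exact Or.inr (Or.inr (Or.inl (Or.inr h1)))
          · refine Or.inl ⟨⟨j, by omega⟩, by simp, false, ?_⟩
            rw [cornerKey_false_of_blue h]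
            simp only [hB, List.headD_cons]
            rw [← hx']
          · exact Or.inr (Or.inr (Or.inr ⟨x, hx, hx'⟩))
        · rcases h2 with h2 | h2 | h2
          · exact Or.inl h2.succ
          · exact Or.inr (Or.inr (Or.inl h2))
          · exact Or.inr (Or.inr (Or.inr h2))
      · obtain ⟨k', R, hR, -⟩ := hw.exists_reds (by omega) h
        rw [explState_red h]
        rw [hR] at h1 h2
        simp only [hR, List.tail_cons, List.headD_cons, List.mem_cons] at h1 h2 ⊢
        constructor
        · rcases h1 with h1 | h1 | (rfl | h1) | h1
          · exact Or.inl h1.succ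
          · exact Or.inr (Or.inl h1)
          · refine Or.inl ⟨⟨j, by omega⟩, by simp, false, ?_⟩
            rw [cornerKey_false_of_red h]
            simp [hR]
          · exact Or.inr (Or.inr (Or.inl h1))
          · exact Or.inr (Or.inr (Or.inr h1))
        · rcases h2 with h2 | rfl | h2 | h2
          · exact Or.inl h2.succ
          · refine Or.inl ⟨⟨j, by omega⟩, by simp, true, ?_⟩
            rw [cornerKey_true_of_ne_blue (by simp [h])]
          · exact Or.inr (Or.inl h2)
          · exact Or.inr (Or.inr h2)
      · rw [explState_green h]
        simp only [List.mem_cons]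
        constructor
        · rcases h1 with h1 | rfl | h1 | ⟨x, hx, hx'⟩
          · exact Or.inl h1.succ
          · exact Or.inr (Or.inr (Or.inr ⟨_, Or.inl rfl, rfl⟩))
          · exact Or.inr (Or.inr (Or.inl h1))
          · exact Or.inr (Or.inr (Or.inr ⟨x, Or.inr hx, hx'⟩))
        · rcases h2 with h2 | rfl | h2
          · exact Or.inl h2.succ
          · refine Or.inl ⟨⟨j, by omega⟩, by simp, true, ?_⟩
            rw [cornerKey_true_of_ne_blue (by simp [h])]
          · exact Or.inr (Or.inr h2)
    · obtain ⟨h, rfl⟩ : w j ≠ .red ∧ j + 1 = k := by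
        rcases hk with hk | ⟨i, hi, h⟩
        · exact absurd (Or.inl hk) hk'
        · rcases Nat.lt_succ_iff_lt_or_eq.1 hi with hi | rfl
          · exact absurd (Or.inr ⟨i, hi, h⟩) hk'
          · exact h
      rw [last_eq_of_ne_red h, top_eq_of_ne_red h]
      simp

theorem IsGoodWord.wordCorners_subset (hw : IsGoodWord w N) :
    wordCorners w N ⊆ Finset.univ.image (cornerKey w N) := by
  intro x hx
  simp only [Finset.mem_image, Finset.mem_univ, true_and]
  rcases x with ⟨k, c⟩ | c
  · simp only [wordCorners, Finset.inl_mem_disjSum, Finset.mem_product, Finset.mem_univ,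
      and_true, mem_wordFaces] at hx
    obtain ⟨h1, h2⟩ := hw.covered_spec N le_rfl k hx
    rw [hw.reds_end, hw.blues_end] at h1
    rw [hw.reds_end] at h2
    simp only [List.not_mem_nil, false_and, exists_false, or_false,] at h1 h2
    cases c
    · rcases h1 with ⟨i, -, b, h⟩ | h1
      · exact ⟨_, h⟩
      · exact ⟨(.inr .red, true), by simp [cornerKey, h1]⟩
    · rcases h2 with ⟨i, -, b, h⟩ | h2
      · exact ⟨_, h⟩
      · exact ⟨(.inr .green, true), by simp [cornerKey, h2]⟩
    · rcases hx with rfl | ⟨j, hj, h, rfl⟩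
      · exact ⟨(.inr .blue, true), by simp [cornerKey]⟩
      · by_cases h' : w j = .blue
        · exact ⟨(.inl ⟨j, hj⟩, true), by simp [cornerKey, h']⟩
        · have : w j = .green := by cases h'' : w j <;> simp_all
          exact ⟨(.inl ⟨j, hj⟩, false), by simp [cornerKey, this]⟩
  · exact ⟨(.inr c, false), by cases c <;> rfl⟩

theorem IsGoodWord.image_cornerKey (hw : IsGoodWord w N) :
    Finset.univ.image (cornerKey w N) = wordCorners w N := by
  refine (Finset.eq_of_subset_of_card_le hw.wordCorners_subset ?_).symm
  rw [hw.card_wordCorners]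
  exact Finset.card_image_le

/-- Surjectivity onto a set with as many elements as there are darts yields injectivity, without
comparing the cases of `cornerKey` with each other. -/
theorem IsGoodWord.cornerKey_injective (hw : IsGoodWord w N) :
    Function.Injective (cornerKey w N) := by
  rw [← Set.injOn_univ, ← Finset.coe_univ, ← Finset.card_image_iff, hw.image_cornerKey,
    hw.card_wordCorners, Finset.card_univ]

theorem IsGoodWord.exists_cornerKey_eq_next (hw : IsGoodWord w N) (d : WordDart N) :
    ∃ d', cornerKey w N d' = (cornerKey w N d).next := by
  have h : cornerKey w N d ∈ wordCorners w N := by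
    rw [← hw.image_cornerKey]; exact Finset.mem_image_of_mem _ (Finset.mem_univ _)
  have h' := next_mem_wordCorners h
  rw [← hw.image_cornerKey] at h'
  simpa using h'

end Bijection

/-! ### Elementary facts about the outer triangle -/

namespace PlaneTriangulation

variable {D : Type} (T : PlaneTriangulation D)

theorem face_apply (d : D) : T.face d = T.rot (T.rev d) := rfl

theorem face_rev (d : D) : T.face (T.rev d) = T.rot d := by rw [face_apply, T.rev_rev]

theorem face_face_face (d : D) : T.face (T.face (T.face d)) = d := (T.triangulation d).2

theorem tail_rot (d : D) : T.tail (T.rot d) = T.tail d :=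
  Quotient.sound (Equiv.Perm.SameCycle.symm ⟨1, by simp⟩)

theorem tail_pow_rot (d : D) (i : ℕ) : T.tail ((T.rot ^ i) d) = T.tail d := by
  induction i with
  | zero => rfl
  | succ i ih => rw [pow_succ', Equiv.Perm.mul_apply, tail_rot, ih]

theorem tail_face (d : D) : T.tail (T.face d) = T.tail (T.rev d) := T.tail_rot _

theorem face_outerDart (c : WoodColor) : T.face (T.outerDart c) = T.outerDart c.cw := by
  cases c
  · rfl
  · exact T.face_face_face _
  · rfl

theorem rot_rev_outerDart (c : WoodColor) : T.rot (T.rev (T.outerDart c)) = T.outerDart c.cw :=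
  T.face_outerDart c

theorem tail_rev_outerDart (c : WoodColor) :
    T.tail (T.rev (T.outerDart c)) = T.outerVertex c.cw := by
  rw [← tail_face, face_outerDart]; rfl

theorem outerVertex_ne_cw (c : WoodColor) : T.outerVertex c ≠ T.outerVertex c.cw := by
  rw [← tail_rev_outerDart]; exact T.simple.1 _

theorem outerVertex_injective : Function.Injective T.outerVertex := by
  have h1 := T.outerVertex_ne_cw .blue
  have h2 := T.outerVertex_ne_cw .red
  have h3 := T.outerVertex_ne_cw .green
  intro c c' h
  cases c <;> cases c' <;> simp_all [WoodColor.cw]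

theorem outerDart_injective : Function.Injective T.outerDart := fun _ _ h =>
  T.outerVertex_injective (congrArg T.tail h)

theorem outerDart_ne_rev (c c' : WoodColor) : T.outerDart c ≠ T.rev (T.outerDart c') := by
  intro h
  have h1 : T.outerVertex c = T.outerVertex c'.cw := by
    rw [← tail_rev_outerDart, ← h]; rfl
  have h2 : T.outerVertex c.cw = T.outerVertex c' := by
    rw [← tail_rev_outerDart, h, T.rev_rev]; rfl
  have h3 := T.outerVertex_injective h1
  have h4 := T.outerVertex_injective h2
  subst h3
  exact WoodColor.cw_cw_ne _ h4

theorem isOuterEdge_outerDart (c : WoodColor) : T.IsOuterEdge (T.outerDart c) := ⟨c, Or.inl rfl⟩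

theorem isOuterEdge_rev_outerDart (c : WoodColor) : T.IsOuterEdge (T.rev (T.outerDart c)) :=
  ⟨c, Or.inr rfl⟩

theorem rev_eq_iff {d d' : D} : T.rev d = d' ↔ d = T.rev d' :=
  ⟨fun h => by rw [← h, T.rev_rev], fun h => by rw [h, T.rev_rev]⟩

theorem isOuterEdge_rev {d : D} : T.IsOuterEdge (T.rev d) ↔ T.IsOuterEdge d := by
  refine exists_congr fun c => ?_
  rw [T.rev_eq_iff, T.rev.apply_eq_iff_eq, or_comm]

theorem not_isInnerVertex_iff {v : T.Vertex} :
    ¬ T.IsInnerVertex v ↔ ∃ c, v = T.outerVertex c := by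
  simp [IsInnerVertex]

theorem not_isInnerVertex_outerVertex (c : WoodColor) : ¬ T.IsInnerVertex (T.outerVertex c) :=
  fun h => h c rfl

theorem IsOuterEdge.not_isInnerVertex {T : PlaneTriangulation D} {d : D} (h : T.IsOuterEdge d) :
    ¬ T.IsInnerVertex (T.tail d) := by
  rw [not_isInnerVertex_iff]
  obtain ⟨c, rfl | rfl⟩ := h
  · exact ⟨c, rfl⟩
  · exact ⟨_, T.tail_rev_outerDart c⟩

theorem exists_pow_rot_of_tail_eq {d d' : D} (h : T.tail d = T.tail d') :
    ∃ i : ℕ, (T.rot ^ i) d = d' := by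
  have := T.finite
  have h' : Equiv.Perm.SameCycle T.rot d d' := Quotient.exact h
  obtain ⟨i, -, hi⟩ := h'.exists_pow_eq'
  exact ⟨i, hi⟩

end PlaneTriangulation

/-! ### Local structure of a Schnyder wood: outgoing edges and corner labels -/

namespace SchnyderWood

open PlaneTriangulation

variable {D : Type} {T : PlaneTriangulation D} (O : SchnyderWood T)

/-- The dart `d` is directed along the orientation and has colour `c`. -/
def IsOut (c : WoodColor) (d : D) : Prop := d ∈ O.out ∧ O.color d = some c

/-- The dart `d` is directed against the orientation and has colour `c`. -/
def IsIn (c : WoodColor) (d : D) : Prop := d ∉ O.out ∧ O.color d = some c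

variable {O} {c c' : WoodColor} {d d' : D}

theorem not_isOuterEdge_of_color (h : O.color d = some c) : ¬ T.IsOuterEdge d := by
  rw [← O.color_eq_none_iff, h]; simp

theorem IsOut.not_isOuterEdge (h : O.IsOut c d) : ¬ T.IsOuterEdge d :=
  not_isOuterEdge_of_color h.2

theorem IsIn.not_isOuterEdge (h : O.IsIn c d) : ¬ T.IsOuterEdge d :=
  not_isOuterEdge_of_color h.2

theorem isOut_rev : O.IsOut c (T.rev d) ↔ O.IsIn c d := by
  unfold IsOut IsIn
  rw [O.color_rev, and_congr_left_iff]
  intro h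
  exact O.out_rev_iff d (not_isOuterEdge_of_color h)

theorem isIn_rev : O.IsIn c (T.rev d) ↔ O.IsOut c d := by
  rw [← isOut_rev, T.rev_rev]

variable (O) in
theorem outer_or_out_or_in (d : D) :
    T.IsOuterEdge d ∨ (∃ c, O.IsOut c d) ∨ ∃ c, O.IsIn c d := by
  rcases hc : O.color d with _ | c
  · exact Or.inl ((O.color_eq_none_iff d).1 hc)
  · by_cases h : d ∈ O.out
    · exact Or.inr (Or.inl ⟨c, h, hc⟩)
    · exact Or.inr (Or.inr ⟨c, h, hc⟩)

theorem IsOut.color_eq (h : O.IsOut c d) (h' : O.IsOut c' d) : c = c' := by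
  have := h.2.symm.trans h'.2; simpa using this

theorem IsIn.color_eq (h : O.IsIn c d) (h' : O.IsIn c' d) : c = c' := by
  have := h.2.symm.trans h'.2; simpa using this

theorem IsOut.not_isIn (h : O.IsOut c d) : ¬ O.IsIn c' d := fun h' => h'.1 h.1

theorem IsOut.isInnerVertex (h : O.IsOut c d) : T.IsInnerVertex (T.tail d) := by
  by_contra h'
  obtain ⟨c', h'⟩ := T.not_isInnerVertex_iff.1 h'
  exact (O.outer_rule d c' h.not_isOuterEdge h').1 h.1

theorem IsIn.eq_of_tail (h : O.IsIn c d) (h' : T.tail d = T.outerVertex c') : c = c' := by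
  have := h.2.symm.trans (O.outer_rule d c' h.not_isOuterEdge h').2; simpa using this

/-- The clockwise run of darts which starts with an outgoing dart. -/
structure IsRun (O : SchnyderWood T) (c : WoodColor) (d : D) (m : ℕ) : Prop where
  isOut : O.IsOut c d
  isIn : ∀ j, 0 < j → j ≤ m → O.IsIn c.cw.cw ((T.rot ^ j) d)
  isOut_end : O.IsOut c.cw ((T.rot ^ (m + 1)) d)

theorem IsOut.exists_isRun (h : O.IsOut c d) : ∃ m, O.IsRun c d m := by
  obtain ⟨m, h1, h2⟩ := O.rule d c h.isInnerVertex h.1 h.2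
  exact ⟨m, h, h1, h2⟩

theorem exists_isOut (hd : T.IsInnerVertex (T.tail d)) : ∃ c d', O.IsOut c d' ∧
    T.tail d' = T.tail d := by
  have h := O.out_degree _ hd
  obtain ⟨d', h'⟩ : {d' | T.tail d' = T.tail d ∧ d' ∈ O.out}.Nonempty := by
    rw [Set.nonempty_iff_ne_empty]
    intro h0
    simp [h0] at h
  rcases O.outer_or_out_or_in d' with h1 | ⟨c, h1⟩ | ⟨c, h1⟩
  · exact absurd h'.2 (O.not_out_of_outer _ h1)
  · exact ⟨c, d', h1, h'.1⟩
  · exact absurd h'.2 h1.1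

theorem exists_isRun (hd : T.IsInnerVertex (T.tail d)) : ∃ c d' m j, O.IsRun c d' m ∧ j ≤ m ∧
    (T.rot ^ j) d' = d := by
  obtain ⟨c, d', h, h'⟩ := exists_isOut (O := O) hd
  obtain ⟨i, rfl⟩ := T.exists_pow_rot_of_tail_eq h'
  clear hd h'
  induction i with
  | zero => obtain ⟨m, hm⟩ := h.exists_isRun; exact ⟨c, d', m, 0, hm, by omega, rfl⟩
  | succ i ih =>
    obtain ⟨c, d'', m, j, hm, hj, hd⟩ := ih
    rw [pow_succ', Equiv.Perm.mul_apply, ← hd, ← Equiv.Perm.mul_apply, ← pow_succ']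
    rcases hj.lt_or_eq with hj | rfl
    · exact ⟨c, d'', m, j + 1, hm, hj, rfl⟩
    · obtain ⟨m, hm'⟩ := hm.isOut_end.exists_isRun
      exact ⟨_, _, m, 0, hm', by omega, rfl⟩

theorem IsOut.exists_cw (h : O.IsOut c d) : ∃ d', O.IsOut c.cw d' ∧ T.tail d' = T.tail d := by
  obtain ⟨m, hm⟩ := h.exists_isRun
  exact ⟨_, hm.isOut_end, T.tail_pow_rot _ _⟩

theorem exists_isOut_color (hd : T.IsInnerVertex (T.tail d)) (c : WoodColor) :
    ∃ d', O.IsOut c d' ∧ T.tail d' = T.tail d := by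
  obtain ⟨c0, d0, h0, t0⟩ := exists_isOut (O := O) hd
  obtain ⟨d1, h1, t1⟩ := h0.exists_cw
  obtain ⟨d2, h2, t2⟩ := h1.exists_cw
  have : c = c0 ∨ c = c0.cw ∨ c = c0.cw.cw := by cases c <;> cases c0 <;> simp [WoodColor.cw]
  rcases this with rfl | rfl | rfl
  · exact ⟨d0, h0, t0⟩
  · exact ⟨d1, h1, t1.trans t0⟩
  · exact ⟨d2, h2, t2.trans (t1.trans t0)⟩

theorem IsOut.eq_of_tail_eq (h : O.IsOut c d) (h' : O.IsOut c d') (ht : T.tail d = T.tail d') :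
    d = d' := by
  have := T.finite
  have hv := h.isInnerVertex
  choose f hf hft using fun c => exists_isOut_color (O := O) hv c
  have hinj : Function.Injective f := fun a b hab => (hf a).color_eq (hab ▸ hf b)
  have hsub : Set.range f ⊆ {x | T.tail x = T.tail d ∧ x ∈ O.out} := by
    rintro _ ⟨a, rfl⟩; exact ⟨hft a, (hf a).1⟩
  have heq : Set.range f = {x | T.tail x = T.tail d ∧ x ∈ O.out} := by
    refine Set.eq_of_subset_of_ncard_le hsub ?_ (Set.toFinite _)
    rw [O.out_degree _ hv, ← Set.image_univ, Set.ncard_image_of_injective _ hinj,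
      Set.ncard_univ, Nat.card_eq_fintype_card]
    rfl
  have key : ∀ x, O.IsOut c x → T.tail x = T.tail d → x = f c := by
    intro x hx hxt
    have : x ∈ Set.range f := by rw [heq]; exact ⟨hxt, hx.1⟩
    obtain ⟨a, rfl⟩ := this
    rw [(hf a).color_eq hx]
  rw [key d h rfl, key d' h' ht.symm]

theorem IsOut.rot (h : O.IsOut c d) : O.IsIn c.cw.cw (T.rot d) ∨ O.IsOut c.cw (T.rot d) := by
  obtain ⟨m, hm⟩ := h.exists_isRun
  rcases m with _ | m
  · exact Or.inr hm.isOut_end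
  · exact Or.inl (hm.isIn 1 (by omega) (by omega))

theorem IsIn.rot_of_isInnerVertex (h : O.IsIn c d) (hd : T.IsInnerVertex (T.tail d)) :
    O.IsIn c (T.rot d) ∨ O.IsOut c.cw.cw (T.rot d) := by
  obtain ⟨c', d', m, j, hm, hj, rfl⟩ := exists_isRun (O := O) hd
  rw [← Equiv.Perm.mul_apply, ← pow_succ']
  have hj0 : 0 < j := by
    rcases Nat.eq_zero_or_pos j with rfl | hj0
    · exact absurd h hm.isOut.not_isIn
    · exact hj0
  obtain rfl := (hm.isIn j hj0 hj).color_eq h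
  rcases hj.lt_or_eq with hj | rfl
  · exact Or.inl (hm.isIn _ (by omega) hj)
  · refine Or.inr ?_
    rw [WoodColor.cw_cw_cw]
    exact hm.isOut_end

/-- Every dart of the colour `c.cw.cw` which enters the tail of `d` belongs to the run of `d`. -/
theorem IsRun.exists_of_isIn {m : ℕ} (h : O.IsRun c d m) (h' : O.IsIn c.cw.cw d')
    (ht : T.tail d' = T.tail d) : ∃ j, 0 < j ∧ j ≤ m ∧ (T.rot ^ j) d = d' := by
  obtain ⟨c', d'', m', j, hm, hj, rfl⟩ :=
    exists_isRun (O := O) (d := d') (ht ▸ h.isOut.isInnerVertex)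
  have hj0 : 0 < j := by
    rcases Nat.eq_zero_or_pos j with rfl | hj0
    · exact absurd h' hm.isOut.not_isIn
    · exact hj0
  obtain rfl := WoodColor.cw_injective (WoodColor.cw_injective ((hm.isIn j hj0 hj).color_eq h'))
  rw [T.tail_pow_rot] at ht
  obtain rfl := hm.isOut.eq_of_tail_eq h.isOut ht
  refine ⟨j, hj0, ?_, rfl⟩
  by_contra hlt
  exact h.isOut_end.not_isIn (hm.isIn (m + 1) (by omega) (by omega))

/-- The corner at the left of the tail of `d` has the label `c`. -/
def Corner (O : SchnyderWood T) (c : WoodColor) (d : D) : Prop :=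
  O.IsIn c d ∨ ∃ c', c = c'.cw ∧ (O.IsOut c' d ∨ d = T.rev (T.outerDart c'))

theorem IsIn.corner (h : O.IsIn c d) : O.Corner c d := Or.inl h

theorem IsOut.corner (h : O.IsOut c d) : O.Corner c.cw d := Or.inr ⟨c, rfl, Or.inl h⟩

variable (O) in
theorem corner_rev_outerDart (c : WoodColor) : O.Corner c.cw (T.rev (T.outerDart c)) :=
  Or.inr ⟨c, rfl, Or.inr rfl⟩

theorem corner_outerVertex (h : T.tail d = T.outerVertex c) (hd : d ≠ T.outerDart c) :
    O.Corner c d := by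
  by_cases ho : T.IsOuterEdge d
  · obtain ⟨c', rfl | rfl⟩ := ho
    · exact absurd (congrArg _ (T.outerVertex_injective h)) hd
    · rw [T.tail_rev_outerDart] at h
      rw [← T.outerVertex_injective h]
      exact O.corner_rev_outerDart c'
  · exact Or.inl (O.outer_rule d c ho h)

theorem rot_eq_outerDart_iff : T.rot d = T.outerDart c ↔ d = T.rev (T.outerDart c.cw.cw) := by
  have h := T.rot_rev_outerDart c.cw.cw
  rw [WoodColor.cw_cw_cw] at h
  rw [← h, T.rot.apply_eq_iff_eq]

/-- At an inner head the rule says in which sector the dart after the reversed one lies; at an outer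
head the only corner without that vertex's label belongs to the outer face. Iterating, an inner face
has the labels green, blue, red in the order of `face`. -/
theorem Corner.face (h : O.Corner c d) : O.Corner c.cw.cw (T.face d) := by
  rw [T.face_apply]
  by_cases hv : T.IsInnerVertex (T.tail (T.rev d))
  · rcases h with h | ⟨c', rfl, h | rfl⟩
    · rcases (isOut_rev.2 h).rot with h' | h'
      · exact h'.corner
      · exact h'.corner
    · rw [WoodColor.cw_cw_cw]
      rcases (isIn_rev.2 h).rot_of_isInnerVertex hv with h' | h'
      · exact h'.corner
      · have := h'.corner; rwa [WoodColor.cw_cw_cw] at this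
    · rw [T.rev_rev] at hv
      exact absurd hv (T.isOuterEdge_outerDart _).not_isInnerVertex
  · obtain ⟨c1, hc1⟩ := T.not_isInnerVertex_iff.1 hv
    have hc : c.cw.cw = c1 ∧ ∀ c', d ≠ T.outerDart c' := by
      rcases h with h | ⟨c', rfl, h | rfl⟩
      · exact absurd (isOut_rev.2 h).isInnerVertex hv
      · rw [WoodColor.cw_cw_cw]
        refine ⟨(isIn_rev.2 h).eq_of_tail hc1, ?_⟩
        rintro c'' rfl
        exact h.not_isOuterEdge (T.isOuterEdge_outerDart _)
      · rw [T.rev_rev] at hc1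
        rw [WoodColor.cw_cw_cw]
        exact ⟨T.outerVertex_injective hc1, fun c'' h => T.outerDart_ne_rev _ _ h.symm⟩
    obtain ⟨rfl, hc⟩ := hc
    refine corner_outerVertex ((T.tail_rot _).trans hc1) fun h => ?_
    rw [rot_eq_outerDart_iff, T.rev.apply_eq_iff_eq] at h
    exact hc _ h

theorem corner_green_iff : O.Corner .green d ↔
    O.IsIn .green d ∨ O.IsOut .blue d ∨ d = T.rev (T.outerDart .blue) := by
  constructor
  · rintro (h | ⟨c', h, h'⟩)
    · exact Or.inl h
    · obtain rfl : c' = .blue := by cases c' <;> simp [WoodColor.cw] at h ⊢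
      exact Or.inr h'
  · rintro (h | h)
    · exact Or.inl h
    · exact Or.inr ⟨.blue, rfl, h⟩

theorem corner_blue_iff : O.Corner .blue d ↔
    O.IsIn .blue d ∨ O.IsOut .red d ∨ d = T.rev (T.outerDart .red) := by
  constructor
  · rintro (h | ⟨c', h, h'⟩)
    · exact Or.inl h
    · obtain rfl : c' = .red := by cases c' <;> simp [WoodColor.cw] at h ⊢
      exact Or.inr h'
  · rintro (h | h)
    · exact Or.inl h
    · exact Or.inr ⟨.red, rfl, h⟩

theorem corner_red_iff : O.Corner .red d ↔
    O.IsIn .red d ∨ O.IsOut .green d ∨ d = T.rev (T.outerDart .green) := by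
  constructor
  · rintro (h | ⟨c', h, h'⟩)
    · exact Or.inl h
    · obtain rfl : c' = .green := by cases c' <;> simp [WoodColor.cw] at h ⊢
      exact Or.inr h'
  · rintro (h | h)
    · exact Or.inl h
    · exact Or.inr ⟨.green, rfl, h⟩

end SchnyderWood

/-! ### The exploration path and its closings -/

namespace SchnyderWood

open PlaneTriangulation

variable {D : Type} {T : PlaneTriangulation D} {O : SchnyderWood T} {c c' : WoodColor} {d d' : D}

section Move

variable (O) in
theorem move_rev_outerDart (c : WoodColor) :
    O.move (T.rev (T.outerDart c)) = T.outerDart c := by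
  unfold move
  rw [T.rev_rev, if_pos ⟨c, rfl⟩]

variable (O) in
theorem move_outerDart (c : WoodColor) : O.move (T.outerDart c) = T.rot (T.outerDart c) := by
  unfold move
  rw [if_neg, if_neg]
  · rw [(O.color_eq_none_iff _).2 (T.isOuterEdge_outerDart c)]; simp
  · rintro ⟨c', h⟩
    exact T.outerDart_ne_rev _ _ h.symm

theorem not_exists_rev_eq (h : ¬ T.IsOuterEdge d) : ¬ ∃ c, T.rev d = T.outerDart c := by
  rintro ⟨c, hc⟩
  exact h ⟨c, Or.inr (by rw [← hc, T.rev_rev])⟩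

theorem move_of_color_ne (h : O.color d = some c) (hc : c ≠ .blue) : O.move d = T.rot d := by
  unfold move
  rw [if_neg (not_exists_rev_eq (not_isOuterEdge_of_color h)), h, if_neg (by simpa using hc)]

theorem move_of_color_blue (h : O.color d = some .blue) : O.move d = T.face d := by
  unfold move
  rw [if_neg (not_exists_rev_eq (not_isOuterEdge_of_color h)), if_pos h]
  rfl

variable (O) in
theorem move_surjective : Function.Surjective O.move := by
  intro y
  by_cases h : ∃ c, T.outerDart c = y
  · obtain ⟨c, rfl⟩ := h
    exact ⟨_, O.move_rev_outerDart c⟩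
  · obtain ⟨x, rfl⟩ := T.rot.surjective y
    have hx : ¬ ∃ c, T.rev x = T.outerDart c := by
      rintro ⟨c, hc⟩
      rw [T.rev_eq_iff] at hc
      exact h ⟨_, by rw [hc, T.rot_rev_outerDart]⟩
    by_cases hc : O.color x = some .blue
    · refine ⟨T.rev x, ?_⟩
      rw [move_of_color_blue (by rw [O.color_rev, hc]), T.face_rev]
    · refine ⟨x, ?_⟩
      unfold move
      rw [if_neg hx, if_neg hc]

variable (O) in
-- Finiteness turns the explicit preimages into injectivity. The path is therefore purely periodic
-- and returns to its start.
theorem move_injective : Function.Injective O.move := by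
  have := T.finite
  exact Finite.injective_iff_surjective.2 O.move_surjective

end Move

section Path

variable (O)

theorem path_zero : O.path 0 = T.outerDart .green := rfl

theorem path_succ (k : ℕ) : O.path (k + 1) = O.move (O.path k) :=
  Function.iterate_succ_apply' _ _ _

theorem pathLength_pos : 0 < O.pathLength := by
  have := T.finite
  exact Function.minimalPeriod_pos_of_mem_periodicPts (O.move_injective.mem_periodicPts _)

theorem path_add_pathLength (k : ℕ) : O.path (k + O.pathLength) = O.path k :=
  Function.iterate_add_minimalPeriod_eq

theorem path_add_mul_pathLength (k i : ℕ) : O.path (k + i * O.pathLength) = O.path k := by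
  induction i with
  | zero => simp
  | succ i ih => rw [Nat.succ_mul, ← add_assoc, path_add_pathLength, ih]

variable {O} in
theorem path_injective {i j : ℕ} (hi : i < O.pathLength) (hj : j < O.pathLength)
    (h : O.path i = O.path j) : i = j :=
  Function.iterate_injOn_Iio_minimalPeriod hi hj h

theorem path_pathLength_sub_one :
    O.path (O.pathLength - 1) = T.rev (T.outerDart .green) := by
  apply O.move_injective
  rw [← path_succ, Nat.sub_add_cancel O.pathLength_pos, move_rev_outerDart]
  have h := O.path_add_pathLength 0
  rw [zero_add] at h
  exact h

variable {O} in
theorem path_add_eq_pow_rot {t m : ℕ}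
    (h : ∀ i ≤ m, O.move ((T.rot ^ i) (O.path t)) = T.rot ((T.rot ^ i) (O.path t))) :
    ∀ i ≤ m + 1, O.path (t + i) = (T.rot ^ i) (O.path t) := by
  intro i
  induction i with
  | zero => intro _; rfl
  | succ i ih =>
    intro hi
    rw [← add_assoc, path_succ, ih (by omega), h i (by omega), pow_succ', Equiv.Perm.mul_apply]

end Path

section Closing

/-- The exploration path closes the edge of `d` when it meets `d`. -/
def IsClosing (O : SchnyderWood T) (d : D) : Prop :=
  O.IsIn .red d ∨ O.IsOut .green d ∨ O.IsOut .blue d ∨ d = T.rev (T.outerDart .blue)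

theorem IsIn.not_isClosing (h : O.IsIn c d) (hc : c ≠ .red) : ¬ O.IsClosing d := by
  rintro (h' | h' | h' | rfl)
  · exact hc (h.color_eq h')
  · exact h'.not_isIn h
  · exact h'.not_isIn h
  · exact h.not_isOuterEdge (T.isOuterEdge_rev_outerDart _)

theorem IsOut.not_isClosing (h : O.IsOut .red d) : ¬ O.IsClosing d := by
  rintro (h' | h' | h' | rfl)
  · exact h.not_isIn h'
  · exact absurd (h.color_eq h') (by simp)
  · exact absurd (h.color_eq h') (by simp)
  · exact h.not_isOuterEdge (T.isOuterEdge_rev_outerDart _)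

theorem not_isClosing_of_isOuterEdge (h : T.IsOuterEdge d) (hd : d ≠ T.rev (T.outerDart .blue)) :
    ¬ O.IsClosing d := by
  rintro (h' | h' | h' | h')
  · exact h'.not_isOuterEdge h
  · exact h'.not_isOuterEdge h
  · exact h'.not_isOuterEdge h
  · exact hd h'

/-- The path meets `d` without closing an edge or coming to its end. -/
def IsIdle (O : SchnyderWood T) (d : D) : Prop :=
  ¬ O.IsClosing d ∧ d ≠ T.rev (T.outerDart .green)

theorem ne_rev_outerDart_of_not_isOuterEdge (h : ¬ T.IsOuterEdge d) :
    d ≠ T.rev (T.outerDart c) := by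
  rintro rfl
  exact h (T.isOuterEdge_rev_outerDart _)

theorem IsIn.isIdle (h : O.IsIn c d) (hc : c ≠ .red) : O.IsIdle d :=
  ⟨h.not_isClosing hc, ne_rev_outerDart_of_not_isOuterEdge h.not_isOuterEdge⟩

theorem IsOut.isIdle (h : O.IsOut .red d) : O.IsIdle d :=
  ⟨h.not_isClosing, ne_rev_outerDart_of_not_isOuterEdge h.not_isOuterEdge⟩

variable (O) in
theorem isIdle_outerDart (c : WoodColor) : O.IsIdle (T.outerDart c) :=
  ⟨not_isClosing_of_isOuterEdge (T.isOuterEdge_outerDart c) (T.outerDart_ne_rev _ _),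
    T.outerDart_ne_rev _ _⟩

variable (O) in
theorem isIdle_rev_outerDart_red : O.IsIdle (T.rev (T.outerDart .red)) := by
  refine ⟨not_isClosing_of_isOuterEdge (T.isOuterEdge_rev_outerDart _) fun h => ?_, fun h => ?_⟩
  · exact absurd (T.outerDart_injective (T.rev.injective h)) (by simp)
  · exact absurd (T.outerDart_injective (T.rev.injective h)) (by simp)

theorem IsClosing.ne_rev_outerDart_green (h : O.IsClosing d) :
    d ≠ T.rev (T.outerDart .green) := by
  rintro rfl
  rcases h with h | h | h | h
  · exact h.not_isOuterEdge (T.isOuterEdge_rev_outerDart _)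
  · exact h.not_isOuterEdge (T.isOuterEdge_rev_outerDart _)
  · exact h.not_isOuterEdge (T.isOuterEdge_rev_outerDart _)
  · exact absurd (T.outerDart_injective (T.rev.injective h)) (by simp)

/-- The clockwise tour of the darts at `A_g`, with which the exploration path begins. -/
theorem exists_initial_run (O : SchnyderWood T) : ∃ m,
    (∀ i, 0 < i → i ≤ m → O.IsIn .green ((T.rot ^ i) (T.outerDart .green))) ∧
    (T.rot ^ (m + 1)) (T.outerDart .green) = T.rev (T.outerDart .blue) ∧
    ∀ d, O.IsIn .green d → T.tail d = T.outerVertex .green →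
      ∃ i, 0 < i ∧ i ≤ m ∧ (T.rot ^ i) (T.outerDart .green) = d := by
  classical
  have hex : ∃ i : ℕ, (T.rot ^ i) (T.outerDart .green) = T.rev (T.outerDart .blue) :=
    T.exists_pow_rot_of_tail_eq (T.tail_rev_outerDart .blue).symm
  obtain ⟨m, hm⟩ : ∃ m, Nat.find hex = m + 1 := by
    refine Nat.exists_eq_succ_of_ne_zero fun h0 => ?_
    have := Nat.find_spec hex
    rw [h0, pow_zero, Equiv.Perm.one_apply] at this
    exact T.outerDart_ne_rev _ _ this
  have hend := Nat.find_spec hex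
  have hmin := fun i => Nat.find_min (m := i) hex
  rw [hm] at hend hmin
  refine ⟨m, fun i hi him => ?_, hend, fun d hd ht => ?_⟩
  · have hc : O.Corner .green ((T.rot ^ i) (T.outerDart .green)) := by
      refine corner_outerVertex (T.tail_pow_rot _ _) fun h => ?_
      -- If the tour were back at its start after `i` steps, it would already have reached its end
      -- `i` steps earlier, against minimality.
      refine hmin (m + 1 - i) (by omega) ?_
      rw [← hend]
      conv_rhs => rw [show m + 1 = (m + 1 - i) + i by omega, pow_add, Equiv.Perm.mul_apply, h]
    rcases corner_green_iff.1 hc with h | h | h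
    · exact h
    · have := h.isInnerVertex
      rw [T.tail_pow_rot] at this
      exact absurd this (T.not_isInnerVertex_outerVertex .green)
    · exact absurd h (hmin i (by omega))
  · obtain ⟨k, rfl⟩ := T.exists_pow_rot_of_tail_eq (d := T.outerDart .green) ht.symm
    -- The tour meets `m` incoming green darts and the two outer ones, so exponents may be reduced
    -- modulo `m + 2`.
    have hper : (T.rot ^ (m + 2)) (T.outerDart .green) = T.outerDart .green := by
      rw [pow_succ', Equiv.Perm.mul_apply, hend, T.rot_rev_outerDart]; rfl
    have hper' : ∀ q, (T.rot ^ ((m + 2) * q)) (T.outerDart .green) = T.outerDart .green := by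
      intro q
      induction q with
      | zero => rfl
      | succ q ih => rw [Nat.mul_succ, pow_add, Equiv.Perm.mul_apply, hper, ih]
    rw [← Nat.mod_add_div k (m + 2), pow_add, Equiv.Perm.mul_apply, hper'] at hd ⊢
    have hlt := Nat.mod_lt k (show m + 2 > 0 by omega)
    refine ⟨k % (m + 2), Nat.pos_of_ne_zero fun h0 => ?_, ?_, rfl⟩
    · rw [h0, pow_zero, Equiv.Perm.one_apply] at hd
      exact hd.not_isOuterEdge (T.isOuterEdge_outerDart _)
    · by_contra hgt
      rw [show k % (m + 2) = m + 1 by omega, hend] at hd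
      exact hd.not_isOuterEdge (T.isOuterEdge_rev_outerDart _)

theorem path_initial_run {m : ℕ}
    (hm : ∀ i, 0 < i → i ≤ m → O.IsIn .green ((T.rot ^ i) (T.outerDart .green))) :
    ∀ i ≤ m + 1, O.path i = (T.rot ^ i) (T.outerDart .green) := by
  intro i hi
  have := path_add_eq_pow_rot (O := O) (t := 0) (m := m) (fun i hi => ?_) i hi
  · rwa [zero_add] at this
  · rw [path_zero]
    rcases Nat.eq_zero_or_pos i with rfl | h0
    · rw [pow_zero, Equiv.Perm.one_apply]
      exact O.move_outerDart _
    · exact move_of_color_ne (hm i h0 hi).2 (by simp)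

end Closing

section Times

variable (O)

/-- The path is continued periodically beyond its length, so that `Nat.nth` enumerates an infinite
set and `closingTime` has no default values. -/
theorem infinite_setOf_isClosing : {k | O.IsClosing (O.path k)}.Infinite := by
  obtain ⟨m, h1, h2, -⟩ := O.exists_initial_run
  refine Set.infinite_of_injective_forall_mem (f := fun i => m + 1 + i * O.pathLength)
    (fun i j h => ?_) fun i => ?_
  · have := O.pathLength_pos
    simpa [this.ne'] using h
  · change O.IsClosing _
    rw [path_add_mul_pathLength, path_initial_run h1 _ le_rfl, h2]
    exact Or.inr (Or.inr (Or.inr rfl))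

/-- The time of the closing number `j` of the path. The number zero is that of the outer edge
between `A_g` and `A_b`. -/
noncomputable def closingTime (j : ℕ) : ℕ := Nat.nth (fun k => O.IsClosing (O.path k)) j

/-- The dart which is met by the path at the closing number `j`. -/
noncomputable def closingDart (j : ℕ) : D := O.path (O.closingTime j)

theorem isClosing_closingDart (j : ℕ) : O.IsClosing (O.closingDart j) :=
  Nat.nth_mem_of_infinite O.infinite_setOf_isClosing j

theorem closingTime_strictMono : StrictMono O.closingTime :=
  Nat.nth_strictMono O.infinite_setOf_isClosing

variable {O}

open Classical in
theorem exists_closingTime_eq {k : ℕ} (h : O.IsClosing (O.path k)) : ∃ j, O.closingTime j = k :=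
  ⟨_, Nat.nth_count (p := fun k => O.IsClosing (O.path k)) h⟩

theorem closingTime_succ_eq {j r : ℕ} (hr : 0 < r)
    (h : ∀ i, 0 < i → i < r → ¬ O.IsClosing (O.path (O.closingTime j + i)))
    (hc : O.IsClosing (O.path (O.closingTime j + r))) :
    O.closingTime (j + 1) = O.closingTime j + r := by
  obtain ⟨i, hi⟩ := exists_closingTime_eq hc
  have h1 : j < i := O.closingTime_strictMono.lt_iff_lt.1 (by omega)
  have h2 : ¬ j + 1 < i := fun h2 => by
    have h3 := O.closingTime_strictMono h2
    have h4 := O.closingTime_strictMono (Nat.lt_add_one j)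
    refine h (O.closingTime (j + 1) - O.closingTime j) (by omega) (by omega) ?_
    rw [Nat.add_sub_cancel' h4.le]
    exact O.isClosing_closingDart _
  rw [← hi, show i = j + 1 by omega]

theorem closingTime_zero {m : ℕ}
    (h1 : ∀ i, 0 < i → i ≤ m → O.IsIn .green ((T.rot ^ i) (T.outerDart .green)))
    (h2 : (T.rot ^ (m + 1)) (T.outerDart .green) = T.rev (T.outerDart .blue)) :
    O.closingTime 0 = m + 1 := by
  have hp := path_initial_run h1
  obtain ⟨i, hi⟩ := exists_closingTime_eq (O := O) (k := m + 1) (by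
    rw [hp _ le_rfl, h2]; exact Or.inr (Or.inr (Or.inr rfl)))
  rcases Nat.eq_zero_or_pos i with rfl | h0
  · exact hi
  · have h3 := O.closingTime_strictMono h0
    have h4 : O.IsClosing (O.path (O.closingTime 0)) := O.isClosing_closingDart 0
    rw [hp _ (by omega)] at h4
    rcases Nat.eq_zero_or_pos (O.closingTime 0) with h5 | h5
    · rw [h5, pow_zero, Equiv.Perm.one_apply] at h4
      exact absurd h4 (O.isIdle_outerDart _).1
    · exact absurd h4 ((h1 _ h5 (by omega)).not_isClosing (by simp))

variable (O)

theorem closingDart_zero : O.closingDart 0 = T.rev (T.outerDart .blue) := by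
  obtain ⟨m, h1, h2, -⟩ := O.exists_initial_run
  unfold closingDart
  rw [closingTime_zero h1 h2, path_initial_run h1 _ le_rfl, h2]

theorem closingTime_zero_lt : O.closingTime 0 < O.pathLength := by
  obtain ⟨m, h1, h2, -⟩ := O.exists_initial_run
  rw [closingTime_zero h1 h2]
  by_contra hge
  have h3 := O.path_pathLength_sub_one
  have h4 := O.pathLength_pos
  rw [path_initial_run h1 _ (by omega)] at h3
  rcases Nat.eq_zero_or_pos (O.pathLength - 1) with h5 | h5
  · rw [h5, pow_zero, Equiv.Perm.one_apply] at h3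
    exact T.outerDart_ne_rev _ _ h3
  · exact ((h1 _ h5 (by omega)).isIdle (by simp)).2 h3

variable {O}

theorem closingDart_ne_of_pos {j : ℕ} (hj : 0 < j) (hL : O.closingTime j < O.pathLength) :
    O.closingDart j ≠ T.rev (T.outerDart .blue) := by
  rw [← O.closingDart_zero]
  intro h
  have := path_injective hL O.closingTime_zero_lt h
  have := O.closingTime_strictMono hj
  omega

theorem closingDart_injOn {i j : ℕ} (hi : O.closingTime i < O.pathLength)
    (hj : O.closingTime j < O.pathLength) (h : O.closingDart i = O.closingDart j) : i = j :=
  O.closingTime_strictMono.injective (path_injective hi hj h)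

/-- If the path is idle after the closing number `j` until it comes to a corner with the red
label, then either this is the next closing or the path ends there. -/
theorem next_closing {j r : ℕ} (hj : O.closingTime j < O.pathLength) (hr : 0 < r)
    (h : ∀ i, 0 < i → i < r → O.IsIdle (O.path (O.closingTime j + i)))
    (hc : O.IsClosing (O.path (O.closingTime j + r)) ∨
      O.path (O.closingTime j + r) = T.rev (T.outerDart .green)) :
    (O.IsClosing (O.path (O.closingTime j + r)) ∧
      O.closingDart (j + 1) = O.path (O.closingTime j + r) ∧
      O.closingTime (j + 1) = O.closingTime j + r ∧ O.closingTime (j + 1) < O.pathLength) ∨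
    (O.path (O.closingTime j + r) = T.rev (T.outerDart .green) ∧
      O.pathLength ≤ O.closingTime (j + 1)) := by
  -- The dart at time `pathLength - 1` is the final one, which is neither idle nor closing; so the
  -- period cannot end during the idle stretch.
  have hle : O.closingTime j + r ≤ O.pathLength - 1 := by
    by_contra hlt
    have h3 := O.path_pathLength_sub_one
    rcases Nat.eq_zero_or_pos (O.pathLength - 1 - O.closingTime j) with h0 | h0
    · rw [show O.pathLength - 1 = O.closingTime j by omega] at h3
      exact (O.isClosing_closingDart j).ne_rev_outerDart_green h3
    · refine (h _ h0 (by omega)).2 ?_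
      rw [← h3]
      congr 1
      omega
  rcases hc with hc | hc
  · have h1 := closingTime_succ_eq hr (fun i h0 hi => (h i h0 hi).1) hc
    exact Or.inl ⟨hc, by unfold closingDart; rw [h1], h1, by have := O.pathLength_pos; omega⟩
  · refine Or.inr ⟨hc, ?_⟩
    by_contra hlt
    have h1 := O.closingTime_strictMono (Nat.lt_add_one j)
    have h2 : O.closingTime j + r = O.pathLength - 1 :=
      path_injective (by have := O.pathLength_pos; omega) (by have := O.pathLength_pos; omega)
        (hc.trans O.path_pathLength_sub_one.symm)
    have h3 : O.IsClosing (O.path (O.closingTime (j + 1))) := O.isClosing_closingDart _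
    rcases (show O.closingTime (j + 1) ≤ O.pathLength - 1 by omega).lt_or_eq with h4 | h4
    · refine (h (O.closingTime (j + 1) - O.closingTime j) (by omega) (by omega)).1 ?_
      rwa [Nat.add_sub_cancel' h1.le]
    · rw [h4, ← h2, hc] at h3
      exact h3.ne_rev_outerDart_green rfl

end Times

section FaceDarts

variable (O)

open Classical in
/-- The dart at the green corner of the inner face discovered at the closing number `j`. -/
noncomputable def faceDart (j : ℕ) : D :=
  if O.IsOut .green (O.closingDart j) then T.rev (O.closingDart j) else O.closingDart j

/-- The dart at the corner `c` of the inner face discovered at the closing number `j`. -/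
noncomputable def cornerDart (j : ℕ) : WoodColor → D
  | .green => O.faceDart j
  | .blue => T.face (O.faceDart j)
  | .red => T.face (T.face (O.faceDart j))

theorem face_cornerDart (j : ℕ) (c : WoodColor) :
    T.face (O.cornerDart j c) = O.cornerDart j c.cw.cw := by
  cases c
  · rfl
  · exact T.face_face_face _
  · rfl

theorem tail_cornerDart (j : ℕ) (c : WoodColor) :
    T.tail (O.cornerDart j c.cw.cw) = T.tail (T.rev (O.cornerDart j c)) := by
  rw [← face_cornerDart, T.tail_face]

variable {O}

theorem corner_faceDart {j : ℕ} (h : ¬ O.IsIn .red (O.closingDart j)) :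
    O.Corner .green (O.faceDart j) := by
  unfold faceDart
  rw [corner_green_iff]
  split_ifs with h'
  · exact Or.inl (isIn_rev.2 h')
  · rcases O.isClosing_closingDart j with h1 | h1 | h1 | h1
    · exact absurd h1 h
    · exact absurd h1 h'
    · exact Or.inr (Or.inl h1)
    · exact Or.inr (Or.inr h1)

theorem corner_cornerDart {j : ℕ} (h : ¬ O.IsIn .red (O.closingDart j)) (c : WoodColor) :
    O.Corner c (O.cornerDart j c) := by
  cases c
  · exact (corner_faceDart h).face
  · exact (corner_faceDart h).face.face
  · exact corner_faceDart h

/-- After a closing which discovers a face, the path next comes to the blue corner. -/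
theorem exists_path_eq_cornerDart_blue {j : ℕ} (hj : O.closingTime j < O.pathLength)
    (h : ¬ O.IsIn .red (O.closingDart j)) :
    ∃ r, 0 < r ∧ (∀ i, 0 < i → i < r → O.IsIdle (O.path (O.closingTime j + i))) ∧
      O.path (O.closingTime j + r) = O.cornerDart j .blue := by
  have hsucc : O.path (O.closingTime j + 1) = O.move (O.closingDart j) := O.path_succ _
  rcases Nat.eq_zero_or_pos j with rfl | h0
  -- Closing number zero leads through the outer face, where the path meets the same edge at its
  -- other end. This costs a second move.
  · refine ⟨2, by omega, fun i h1 h2 => ?_, ?_⟩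
    · obtain rfl : i = 1 := by omega
      rw [hsucc, closingDart_zero, move_rev_outerDart]
      exact O.isIdle_outerDart _
    · have hg : ¬ O.IsOut .green (O.closingDart 0) := fun h' => by
        rw [closingDart_zero] at h'
        exact h'.not_isOuterEdge (T.isOuterEdge_rev_outerDart _)
      rw [show O.closingTime 0 + 2 = O.closingTime 0 + 1 + 1 from rfl, path_succ, hsucc]
      unfold cornerDart faceDart
      rw [if_neg hg, closingDart_zero, move_rev_outerDart, move_outerDart, T.face_rev]
  · refine ⟨1, by omega, fun i h1 h2 => by omega, ?_⟩
    rw [hsucc]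
    unfold cornerDart faceDart
    rcases O.isClosing_closingDart j with h1 | h1 | h1 | h1
    · exact absurd h1 h
    · simp only
      rw [if_pos h1, T.face_rev, move_of_color_ne h1.2 (by simp)]
    · simp only
      rw [if_neg fun h' => absurd (h1.color_eq h') (by simp), move_of_color_blue h1.2]
    · exact absurd h1 (closingDart_ne_of_pos h0 hj)

theorem isClosing_or_eq_of_corner_red (h : O.Corner .red d) :
    O.IsClosing d ∨ d = T.rev (T.outerDart .green) := by
  rcases corner_red_iff.1 h with h | h | h
  · exact Or.inl (Or.inl h)
  · exact Or.inl (Or.inr (Or.inl h))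
  · exact Or.inr h

theorem next_of_isIn_red {j : ℕ} (hj : O.closingTime j < O.pathLength)
    (h : O.IsIn .red (O.closingDart j)) :
    (O.IsClosing (T.rot (O.closingDart j)) ∧
      O.closingDart (j + 1) = T.rot (O.closingDart j) ∧ O.closingTime (j + 1) < O.pathLength) ∨
    (T.rot (O.closingDart j) = T.rev (T.outerDart .green) ∧
      O.pathLength ≤ O.closingTime (j + 1)) := by
  have hp : O.path (O.closingTime j + 1) = T.rot (O.closingDart j) := by
    rw [path_succ]; exact move_of_color_ne h.2 (by simp)
  have hc : O.Corner .red (T.rot (O.closingDart j)) := by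
    have := (isOut_rev.2 h).corner.face
    rwa [T.face_rev] at this
  have := next_closing hj (r := 1) (by omega) (fun i h1 h2 => by omega)
    (by rw [hp]; exact isClosing_or_eq_of_corner_red hc)
  rw [hp] at this
  rcases this with ⟨h1, h2, -, h3⟩ | h1
  · exact Or.inl ⟨h1, h2, h3⟩
  · exact Or.inr h1

/-- Without an outgoing red edge at the blue corner, the path goes on to the red corner of the same
face, either along an incoming blue edge or, at the end of the contour, through the outer face
across the edge between `A_b` and `A_r`. Nothing is closed on the way. -/
theorem next_of_isIn_blue {j : ℕ} (hj : O.closingTime j < O.pathLength)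
    (h : ¬ O.IsIn .red (O.closingDart j)) (hb : ¬ O.IsOut .red (O.cornerDart j .blue)) :
    (∃ s, s < O.closingTime (j + 1) ∧ O.path s = O.cornerDart j .blue) ∧
    ((O.IsClosing (O.cornerDart j .red) ∧
      O.closingDart (j + 1) = O.cornerDart j .red ∧ O.closingTime (j + 1) < O.pathLength) ∨
    (O.cornerDart j .red = T.rev (T.outerDart .green) ∧
      O.pathLength ≤ O.closingTime (j + 1))) := by
  obtain ⟨r, h0, hr, hp⟩ := exists_path_eq_cornerDart_blue hj h
  have hc := isClosing_or_eq_of_corner_red (corner_cornerDart h .red)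
  have key : ∃ r', r < r' ∧
      (∀ i, 0 < i → i < r' → O.IsIdle (O.path (O.closingTime j + i))) ∧
      O.path (O.closingTime j + r') = O.cornerDart j .red := by
    have hsucc : O.path (O.closingTime j + (r + 1)) = O.move (O.cornerDart j .blue) := by
      rw [← add_assoc, path_succ, hp]
    rcases corner_blue_iff.1 (corner_cornerDart h .blue) with h1 | h1 | h1
    · refine ⟨r + 1, by omega, fun i h2 h3 => ?_, ?_⟩
      · rcases Nat.lt_succ_iff_lt_or_eq.1 h3 with h3 | rfl
        · exact hr i h2 h3
        · rw [hp]; exact h1.isIdle (by simp)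
      · rw [hsucc, move_of_color_blue h1.2]; rfl
    · exact absurd h1 hb
    · have h4 : O.path (O.closingTime j + (r + 1)) = T.outerDart .red := by
        rw [hsucc, h1, move_rev_outerDart]
      -- Crossing the outer edge out and in again takes two moves.
      refine ⟨r + 2, by omega, fun i h2 h3 => ?_, ?_⟩
      · rcases Nat.lt_succ_iff_lt_or_eq.1 h3 with h3 | rfl
        · rcases Nat.lt_succ_iff_lt_or_eq.1 h3 with h3 | rfl
          · exact hr i h2 h3
          · rw [hp, h1]; exact O.isIdle_rev_outerDart_red
        · rw [h4]; exact O.isIdle_outerDart _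
      · rw [show O.closingTime j + (r + 2) = O.closingTime j + (r + 1) + 1 from rfl, path_succ, h4,
          move_outerDart, ← T.face_rev, ← h1]; rfl
  obtain ⟨r', hrr, hr', hp'⟩ := key
  have := next_closing hj (r := r') (by omega) hr' (by rwa [hp'])
  rw [hp'] at this
  rcases this with ⟨h1, h2, h3, h4⟩ | ⟨h1, h2⟩
  · exact ⟨⟨_, by omega, hp⟩, Or.inl ⟨h1, h2, h4⟩⟩
  · refine ⟨⟨_, ?_, hp⟩, Or.inr ⟨h1, h2⟩⟩
    by_contra hlt
    have h5 : O.IsClosing (O.path (O.closingTime (j + 1))) := O.isClosing_closingDart _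
    have h6 := O.closingTime_strictMono (Nat.lt_add_one j)
    refine (hr' (O.closingTime (j + 1) - O.closingTime j) (by omega) (by omega)).1 ?_
    rwa [Nat.add_sub_cancel' h6.le]

/-- From the outgoing red edge the path turns clockwise about its tail across the incoming green
edges, until it closes the outgoing blue edge. `IsRun.exists_of_isIn` shows that no incoming green
edge is missed; this is needed when these edges are closed later. -/
theorem next_of_isOut_red {j : ℕ} (hj : O.closingTime j < O.pathLength)
    (h : ¬ O.IsIn .red (O.closingDart j)) (hb : O.IsOut .red (O.cornerDart j .blue)) :
    O.IsOut .blue (O.closingDart (j + 1)) ∧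
    T.tail (O.closingDart (j + 1)) = T.tail (O.cornerDart j .blue) ∧
    O.closingTime (j + 1) < O.pathLength ∧
    (∃ s < O.closingTime (j + 1), O.path s = O.cornerDart j .blue) ∧
    ∀ d, O.IsIn .green d → T.tail d = T.tail (O.cornerDart j .blue) →
      ∃ s < O.closingTime (j + 1), O.path s = d := by
  obtain ⟨r, h0, hr, hp⟩ := exists_path_eq_cornerDart_blue hj h
  obtain ⟨m, hm⟩ := hb.exists_isRun
  have hrun : ∀ i ≤ m + 1, O.path (O.closingTime j + r + i) = (T.rot ^ i) (O.cornerDart j .blue) := by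
    rw [← hp]
    refine path_add_eq_pow_rot fun i hi => ?_
    rw [hp]
    rcases Nat.eq_zero_or_pos i with rfl | hi0
    · exact move_of_color_ne hb.2 (by simp)
    · exact move_of_color_ne (hm.isIn i hi0 hi).2 (by simp [WoodColor.cw])
  have hend : O.IsOut .blue ((T.rot ^ (m + 1)) (O.cornerDart j .blue)) := hm.isOut_end
  have := next_closing hj (r := r + (m + 1)) (by omega) (fun i hi0 hi => ?_)
    (Or.inl (by rw [← add_assoc, hrun _ le_rfl]; exact Or.inr (Or.inr (Or.inl hend))))
  · rw [← add_assoc, hrun _ le_rfl] at this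
    rcases this with ⟨-, h2, h3, h4⟩ | ⟨h1, -⟩
    · refine ⟨by rw [h2]; exact hend, by rw [h2, T.tail_pow_rot], h4,
        ⟨_, by omega, hp⟩, fun d hd ht => ?_⟩
      obtain ⟨i, hi0, hi, rfl⟩ := hm.exists_of_isIn hd ht
      exact ⟨O.closingTime j + r + i, by omega, hrun i (by omega)⟩
    · exact absurd h1 (ne_rev_outerDart_of_not_isOuterEdge hend.not_isOuterEdge)
  · rcases lt_trichotomy i r with hir | rfl | hir
    · exact hr i hi0 hir
    · rw [hp]; exact hb.isIdle
    · obtain ⟨i', rfl⟩ := Nat.exists_eq_add_of_lt hir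
      rw [show O.closingTime j + (r + i' + 1) = O.closingTime j + r + (i' + 1) by omega,
        hrun _ (by omega)]
      exact (hm.isIn (i' + 1) (by omega) (by omega)).isIdle (by simp [WoodColor.cw])

end FaceDarts

end SchnyderWood

/-! ### The word of a wooded triangulation and its stack invariants -/

namespace SchnyderWood

open PlaneTriangulation

variable {D : Type} {T : PlaneTriangulation D} {O : SchnyderWood T}

/-- The path closes `M` inner edges, and the word `w` lists their colours. -/
structure IsExploredBy (O : SchnyderWood T) (w : ℕ → WoodColor) (M : ℕ) : Prop where
  lt_iff : ∀ j, O.closingTime j < O.pathLength ↔ j ≤ M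
  color : ∀ j < M, O.color (O.closingDart (j + 1)) = some (w j)

/-- The vertex which has the last pending red edge. -/
noncomputable def redVertex (O : SchnyderWood T) : List ℕ → T.Vertex
  | [] => T.outerVertex .green
  | k :: _ => T.tail (O.cornerDart k .blue)

/-- The vertex which has the last pending blue edge. -/
noncomputable def blueVertex (O : SchnyderWood T) : List (ℕ × ℕ) → T.Vertex
  | [] => T.outerVertex .blue
  | x :: _ => T.tail (O.cornerDart x.1 .red)

theorem exists_isExploredBy (O : SchnyderWood T) : ∃ w M, O.IsExploredBy w M := by
  classical
  have hex : ∃ j, O.pathLength ≤ O.closingTime (j + 1) :=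
    ⟨O.pathLength, (Nat.le_succ _).trans O.closingTime_strictMono.le_apply⟩
  have hM : ∀ j, O.closingTime j < O.pathLength ↔ j ≤ Nat.find hex := by
    intro j
    constructor
    · intro h
      by_contra hlt
      have := O.closingTime_strictMono.monotone (show Nat.find hex + 1 ≤ j by omega)
      have := Nat.find_spec hex
      omega
    · intro h
      rcases j with _ | j
      · exact O.closingTime_zero_lt
      · exact not_le.1 (Nat.find_min hex h)
  -- The shift by one skips the closing of the outer edge. The default colour never matters: all
  -- later closings within the period are of inner edges.
  refine ⟨fun j => (O.color (O.closingDart (j + 1))).getD .blue, Nat.find hex, hM, fun j hj => ?_⟩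
  have h1 := closingDart_ne_of_pos (Nat.succ_pos j) ((hM _).2 hj)
  rcases O.isClosing_closingDart (j + 1) with h | h | h | h
  · simp [h.2]
  · simp [h.2]
  · simp [h.2]
  · exact absurd h h1

namespace IsExploredBy

variable {w : ℕ → WoodColor} {M j : ℕ} (h : O.IsExploredBy w M)

include h

theorem isOut_blue (hj : j < M) (hw : w j = .blue) : O.IsOut .blue (O.closingDart (j + 1)) := by
  have hc := h.color j hj
  rcases O.isClosing_closingDart (j + 1) with h' | h' | h' | h'
  · have := h'.2.symm.trans hc; simp [hw] at this
  · have := h'.2.symm.trans hc; simp [hw] at this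
  · exact h'
  · exact absurd h' (closingDart_ne_of_pos (Nat.succ_pos j) ((h.lt_iff _).2 hj))

theorem isOut_green (hj : j < M) (hw : w j = .green) :
    O.IsOut .green (O.closingDart (j + 1)) := by
  have hc := h.color j hj
  rcases O.isClosing_closingDart (j + 1) with h' | h' | h' | h'
  · have := h'.2.symm.trans hc; simp [hw] at this
  · exact h'
  · have := h'.2.symm.trans hc; simp [hw] at this
  · exact absurd h' (closingDart_ne_of_pos (Nat.succ_pos j) ((h.lt_iff _).2 hj))

theorem isIn_red (hj : j < M) (hw : w j = .red) : O.IsIn .red (O.closingDart (j + 1)) := by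
  have hc := h.color j hj
  rcases O.isClosing_closingDart (j + 1) with h' | h' | h' | h'
  · exact h'
  · have := h'.2.symm.trans hc; simp [hw] at this
  · have := h'.2.symm.trans hc; simp [hw] at this
  · exact absurd h' (closingDart_ne_of_pos (Nat.succ_pos j) ((h.lt_iff _).2 hj))

theorem isIn_red_iff (hj : j < M) : O.IsIn .red (O.closingDart (j + 1)) ↔ w j = .red := by
  refine ⟨fun h' => ?_, h.isIn_red hj⟩
  have := h'.2.symm.trans (h.color j hj)
  simpa using this.symm

theorem fresh (hj : j ≤ M) (hr : ¬ O.IsIn .red (O.closingDart j)) :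
    (explState w j).last = j ∧ (explState w j).top = j := by
  rcases j with _ | j
  · exact ⟨rfl, rfl⟩
  · rw [h.isIn_red_iff hj] at hr
    exact ⟨last_eq_of_ne_red hr, top_eq_of_ne_red hr⟩

omit h in
theorem not_isIn_red_zero : ¬ O.IsIn .red (O.closingDart 0) := by
  rw [closingDart_zero]
  exact fun h' => h'.not_isOuterEdge (T.isOuterEdge_rev_outerDart _)

theorem eq_blue_of_isOut_red (hj : j ≤ M) (hr : ¬ O.IsIn .red (O.closingDart j))
    (hb : O.IsOut .red (O.cornerDart j .blue)) : j < M ∧ w j = .blue := by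
  obtain ⟨h1, -, h2, -⟩ := next_of_isOut_red ((h.lt_iff j).2 hj) hr hb
  have hlt : j < M := (h.lt_iff _).1 h2
  have := h1.2.symm.trans (h.color j hlt)
  exact ⟨hlt, by simpa using this.symm⟩

theorem path_cornerDart_blue (hj : j ≤ M) (hr : ¬ O.IsIn .red (O.closingDart j)) :
    ∃ s < O.closingTime (j + 1), O.path s = O.cornerDart j .blue := by
  by_cases hb : O.IsOut .red (O.cornerDart j .blue)
  · exact (next_of_isOut_red ((h.lt_iff j).2 hj) hr hb).2.2.2.1
  · exact (next_of_isIn_blue ((h.lt_iff j).2 hj) hr hb).1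

/-- A closing that is not blue happens at the red corner of the face `top`, and so does the end of
the path; a blue one happens just after a face with an outgoing red edge at its blue corner has been
discovered. The hypothesis `hred` is a field of `Invariant`; it is assumed separately because the
induction that proves the invariant needs this lemma. -/
theorem locate (hj : j ≤ M) (hred : O.IsIn .red (O.closingDart j) →
      T.rot (O.closingDart j) = O.cornerDart (explState w j).top .red) :
    (j < M → w j ≠ .blue → O.closingDart (j + 1) = O.cornerDart (explState w j).top .red) ∧
    (j = M → O.cornerDart (explState w j).top .red = T.rev (T.outerDart .green)) ∧
    (j < M → w j = .blue → ¬ O.IsIn .red (O.closingDart j) ∧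
      O.IsOut .red (O.cornerDart j .blue) ∧
      T.tail (O.closingDart (j + 1)) = T.tail (O.cornerDart j .blue)) := by
  have hlt := (h.lt_iff j).2 hj
  have hM : O.pathLength ≤ O.closingTime (j + 1) ↔ j = M := by
    rw [← not_lt, h.lt_iff]; omega
  have hM' : O.closingTime (j + 1) < O.pathLength ↔ j < M := h.lt_iff _
  -- An outgoing blue dart lies at a green corner, so a closing at a red corner is not blue.
  have hcol : ∀ {c}, j < M → O.Corner .red (O.closingDart (j + 1)) → w j = c → c ≠ .blue := by
    rintro c hjM hc rfl hw
    rcases corner_red_iff.1 hc with h' | h' | h'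
    · have := (h.isOut_blue hjM hw); exact this.not_isIn h'
    · exact absurd (h'.color_eq (h.isOut_blue hjM hw)) (by simp)
    · exact (O.isClosing_closingDart _).ne_rev_outerDart_green h'
  by_cases hr : O.IsIn .red (O.closingDart j)
  · have hc : O.Corner .red (T.rot (O.closingDart j)) := by
      have := (isOut_rev.2 hr).corner.face
      rwa [T.face_rev] at this
    rw [← hred hr]
    rcases next_of_isIn_red hlt hr with ⟨h1, h2, h3⟩ | ⟨h1, h2⟩
    · rw [hM'] at h3
      exact ⟨fun _ _ => h2, fun _ => by omega,
        fun _ hw => absurd hw (hcol h3 (h2 ▸ hc) rfl)⟩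
    · rw [hM] at h2
      exact ⟨fun _ => by omega, fun _ => h1, fun _ => by omega⟩
  · rw [(h.fresh hj hr).2]
    by_cases hb : O.IsOut .red (O.cornerDart j .blue)
    · obtain ⟨hjM, hw⟩ := h.eq_blue_of_isOut_red hj hr hb
      exact ⟨fun _ hw' => absurd hw hw', fun _ => by omega,
        fun _ _ => ⟨hr, hb, (next_of_isOut_red hlt hr hb).2.1⟩⟩
    · rcases (next_of_isIn_blue hlt hr hb).2 with ⟨h1, h2, h3⟩ | ⟨h1, h2⟩
      · rw [hM'] at h3
        exact ⟨fun _ _ => h2, fun _ => by omega,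
          fun _ hw => absurd hw (hcol h3 (h2 ▸ corner_cornerDart hr .red) rfl)⟩
      · rw [hM] at h2
        exact ⟨fun _ => by omega, fun _ => h1, fun _ => by omega⟩

omit h in
theorem faceDart_of_isOut_green (hg : O.IsOut .green (O.closingDart j)) :
    O.cornerDart j .green = T.rev (O.closingDart j) := if_pos hg

omit h in
theorem faceDart_of_isOut_blue (hg : O.IsOut .blue (O.closingDart j)) :
    O.cornerDart j .green = O.closingDart j :=
  if_neg fun h' => absurd (hg.color_eq h') (by simp)

omit h in
/-- What is known about the state of the exploration after `j` letters. -/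
structure Invariant (O : SchnyderWood T) (w : ℕ → WoodColor) (M j : ℕ) : Prop where
  rot_eq : O.IsIn .red (O.closingDart j) →
    T.rot (O.closingDart j) = O.cornerDart (explState w j).top .red
  last_node : ¬ O.IsIn .red (O.closingDart (explState w j).last)
  tail_green : T.tail (O.cornerDart (explState w j).top .green) = O.redVertex (explState w j).reds
  tail_blue : T.tail (O.cornerDart (explState w j).last .blue) =
    O.blueVertex (explState w j).blues
  tail_red : T.tail (O.cornerDart (explState w j).top .red) =
    T.tail (O.cornerDart (explState w j).last .red)
  not_isOut_red : (j < M → w j ≠ .blue) → ¬ O.IsOut .red (O.cornerDart (explState w j).last .blue)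

/-- The other candidates for the blue corner of `last` are excluded: an outgoing red edge would make
the next letter blue, and the outer edge would place the current red corner at `A_r`, where no green
edge starts. -/
theorem isIn_blue_of_green (hj : j < M) (hi : Invariant O w M j) (hw : w j = .green) :
    O.IsIn .blue (O.cornerDart (explState w j).last .blue) := by
  rcases corner_blue_iff.1 (corner_cornerDart hi.last_node .blue) with h' | h' | h'
  · exact h'
  · exact absurd h' (hi.not_isOut_red fun _ => by simp [hw])
  · have h1 := (h.locate hj.le hi.rot_eq).1 hj (by simp [hw])
    have h2 := (h.isOut_green hj hw).isInnerVertex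
    have h3 : O.cornerDart (explState w j).last .red =
        T.face (O.cornerDart (explState w j).last .blue) := rfl
    rw [h1, hi.tail_red, h3, h', T.face_rev, T.tail_rot] at h2
    exact absurd h2 (T.not_isInnerVertex_outerVertex .red)

theorem isIn_blue_of_blues (hj : j ≤ M) (hi : ∀ i ≤ j, Invariant O w M i) {k i : ℕ}
    {B : List (ℕ × ℕ)} (hB : (explState w j).blues = (k, i) :: B) :
    O.IsIn .blue (O.cornerDart k .blue) := by
  obtain ⟨h1, h2, h3, h4, -⟩ := blues_cons_spec hB
  rw [← h4]
  exact h.isIn_blue_of_green (by omega) (hi i (by omega)) h3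

theorem isOut_red_of_reds (hj : j ≤ M) (hi : ∀ i ≤ j, Invariant O w M i) {k : ℕ} {R : List ℕ}
    (hR : (explState w j).reds = k :: R) : k < j ∧ w k = .blue ∧ (explState w k).reds = R ∧
      ¬ O.IsIn .red (O.closingDart k) ∧ O.IsOut .red (O.cornerDart k .blue) := by
  obtain ⟨h1, h2, h3⟩ := reds_spec (w := w) (j := j) (k := k) (R := R) ⟨[], hR.symm⟩
  have := (h.locate (by omega) (hi k h1.le).rot_eq).2.2 (by omega) h2
  exact ⟨h1, h2, h3, this.1, this.2.1⟩

/-- By the invariant the edge being closed starts at the vertex on top of `reds`. That vertex has a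
single outgoing red edge, the pending one. An empty stack would mean that the edge starts at `A_g`,
which has no outgoing edges. -/
theorem red_step (hj : j < M) (hi : ∀ i ≤ j, Invariant O w M i) (hw : w j = .red) :
    ∃ k R, (explState w j).reds = k :: R ∧ T.rev (O.closingDart (j + 1)) = O.cornerDart k .blue := by
  have h1 := (h.locate hj.le (hi j le_rfl).rot_eq).1 hj (by simp [hw])
  have h2 := isOut_rev.2 (h.isIn_red hj hw)
  have h3 : T.tail (T.rev (O.closingDart (j + 1))) = O.redVertex (explState w j).reds := by
    rw [h1, ← tail_cornerDart, ← (hi j le_rfl).tail_green]; rfl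
  rcases hR : (explState w j).reds with _ | ⟨k, R⟩
  · rw [hR] at h3
    have := h2.isInnerVertex
    rw [h3] at this
    exact absurd this (T.not_isInnerVertex_outerVertex .green)
  · rw [hR] at h3
    exact ⟨k, R, rfl, h2.eq_of_tail_eq (h.isOut_red_of_reds hj.le hi hR).2.2.2.2 h3⟩

/-- Here the vertex on top of `blues` is the tail of both the pending edge and the edge being
closed, and uniqueness of the outgoing blue edge identifies them. -/
theorem blue_step (hj : j < M) (hi : ∀ i ≤ j, Invariant O w M i) (hw : w j = .blue) :
    ∃ k i B, (explState w j).blues = (k, i) :: B ∧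
      T.rev (O.closingDart (j + 1)) = O.cornerDart k .blue := by
  obtain ⟨h0, -, h1⟩ := (h.locate hj.le (hi j le_rfl).rot_eq).2.2 hj hw
  have h2 := h.isOut_blue hj hw
  have h3 := (hi j le_rfl).tail_blue
  rw [(h.fresh hj.le h0).1, ← h1] at h3
  rcases hB : (explState w j).blues with _ | ⟨⟨k, i⟩, B⟩
  · rw [hB] at h3
    have := h2.isInnerVertex
    rw [h3] at this
    exact absurd this (T.not_isInnerVertex_outerVertex .blue)
  · rw [hB] at h3
    refine ⟨k, i, B, rfl, ?_⟩
    rw [T.rev_eq_iff]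
    refine h2.eq_of_tail_eq (isOut_rev.2 (h.isIn_blue_of_blues hj.le hi hB)) (h3.trans ?_)
    exact O.tail_cornerDart k .blue

/-- The induction is strong because a pop uncovers an older part of the stack. The face `k` involved
in the pop was discovered when the stack was exactly that part, so the invariant at time `k` names
its top vertex. Pushes and the remaining fields follow from adjacency of corners along the faces
concerned. -/
theorem invariant (hj : j ≤ M) : Invariant O w M j := by
  induction j using Nat.strong_induction_on with
  | _ j ih =>
    have hnew : ∀ {j}, j ≤ M → ¬ O.IsIn .red (O.closingDart j) → (j < M → w j ≠ .blue) →
        ¬ O.IsOut .red (O.cornerDart j .blue) := fun hj hr hb h' =>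
      have := h.eq_blue_of_isOut_red hj hr h'
      hb this.1 this.2
    rcases j with _ | j
    · have h0 := not_isIn_red_zero (O := O)
      refine ⟨fun h' => absurd h' h0, h0, ?_, ?_, rfl, hnew hj h0⟩
      · change T.tail (O.faceDart 0) = _
        unfold faceDart
        rw [closingDart_zero, if_neg, T.tail_rev_outerDart]
        · rfl
        · exact fun h' => h'.not_isOuterEdge (T.isOuterEdge_rev_outerDart _)
      · change T.tail (T.face (O.faceDart 0)) = _
        unfold faceDart
        rw [closingDart_zero, if_neg, T.face_rev, T.tail_rot]
        · rfl
        · exact fun h' => h'.not_isOuterEdge (T.isOuterEdge_rev_outerDart _)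
    · have hi : ∀ i ≤ j, Invariant O w M i := fun i hij => ih i (by omega) (by omega)
      have hj' : j < M := hj
      have hI := hi j le_rfl
      obtain ⟨l1, l2, l3⟩ := h.locate hj'.le hI.rot_eq
      cases hw : w j
      · obtain ⟨k, i, B, hB, hk⟩ := h.blue_step hj' hi hw
        obtain ⟨m1, m2, m3⟩ := l3 hj' hw
        have ho := h.isOut_blue hj' hw
        have hr : ¬ O.IsIn .red (O.closingDart (j + 1)) := fun h' => ho.not_isIn h'
        obtain ⟨b1, b2, b3, b4, b5, b6, b7, b8⟩ := blues_cons_spec hB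
        have hIk := (hi k (by omega)).tail_blue
        rw [b5, b7] at hIk
        have hn := hnew hj hr
        refine ⟨fun h' => absurd h' hr, ?_, ?_, ?_, ?_, ?_⟩ <;> rw [explState_blue hw]
        · exact hr
        · simp only
          rw [faceDart_of_isOut_blue ho, m3]; rfl
        · simp only [hB, List.tail_cons]
          rw [← hIk, ← hk, ← faceDart_of_isOut_blue ho]
          exact O.tail_cornerDart (j + 1) .green
        · exact hn
      · obtain ⟨k, R, hR, hk⟩ := h.red_step hj' hi hw
        obtain ⟨r1, r2, r3, r4, r5⟩ := h.isOut_red_of_reds hj'.le hi hR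
        have hrot : T.rot (O.closingDart (j + 1)) = O.cornerDart k .red := by
          rw [← T.face_rev, hk]; rfl
        have hIk := (hi k r1.le).tail_green
        rw [(h.fresh (by omega) r4).2, r3] at hIk
        refine ⟨?_, ?_, ?_, ?_, ?_, ?_⟩ <;> rw [explState_red hw] <;>
          simp only [hR, List.headD_cons, List.tail_cons]
        · exact fun _ => hrot
        · exact hI.last_node
        · exact hIk
        · exact hI.tail_blue
        · rw [← hrot, T.tail_rot, l1 hj' (by simp [hw]), hI.tail_red]
        · exact fun _ => hI.not_isOut_red fun _ => by simp [hw]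
      · have ho := h.isOut_green hj' hw
        have hr : ¬ O.IsIn .red (O.closingDart (j + 1)) := fun h' => ho.not_isIn h'
        have h1 := l1 hj' (by simp [hw])
        have hn := hnew hj hr
        refine ⟨fun h' => absurd h' hr, ?_, ?_, ?_, ?_, ?_⟩ <;> rw [explState_green hw]
        · exact hr
        · simp only
          rw [faceDart_of_isOut_green ho, h1, ← tail_cornerDart]
          exact hI.tail_green
        · simp only
          change T.tail (O.cornerDart (j + 1) WoodColor.green.cw.cw) = _
          rw [tail_cornerDart, faceDart_of_isOut_green ho, T.rev_rev, h1]
          exact hI.tail_red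
        · exact hn

/-- At the end the path is at `A_r`, the green corner of `top` is at `A_g` and the blue corner of
`last` is at `A_b`. A nonempty stack would put an inner vertex at one of the latter two corners. -/
theorem end_spec : O.cornerDart (explState w M).top .red = T.rev (T.outerDart .green) ∧
    O.cornerDart (explState w M).last .blue = T.rev (T.outerDart .red) ∧
    (explState w M).reds = [] ∧ (explState w M).blues = [] := by
  have hI := h.invariant le_rfl
  have h1 := (h.locate le_rfl hI.rot_eq).2.1 rfl
  have h2 : T.tail (O.cornerDart (explState w M).last .red) = T.outerVertex .red := by
    rw [← hI.tail_red, h1, T.tail_rev_outerDart]; rfl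
  have h3 : O.cornerDart (explState w M).last .blue = T.rev (T.outerDart .red) := by
    rcases corner_blue_iff.1 (corner_cornerDart hI.last_node .blue) with h' | h' | h'
    · have h4 := (isOut_rev.2 h').isInnerVertex
      rw [← tail_cornerDart] at h4
      exact absurd (h2 ▸ h4) (T.not_isInnerVertex_outerVertex .red)
    · exact absurd h' (hI.not_isOut_red fun h => absurd h (lt_irrefl _))
    · exact h'
  refine ⟨h1, h3, ?_, ?_⟩
  · have h4 : T.tail (O.cornerDart (explState w M).top .green) = T.outerVertex .green := by
      change T.tail (O.cornerDart (explState w M).top WoodColor.red.cw.cw) = _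
      rw [tail_cornerDart, h1, T.rev_rev]; rfl
    rcases hR : (explState w M).reds with _ | ⟨k, R⟩
    · rfl
    · have h5 := (h.isOut_red_of_reds le_rfl (fun i hi => h.invariant hi) hR).2.2.2.2.isInnerVertex
      have h6 := hI.tail_green
      rw [h4, hR] at h6
      simp only [redVertex] at h6
      rw [← h6] at h5
      exact absurd h5 (T.not_isInnerVertex_outerVertex _)
  · have h4 := hI.tail_blue
    rcases hB : (explState w M).blues with _ | ⟨⟨k, i⟩, B⟩
    · rfl
    · have h5 := (isOut_rev.2
        (h.isIn_blue_of_blues le_rfl (fun i hi => h.invariant hi) hB)).isInnerVertex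
      rw [h3, T.tail_rev_outerDart, hB] at h4
      rw [← tail_cornerDart] at h5
      simp only [blueVertex] at h4
      exact absurd (h4 ▸ h5) (T.not_isInnerVertex_outerVertex _)

theorem isGoodWord : IsGoodWord w M where
  red_ne j hj hw := by
    obtain ⟨k, R, hR, -⟩ := h.red_step hj (fun i hi => h.invariant (hi.trans hj.le)) hw
    simp [hR]
  blue_ne j hj hw := by
    obtain ⟨k, i, B, hB, -⟩ := h.blue_step hj (fun i hi => h.invariant (hi.trans hj.le)) hw
    simp [hB]
  no_red_blue j hj hw hw' :=
    ((h.locate hj.le (h.invariant hj.le).rot_eq).2.2 hj hw').1 (h.isIn_red (by omega) hw)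
  reds_end := h.end_spec.2.2.1
  blues_end := h.end_spec.2.2.2

/-- Every edge has been met before the path closes it. -/
theorem exists_path_eq_rev (hj : j < M) :
    ∃ s < O.closingTime (j + 1), O.path s = T.rev (O.closingDart (j + 1)) := by
  have hi : ∀ i ≤ j, Invariant O w M i := fun i hi => h.invariant (hi.trans hj.le)
  have key : ∀ k < j + 1, ¬ O.IsIn .red (O.closingDart k) →
      ∃ s < O.closingTime (j + 1), O.path s = O.cornerDart k .blue := fun k hk hr => by
    obtain ⟨s, h1, h2⟩ := h.path_cornerDart_blue (show k ≤ M by omega) hr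
    exact ⟨s, h1.trans_le (O.closingTime_strictMono.monotone hk), h2⟩
  cases hw : w j
  · obtain ⟨k, i, B, hB, hk⟩ := h.blue_step hj hi hw
    obtain ⟨b1, b2, b3, b4, -⟩ := blues_cons_spec hB
    rw [hk]
    exact key k (by omega) (b4 ▸ (hi i b2.le).last_node)
  · obtain ⟨k, R, hR, hk⟩ := h.red_step hj hi hw
    obtain ⟨r1, -, -, r2, -⟩ := h.isOut_red_of_reds hj.le hi hR
    rw [hk]
    exact key k (by omega) r2
  · have h1 := (h.locate hj.le (hi j le_rfl).rot_eq).1 hj (by simp [hw])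
    have h2 := isIn_rev.2 (h.isOut_green hj hw)
    have h3 : T.tail (T.rev (O.closingDart (j + 1))) = O.redVertex (explState w j).reds := by
      rw [h1, ← tail_cornerDart, ← (hi j le_rfl).tail_green]; rfl
    -- A green edge enters the vertex on top of `reds`, so it was crossed in the turn about that
    -- vertex, or in the initial tour about `A_g` if the stack is empty.
    rcases hR : (explState w j).reds with _ | ⟨k, R⟩
    · rw [hR] at h3
      obtain ⟨m, m1, m2, m3⟩ := O.exists_initial_run
      obtain ⟨i, i0, i1, i2⟩ := m3 _ h2 h3
      refine ⟨i, ?_, by rw [path_initial_run m1 _ (by omega), i2]⟩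
      have := O.closingTime_strictMono (Nat.succ_pos j)
      rw [closingTime_zero m1 m2] at this
      exact (by omega : i < m + 1).trans this
    · rw [hR] at h3
      obtain ⟨r1, -, -, r2, r3⟩ := h.isOut_red_of_reds hj.le hi hR
      obtain ⟨s, s1, s2⟩ := (next_of_isOut_red ((h.lt_iff k).2 (by omega)) r2 r3).2.2.2.2 _ h2 h3
      exact ⟨s, s1.trans_le (O.closingTime_strictMono.monotone (by omega)), s2⟩

end IsExploredBy

end SchnyderWood

/-! ### The walk as the pair of stack heights -/

open PlaneTriangulation

/-- The position of the walk after `j` letters. -/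
def wordPosition (w : ℕ → WoodColor) (j : ℕ) : ℤ × ℤ :=
  (((explState w j).reds.length : ℤ), ((explState w j).blues.length : ℤ))

/-- The positions of the walk encoded by a word of length `N`. -/
def wordWalk (w : ℕ → WoodColor) (N : ℕ) : List (ℤ × ℤ) :=
  (List.range (N + 1)).map (wordPosition w)

/-- The stacks must be nonempty at the pops, since `List.tail` does not shorten the empty list. -/
theorem wordPosition_succ {w : ℕ → WoodColor} {j : ℕ}
    (hr : w j = .red → (explState w j).reds ≠ []) (hb : w j = .blue → (explState w j).blues ≠ []) :
    wordPosition w (j + 1) = wordPosition w j + SchnyderWood.colorStep (w j) := by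
  unfold wordPosition
  cases h : w j
  · have := List.length_pos_iff.2 (hb h)
    rw [explState_blue h]
    simp only [SchnyderWood.colorStep, List.length_cons, List.length_tail, Prod.mk_add_mk,
      Prod.mk.injEq]
    omega
  · have := List.length_pos_iff.2 (hr h)
    rw [explState_red h]
    simp only [SchnyderWood.colorStep, List.length_tail, Prod.mk_add_mk, Prod.mk.injEq]
    omega
  · rw [explState_green h]
    simp only [SchnyderWood.colorStep, List.length_cons, Prod.mk_add_mk, Prod.mk.injEq]
    omega

theorem IsGoodWord.wordPosition_succ {w : ℕ → WoodColor} {N j : ℕ} (hw : IsGoodWord w N)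
    (hj : j < N) : wordPosition w (j + 1) = wordPosition w j + SchnyderWood.colorStep (w j) :=
  _root_.wordPosition_succ (hw.red_ne j hj) (hw.blue_ne j hj)

theorem IsGoodWord.scanl_eq_wordWalk {w : ℕ → WoodColor} {N : ℕ} (hw : IsGoodWord w N) :
    ((List.range N).map fun j => SchnyderWood.colorStep (w j)).scanl (· + ·) (0, 0) =
      wordWalk w N := by
  have hlen : (((List.range N).map fun j => SchnyderWood.colorStep (w j)).scanl (· + ·)
      ((0, 0) : ℤ × ℤ)).length = N + 1 := by simp
  have key : ∀ j (hj : j < N + 1), (((List.range N).map fun j =>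
      SchnyderWood.colorStep (w j)).scanl (· + ·) ((0, 0) : ℤ × ℤ))[j]'(by rw [hlen]; exact hj) =
      wordPosition w j := by
    intro j
    induction j with
    | zero => intro _; simp [wordPosition, explState]
    | succ j ih =>
      intro hj
      rw [List.getElem_succ_scanl, ih (by omega), hw.wordPosition_succ (by omega)]
      simp
  refine List.ext_getElem (by simp [wordWalk]) fun j h1 h2 => ?_
  rw [key j (by rw [hlen] at h1; exact h1)]
  simp [wordWalk]

theorem filterMap_range_eq {α : Type*} (p : ℕ → Prop) [DecidablePred p] (g : ℕ → Option α)
    (L : ℕ) : ((List.range L).filterMap fun k => if p k then g k else none) =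
      (List.range (Nat.count p L)).filterMap fun j => g (Nat.nth p j) := by
  induction L with
  | zero => simp
  | succ L ih =>
    rw [List.range_succ, List.filterMap_append, ih, Nat.count_succ]
    by_cases h : p L
    · rw [if_pos h, List.range_succ, List.filterMap_append]
      congr 1
      simp only [List.filterMap_cons, List.filterMap_nil, if_pos h, Nat.nth_count h]
    · simp [h]

/-! ### Recovering the map and the walk from the word -/

namespace SchnyderWood

variable {D : Type} {T : PlaneTriangulation D} {O : SchnyderWood T}

/-- The dart at a corner. -/
noncomputable def keyDart (O : SchnyderWood T) : CornerKey → D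
  | .inl (k, c) => O.cornerDart k c
  | .inr c => T.outerDart c

/-- The dart encoded by a dart of the word of the colours of the closings. -/
noncomputable def wordDart (O : SchnyderWood T) {N : ℕ} : WordDart N → D
  | (.inl j, true) => O.closingDart (j + 1)
  | (.inl j, false) => T.rev (O.closingDart (j + 1))
  | (.inr c, true) => T.rev (T.outerDart c)
  | (.inr c, false) => T.outerDart c

/-- The dart of a word in the opposite direction. -/
def _root_.WordDart.rev {N : ℕ} (d : WordDart N) : WordDart N := (d.1, !d.2)

variable (O) in
theorem wordDart_rev {N : ℕ} (d : WordDart N) : O.wordDart d.rev = T.rev (O.wordDart d) := by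
  rcases d with ⟨j | c, _ | _⟩ <;> simp [WordDart.rev, wordDart, T.rev_rev]

namespace IsExploredBy

variable {w : ℕ → WoodColor} {M j : ℕ} (h : O.IsExploredBy w M)

include h

/-- This is the core of injectivity: `cornerKey` depends on the word alone, so the word determines
at which corner of which face each dart lies. -/
theorem wordDart_eq_keyDart (d : WordDart M) : O.wordDart d = O.keyDart (cornerKey w M d) := by
  obtain ⟨e1, e2, -, -⟩ := h.end_spec
  rcases d with ⟨⟨j, hj⟩ | c, _ | _⟩
  · have hi : ∀ i ≤ j, Invariant O w M i := fun i hi => h.invariant (hi.trans hj.le)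
    cases hw : w j
    · obtain ⟨k, i, B, hB, hk⟩ := h.blue_step hj hi hw
      rw [cornerKey_false_of_blue hw]
      simpa [hB, keyDart, wordDart] using hk
    · obtain ⟨k, R, hR, hk⟩ := h.red_step hj hi hw
      rw [cornerKey_false_of_red hw]
      simpa [hR, keyDart, wordDart] using hk
    · rw [cornerKey_false_of_green hw]
      exact (faceDart_of_isOut_green (h.isOut_green hj hw)).symm
  · by_cases hw : w j = .blue
    · rw [cornerKey_true_of_blue hw]
      exact (faceDart_of_isOut_blue (h.isOut_blue hj hw)).symm
    · rw [cornerKey_true_of_ne_blue hw]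
      exact (h.locate hj.le (h.invariant hj.le).rot_eq).1 hj hw
  · cases c <;> rfl
  · cases c
    · simp only [wordDart, cornerKey, keyDart, cornerDart, faceDart]
      rw [closingDart_zero, if_neg]
      exact fun h' => h'.not_isOuterEdge (T.isOuterEdge_rev_outerDart _)
    · exact e2.symm
    · exact e1.symm

theorem face_wordDart {d d' : WordDart M} (hd : cornerKey w M d' = (cornerKey w M d).next) :
    T.face (O.wordDart d) = O.wordDart d' := by
  rw [h.wordDart_eq_keyDart, h.wordDart_eq_keyDart, hd]
  rcases cornerKey w M d with ⟨k, c⟩ | c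
  · exact O.face_cornerDart k c
  · exact T.face_outerDart c

/-- The darts of closed edges and outer edges form a set stable under reversal and under `face`,
hence under `rot`, and the map is connected. So the path misses no edge. -/
theorem wordDart_surjective : Function.Surjective (O.wordDart (N := M)) := by
  have hrev : ∀ x ∈ Set.range (O.wordDart (N := M)), T.rev x ∈ Set.range (O.wordDart (N := M)) := by
    rintro _ ⟨d, rfl⟩
    exact ⟨d.rev, O.wordDart_rev d⟩
  have hface : ∀ x ∈ Set.range (O.wordDart (N := M)),
      T.face x ∈ Set.range (O.wordDart (N := M)) := by
    rintro _ ⟨d, rfl⟩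
    obtain ⟨d', hd'⟩ := h.isGoodWord.exists_cornerKey_eq_next d
    exact ⟨d', (h.face_wordDart hd').symm⟩
  have hrev' : ∀ x, T.rev x ∈ Set.range (O.wordDart (N := M)) ↔
      x ∈ Set.range (O.wordDart (N := M)) := fun x =>
    ⟨fun hx => T.rev_rev x ▸ hrev _ hx, hrev x⟩
  have hrot' : ∀ x, T.rot x ∈ Set.range (O.wordDart (N := M)) ↔
      x ∈ Set.range (O.wordDart (N := M)) := fun x => by
    rw [← T.face_rev, ← hrev' x]
    -- All faces are triangles, so `face` applied twice is its inverse.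
    exact ⟨fun hx => T.face_face_face (T.rev x) ▸ hface _ (hface _ hx), hface _⟩
  intro y
  obtain ⟨g, hg, rfl⟩ := T.planar.1 T.root y
  have key : ∀ x, g x ∈ Set.range (O.wordDart (N := M)) ↔
      x ∈ Set.range (O.wordDart (N := M)) := by
    induction hg using Subgroup.closure_induction with
    | mem g hg =>
      rcases hg with rfl | rfl
      · exact hrot'
      · exact hrev'
    | one => exact fun x => Iff.rfl
    | mul a b _ _ ha hb => exact fun x => (ha _).trans (hb _)
    | inv a _ ha => exact fun x => by rw [← ha, ← Equiv.Perm.mul_apply, mul_inv_cancel, Equiv.Perm.one_apply]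
  exact (key _).2 ⟨(.inr .blue, false), rfl⟩

theorem not_isOuterEdge (hj : j < M) : ¬ T.IsOuterEdge (O.closingDart (j + 1)) :=
  not_isOuterEdge_of_color (h.color j hj)

theorem not_isClosing_rev (hj : j < M) : ¬ O.IsClosing (T.rev (O.closingDart (j + 1))) := by
  cases hw : w j
  · exact (isIn_rev.2 (h.isOut_blue hj hw)).not_isClosing (by simp)
  · exact (isOut_rev.2 (h.isIn_red hj hw)).not_isClosing
  · exact (isIn_rev.2 (h.isOut_green hj hw)).not_isClosing (by simp)

/-- Within one period a dart is met only once, and the reverse of a closing dart is not closing; so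
every edge is closed at most once. -/
theorem wordDart_injective : Function.Injective (O.wordDart (N := M)) := by
  have h1 : ∀ i j : Fin M, O.closingDart (i + 1) = O.closingDart (j + 1) → i = j := by
    intro i j hij
    have := closingDart_injOn ((h.lt_iff _).2 i.2) ((h.lt_iff _).2 j.2) hij
    ext; omega
  have h2 : ∀ i j : Fin M, O.closingDart (i + 1) ≠ T.rev (O.closingDart (j + 1)) := by
    intro i j hij
    exact h.not_isClosing_rev j.2 (hij ▸ O.isClosing_closingDart _)
  have h3 : ∀ (j : Fin M) d, T.IsOuterEdge d → O.closingDart (j + 1) ≠ d := by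
    rintro j d hd rfl
    exact h.not_isOuterEdge j.2 hd
  have h4 : ∀ (j : Fin M) d, T.IsOuterEdge d → T.rev (O.closingDart (j + 1)) ≠ d := by
    rintro j d hd rfl
    exact h.not_isOuterEdge j.2 (T.isOuterEdge_rev.1 hd)
  have o1 := T.isOuterEdge_outerDart
  have o2 := T.isOuterEdge_rev_outerDart
  rintro ⟨i | c, _ | _⟩ ⟨j | c', _ | _⟩ hd <;> simp only [wordDart] at hd
  · rw [h1 i j (T.rev.injective hd)]
  · exact absurd hd.symm (h2 j i)
  · exact absurd hd (h4 _ _ (o1 _))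
  · exact absurd hd (h4 _ _ (o2 _))
  · exact absurd hd (h2 i j)
  · rw [h1 i j hd]
  · exact absurd hd (h3 _ _ (o1 _))
  · exact absurd hd (h3 _ _ (o2 _))
  · exact absurd hd.symm (h4 _ _ (o1 _))
  · exact absurd hd.symm (h3 _ _ (o1 _))
  · rw [T.outerDart_injective hd]
  · exact absurd hd (T.outerDart_ne_rev _ _)
  · exact absurd hd.symm (h4 _ _ (o2 _))
  · exact absurd hd.symm (h3 _ _ (o2 _))
  · exact absurd hd.symm (T.outerDart_ne_rev _ _)
  · rw [T.outerDart_injective (T.rev.injective hd)]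

theorem color_wordDart_inl (i : Fin M) (b : Bool) :
    O.color (O.wordDart (.inl i, b)) = some (w i) := by
  cases b <;> simp [wordDart, O.color_rev, h.color i i.2]

omit h in
theorem color_wordDart_inr (c : WoodColor) (b : Bool) :
    O.color (O.wordDart (N := M) (.inr c, b)) = none := by
  rw [O.color_eq_none_iff]
  cases b
  · exact T.isOuterEdge_outerDart c
  · exact T.isOuterEdge_rev_outerDart c

theorem wordDart_mem_out_inl (i : Fin M) (b : Bool) :
    O.wordDart (.inl i, b) ∈ O.out ↔ (b = true ↔ w i ≠ .red) := by
  have h1 : O.closingDart (i + 1) ∈ O.out ↔ w i ≠ .red := by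
    cases hw : w i
    · simp [(h.isOut_blue i.2 hw).1]
    · simp [(h.isIn_red i.2 hw).1]
    · simp [(h.isOut_green i.2 hw).1]
  cases b
  · simp only [wordDart, O.out_rev_iff _ (h.not_isOuterEdge i.2), h1]
    simp
  · simp only [wordDart, h1]
    simp

omit h in
theorem wordDart_not_mem_out_inr (c : WoodColor) (b : Bool) :
    O.wordDart (N := M) (.inr c, b) ∉ O.out := by
  cases b
  · exact O.not_out_of_outer _ (T.isOuterEdge_outerDart c)
  · exact O.not_out_of_outer _ (T.isOuterEdge_rev_outerDart c)

/-- A green edge corresponds to its tail: every inner vertex has exactly one outgoing green edge. By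
the stack count the green letters are a third of the word. -/
theorem length_eq : M = 3 * T.size := by
  rw [← h.isGoodWord.card_eq.2]
  congr 1
  have hc : ∀ i : {i // i ∈ (Finset.range M).filter fun i => w i = .green},
      O.IsOut .green (O.closingDart (i.1 + 1)) := fun ⟨i, hi⟩ => by
    rw [Finset.mem_filter, Finset.mem_range] at hi
    exact h.isOut_green hi.1 hi.2
  rw [← Nat.card_eq_finsetCard]
  refine Nat.card_eq_of_bijective (fun i => ⟨T.tail (O.closingDart (i.1 + 1)),
    (hc i).isInnerVertex⟩) ⟨fun i j hij => ?_, ?_⟩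
  · have h1 := (hc i).eq_of_tail_eq (hc j) (congrArg Subtype.val hij)
    have hi := i.2
    have hj := j.2
    rw [Finset.mem_filter, Finset.mem_range] at hi hj
    have := closingDart_injOn ((h.lt_iff _).2 hi.1) ((h.lt_iff _).2 hj.1) h1
    ext; omega
  · rintro ⟨v, hv⟩
    obtain ⟨d, rfl⟩ := Quotient.exists_rep v
    obtain ⟨d', h1, h2⟩ := exists_isOut_color (O := O) (d := d) hv .green
    obtain ⟨⟨i | c, b⟩, rfl⟩ := h.wordDart_surjective d'
    · have hw : w i = .green := by
        have := (h.color_wordDart_inl i b).symm.trans h1.2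
        simpa using this
      have hb : b = true := ((h.wordDart_mem_out_inl i b).1 h1.1).2 (by simp [hw])
      subst hb
      refine ⟨⟨i, ?_⟩, Subtype.ext h2⟩
      rw [Finset.mem_filter, Finset.mem_range]
      exact ⟨i.2, hw⟩
    · exact absurd h1.1 (wordDart_not_mem_out_inr c b)

/-- For inner edges second visits and closings coincide: exactly one of the two darts is closing,
and by `exists_path_eq_rev` the other one is met before it. -/
theorem steps_eq : O.steps = (List.range M).map fun j => colorStep (w j) := by
  classical
  have hinf := O.infinite_setOf_isClosing
  have hcount : Nat.count (fun k => O.IsClosing (O.path k)) O.pathLength = M + 1 := by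
    have h1 : M < Nat.count (fun k => O.IsClosing (O.path k)) O.pathLength :=
      (Nat.lt_nth_iff_count_lt hinf).2 ((h.lt_iff M).2 le_rfl)
    have h2 : ¬ M + 1 < Nat.count (fun k => O.IsClosing (O.path k)) O.pathLength := fun h2 => by
      have := (h.lt_iff (M + 1)).1 ((Nat.lt_nth_iff_count_lt hinf).1 h2)
      omega
    omega
  have hf : ∀ k < O.pathLength,
      (if O.IsSecondVisit k then (O.color (O.path k)).map colorStep else none) =
      if O.IsClosing (O.path k) then (O.color (O.path k)).map colorStep else none := by
    intro k hk
    rcases hc : O.color (O.path k) with _ | c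
    · simp
    · congr 1
      rw [eq_iff_iff]
      have hout := not_isOuterEdge_of_color hc
      constructor
      · rintro ⟨s, hs, hs'⟩
        by_contra hcl
        have hcl' : O.IsClosing (T.rev (O.path k)) := by
          rcases O.outer_or_out_or_in (O.path k) with h' | ⟨c, h'⟩ | ⟨c, h'⟩
          · exact absurd h' hout
          · cases c
            · exact absurd (Or.inr (Or.inr (Or.inl h'))) hcl
            · exact Or.inl (isIn_rev.2 h')
            · exact absurd (Or.inr (Or.inl h')) hcl
          · cases c
            · exact Or.inr (Or.inr (Or.inl (isOut_rev.2 h')))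
            · exact absurd (Or.inl h') hcl
            · exact Or.inr (Or.inl (isOut_rev.2 h'))
        rw [← hs'] at hcl'
        obtain ⟨i, rfl⟩ := exists_closingTime_eq hcl'
        rcases i with _ | i
        · have h0 : O.path (O.closingTime 0) = _ := O.closingDart_zero
          rw [h0, T.rev.apply_eq_iff_eq] at hs'
          exact hout (hs' ▸ T.isOuterEdge_outerDart _)
        -- The earlier closing was itself preceded by the reverse dart, which is the present one; it
        -- would be met twice within a period.
        · obtain ⟨s', h1, h2⟩ := h.exists_path_eq_rev ((h.lt_iff _).1 (hs.trans hk))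
          have h3 : O.path s' = O.path k := by
            rw [h2]; unfold closingDart; rw [hs', T.rev_rev]
          have := path_injective (by omega) hk h3
          omega
      · intro hcl
        obtain ⟨i, rfl⟩ := exists_closingTime_eq hcl
        rcases i with _ | i
        · have h0 : O.path (O.closingTime 0) = _ := O.closingDart_zero
          rw [h0] at hout
          exact absurd (T.isOuterEdge_rev_outerDart _) hout
        · obtain ⟨s', h1, h2⟩ := h.exists_path_eq_rev ((h.lt_iff _).1 hk)
          exact ⟨s', h1, h2⟩
  have hsteps : O.steps = (List.range O.pathLength).filterMap fun k =>
      if O.IsClosing (O.path k) then (O.color (O.path k)).map colorStep else none := by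
    unfold steps
    refine List.filterMap_congr fun k hk => ?_
    rw [← hf k (List.mem_range.1 hk)]
  have h0 : O.color (O.path (Nat.nth (fun k => O.IsClosing (O.path k)) 0)) = none := by
    have h0 : O.path (O.closingTime 0) = _ := O.closingDart_zero
    refine (O.color_eq_none_iff _).2 ?_
    exact h0 ▸ T.isOuterEdge_rev_outerDart _
  -- Closing number zero concerns an outer edge, has no colour and drops out; the others are shifted
  -- by one.
  rw [hsteps, filterMap_range_eq, hcount, List.range_succ_eq_map, List.filterMap_cons, h0,
    Option.map_none]
  simp only
  rw [List.filterMap_map, ← List.filterMap_eq_map]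
  refine List.filterMap_congr fun j hj => ?_
  have : O.color (O.path (Nat.nth (fun k => O.IsClosing (O.path k)) (j + 1))) = _ :=
    h.color j (List.mem_range.1 hj)
  simp [this]

theorem walk_eq : O.walk = wordWalk w M := by
  unfold walk
  rw [h.steps_eq, h.isGoodWord.scanl_eq_wordWalk]

end IsExploredBy

end SchnyderWood

/-! ### Vertex labels of a word -/

section Labels

variable {w : ℕ → WoodColor} {N : ℕ}

theorem mem_reds_of_le {j j' x : ℕ} (hj : j ≤ j') (hx : x ∈ (explState w j').reds) :
    x ∈ (explState w j).reds ∨ j ≤ x := by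
  induction j', hj using Nat.le_induction with
  | base => exact Or.inl hx
  | succ j' hj ih =>
    cases hw : w j'
    · rw [explState_blue hw] at hx
      rcases List.mem_cons.1 hx with rfl | hx
      · exact Or.inr hj
      · exact ih hx
    · rw [explState_red hw] at hx
      exact ih (List.mem_of_mem_tail hx)
    · rw [explState_green hw] at hx
      exact ih hx

theorem top_eq_of_last_eq {k : ℕ} (h : (explState w k).last = k) : (explState w k).top = k := by
  rcases k with _ | k
  · rfl
  · by_cases hk : w k = .red
    · rw [explState_red hk] at h
      have := (last_spec w k).1
      simp only at h
      omega
    · exact top_eq_of_ne_red hk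

/-- The labels of the vertices: `Sum.inl i` is the inner vertex discovered by the letter number
`i`, and `Sum.inr c` is the outer vertex of colour `c`. -/
abbrev WordVertex : Type := ℕ ⊕ WoodColor

/-- The vertex around which the path turns after `j` letters. -/
def blueLabel (w : ℕ → WoodColor) (j : ℕ) : WordVertex :=
  match (explState w j).blues with
  | [] => .inr .blue
  | x :: _ => .inl x.2

/-- The last vertex whose red edge is pending after `j` letters. -/
def redLabel (w : ℕ → WoodColor) (j : ℕ) : WordVertex :=
  match (explState w j).reds with
  | [] => .inr .green
  | k :: _ => blueLabel w k

/-- The first of the next `m` letters, starting from number `j`, which discovers a vertex. -/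
def nextLabelAux (w : ℕ → WoodColor) : ℕ → ℕ → WordVertex
  | 0, _ => .inr .red
  | m + 1, j => if w j = .green then .inl j else nextLabelAux w m (j + 1)

/-- The first vertex which is discovered by the letter number `j` or later. -/
def nextLabel (w : ℕ → WoodColor) (N j : ℕ) : WordVertex := nextLabelAux w (N - j) j

/-- The vertex from which a dart leaves. -/
def dartLabel (w : ℕ → WoodColor) (N : ℕ) : WordDart N → WordVertex
  | (.inl j, true) =>
    match w j with
    | .green => .inl j
    | .blue => blueLabel w j
    | .red => nextLabel w N j
  | (.inl j, false) =>
    match w j with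
    | .green => redLabel w j
    | .blue => blueLabel w (j + 1)
    | .red => redLabel w j
  | (.inr c, true) => .inr c.cw
  | (.inr c, false) => .inr c

theorem blueLabel_nil {j : ℕ} (h : (explState w j).blues = []) : blueLabel w j = .inr .blue := by
  simp [blueLabel, h]

theorem blueLabel_cons {j : ℕ} {x : ℕ × ℕ} {B : List (ℕ × ℕ)} (h : (explState w j).blues = x :: B) :
    blueLabel w j = .inl x.2 := by
  simp [blueLabel, h]

theorem redLabel_nil {j : ℕ} (h : (explState w j).reds = []) : redLabel w j = .inr .green := by
  simp [redLabel, h]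

theorem redLabel_cons {j k : ℕ} {R : List ℕ} (h : (explState w j).reds = k :: R) :
    redLabel w j = blueLabel w k := by
  simp [redLabel, h]

theorem blueLabel_congr {j j' : ℕ} (h : (explState w j).blues = (explState w j').blues) :
    blueLabel w j = blueLabel w j' := by
  simp [blueLabel, h]

theorem redLabel_congr {j j' : ℕ} (h : (explState w j).reds = (explState w j').reds) :
    redLabel w j = redLabel w j' := by
  simp [redLabel, h]

theorem nextLabel_self : nextLabel w N N = .inr .red := by simp [nextLabel, nextLabelAux]

theorem nextLabel_green {j : ℕ} (hj : j < N) (h : w j = .green) : nextLabel w N j = .inl j := by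
  unfold nextLabel
  rw [show N - j = (N - (j + 1)) + 1 by omega, nextLabelAux, if_pos h]

theorem nextLabel_of_ne_green {j : ℕ} (hj : j < N) (h : w j ≠ .green) :
    nextLabel w N j = nextLabel w N (j + 1) := by
  unfold nextLabel
  rw [show N - j = (N - (j + 1)) + 1 by omega, nextLabelAux, if_neg h]

theorem nextLabel_of_run {k i : ℕ} (hki : k ≤ i) (hi : i ≤ N)
    (h : ∀ i', k ≤ i' → i' < i → w i' = .red) : nextLabel w N k = nextLabel w N i := by
  induction i, hki using Nat.le_induction with
  | base => rfl
  | succ i hki ih =>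
    rw [ih (by omega) fun i' h1 h2 => h i' h1 (by omega),
      nextLabel_of_ne_green (by omega) (by rw [h i hki (by omega)]; simp)]

theorem nextLabel_eq_or (w : ℕ → WoodColor) (N j : ℕ) :
    nextLabel w N j = .inr .red ∨ ∃ i, j ≤ i ∧ i < N ∧ nextLabel w N j = .inl i := by
  suffices h : ∀ m j, nextLabelAux w m j = .inr .red ∨
      ∃ i, j ≤ i ∧ i < j + m ∧ nextLabelAux w m j = .inl i by
    rcases h (N - j) j with h | ⟨i, h1, h2, h3⟩
    · exact Or.inl h
    · exact Or.inr ⟨i, h1, by omega, h3⟩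
  intro m
  induction m with
  | zero => intro j; exact Or.inl rfl
  | succ m ih =>
    intro j
    rw [nextLabelAux]
    split_ifs with h
    · exact Or.inr ⟨j, le_rfl, by omega, rfl⟩
    · rcases ih (j + 1) with h | ⟨i, h1, h2, h3⟩
      · exact Or.inl h
      · exact Or.inr ⟨i, by omega, by omega, h3⟩

theorem dartLabel_true_of_ne_blue {j : Fin N} (h : w j ≠ .blue) :
    dartLabel w N (.inl j, true) = nextLabel w N j := by
  cases hw : w j
  · exact absurd hw h
  · simp [dartLabel, hw]
  · simp [dartLabel, hw, nextLabel_green j.2 hw]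

theorem dartLabel_true_of_blue {j : Fin N} (h : w j = .blue) :
    dartLabel w N (.inl j, true) = blueLabel w j := by simp [dartLabel, h]

theorem dartLabel_true_of_green {j : Fin N} (h : w j = .green) :
    dartLabel w N (.inl j, true) = .inl j.1 := by simp [dartLabel, h]

theorem dartLabel_false_of_blue {j : Fin N} (h : w j = .blue) :
    dartLabel w N (.inl j, false) = blueLabel w (j + 1) := by simp [dartLabel, h]

theorem dartLabel_false_of_ne_blue {j : Fin N} (h : w j ≠ .blue) :
    dartLabel w N (.inl j, false) = redLabel w j := by
  cases hw : w j
  · exact absurd hw h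
  · simp [dartLabel, hw]
  · simp [dartLabel, hw]

namespace IsGoodWord

variable (hw : IsGoodWord w N)

include hw

theorem exists_blues {j : ℕ} (hj : j < N) (h : w j = .blue) :
    ∃ k i B, (explState w j).blues = (k, i) :: B ∧ blueLabel w j = .inl i ∧ k ≤ i ∧ i < j ∧
      w i = .green ∧ (explState w i).last = k ∧ (explState w k).last = k ∧
      (explState w i).blues = B ∧ (explState w k).blues = B ∧
      (∀ i', k ≤ i' → i' < i → w i' = .red) ∧ (explState w (j + 1)).blues = B := by
  obtain ⟨⟨k, i⟩, B, hB⟩ := List.exists_cons_of_ne_nil (hw.blue_ne j hj h)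
  obtain ⟨h1, h2, h3, h4, h5, h6, h7, h8⟩ := blues_cons_spec hB
  exact ⟨k, i, B, hB, blueLabel_cons hB, h1, h2, h3, h4, h5, h6, h7, h8,
    by rw [explState_blue h, hB]; rfl⟩

/-- A vertex which has been closed does not become the current vertex again. -/
theorem blueLabel_ne {k m : ℕ} (hkm : k < m) (hk : k < N) (h : w k = .blue) :
    blueLabel w m ≠ blueLabel w k := by
  obtain ⟨k', i, B, hB, hl, -, hik, -, -, -, hBi, -, -, hB1⟩ := hw.exists_blues hk h
  rw [hl]
  intro hm
  rcases hBm : (explState w m).blues with _ | ⟨x, B'⟩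
  · rw [blueLabel_nil hBm] at hm; simp at hm
  · rw [blueLabel_cons hBm] at hm
    have hxi : x.2 = i := by simpa using hm
    have hx : x ∈ (explState w m).blues := by rw [hBm]; simp
    -- An entry at time `m` either survived from the stack left by the pop, and was pushed before
    -- time `i`, or was pushed after time `k > i`.
    rcases mem_blues_of_le (show k + 1 ≤ m from hkm) hx with h1 | h1
    · rw [hB1, ← hBi] at h1
      have := mem_blues_lt h1
      omega
    · omega

theorem blueLabel_inj {k m : ℕ} (hk : k < N) (hm : m < N) (h : w k = .blue) (h' : w m = .blue)
    (hl : blueLabel w k = blueLabel w m) : k = m := by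
  rcases lt_trichotomy k m with hkm | rfl | hkm
  · exact absurd hl.symm (hw.blueLabel_ne hkm hk h)
  · rfl
  · exact absurd hl (hw.blueLabel_ne hkm hm h')

theorem exists_reds_label {j : ℕ} (hj : j < N) (h : w j = .red) :
    ∃ k R i, (explState w j).reds = k :: R ∧ redLabel w j = blueLabel w k ∧ k < j ∧
      w k = .blue ∧ blueLabel w k = .inl i ∧ i < k := by
  obtain ⟨k, R, h1, h2, h3, -⟩ := hw.exists_reds hj h
  obtain ⟨k', i, B, -, h4, -, h5, -⟩ := hw.exists_blues (h2.trans hj) h3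
  exact ⟨k, R, i, h1, redLabel_cons h1, h2, h3, h4, h5⟩

omit hw in
-- Together with `dartLabel_of_blue` this is the abstract form of the invariants `tail_green` and
-- `tail_blue`: the stacks at the discovery of a face name the vertices at its green and blue
-- corners.
theorem dartLabel_of_green {d : WordDart N} {k : ℕ} (h : cornerKey w N d = .inl (k, .green)) :
    dartLabel w N d = redLabel w k := by
  rcases d with ⟨j | c, _ | _⟩
  · cases hj : w j
    · rw [cornerKey_false_of_blue hj] at h; simp at h
    · rw [cornerKey_false_of_red hj] at h; simp at h
    · rw [cornerKey_false_of_green hj] at h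
      obtain rfl : j.1 + 1 = k := by simpa using h
      rw [dartLabel_false_of_ne_blue (by simp [hj])]
      exact redLabel_congr (by rw [explState_green hj])
  · by_cases hj : w j = .blue
    · rw [cornerKey_true_of_blue hj] at h
      obtain rfl : j.1 + 1 = k := by simpa using h
      rw [dartLabel_true_of_blue hj]
      exact (redLabel_cons (by rw [explState_blue hj])).symm
    · rw [cornerKey_true_of_ne_blue hj] at h; simp at h
  · cases c <;> simp [cornerKey] at h
  · cases c <;> simp [cornerKey] at h
    subst h
    rfl

theorem dartLabel_of_blue {d : WordDart N} {k : ℕ} (h : cornerKey w N d = .inl (k, .blue)) :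
    dartLabel w N d = blueLabel w k := by
  rcases d with ⟨j | c, _ | _⟩
  · cases hj : w j
    · obtain ⟨k', i, B, hB, -, -, -, -, -, -, -, hk, -, hB1⟩ := hw.exists_blues j.2 hj
      rw [cornerKey_false_of_blue hj, hB] at h
      obtain rfl : k' = k := by simpa using h
      rw [dartLabel_false_of_blue hj]
      exact blueLabel_congr (hB1.trans hk.symm)
    · obtain ⟨k', R, -, hR, hl, -⟩ := hw.exists_reds_label j.2 hj
      rw [cornerKey_false_of_red hj, hR] at h
      obtain rfl : k' = k := by simpa using h
      rw [dartLabel_false_of_ne_blue (by simp [hj]), hl]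
    · rw [cornerKey_false_of_green hj] at h; simp at h
  · by_cases hj : w j = .blue
    · rw [cornerKey_true_of_blue hj] at h; simp at h
    · rw [cornerKey_true_of_ne_blue hj] at h; simp at h
  · cases c <;> simp [cornerKey] at h
  · cases c <;> simp [cornerKey] at h
    subst h
    rw [blueLabel_congr (last_spec w N).2.1, blueLabel_nil hw.blues_end]
    rfl

/-- The dart at the red corner of the face which is left by the letter number `j`. -/
theorem exists_redDart {j : ℕ} (hj : j ≤ N) (h : j < N → w j ≠ .blue) :
    ∃ d, cornerKey w N d = .inl ((explState w j).top, .red) ∧ dartLabel w N d = nextLabel w N j := by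
  rcases hj.lt_or_eq with hj | rfl
  · exact ⟨(.inl ⟨j, hj⟩, true), cornerKey_true_of_ne_blue (h hj), dartLabel_true_of_ne_blue (h hj)⟩
  · exact ⟨(.inr .green, true), rfl, nextLabel_self.symm⟩

theorem dartLabel_rev_of_red {d : WordDart N} {k : ℕ} (h : cornerKey w N d = .inl (k, .red)) :
    dartLabel w N d.rev = redLabel w k := by
  rcases d with ⟨j | c, _ | _⟩
  · cases hj : w j
    · rw [cornerKey_false_of_blue hj] at h; simp at h
    · rw [cornerKey_false_of_red hj] at h; simp at h
    · rw [cornerKey_false_of_green hj] at h; simp at h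
  · by_cases hj : w j = .blue
    · rw [cornerKey_true_of_blue hj] at h; simp at h
    · rw [cornerKey_true_of_ne_blue hj] at h
      obtain rfl : (explState w j).top = k := by simpa using h
      rw [redLabel_congr (hw.top_spec j.2.le).2]
      exact dartLabel_false_of_ne_blue hj
  · cases c <;> simp [cornerKey] at h
  · cases c <;> simp [cornerKey] at h
    subst h
    rw [redLabel_congr (hw.top_spec le_rfl).2, redLabel_nil hw.reds_end]
    rfl

omit hw in
theorem dartLabel_rev_of_green {d : WordDart N} {k : ℕ} (h : cornerKey w N d = .inl (k, .green)) :
    dartLabel w N d.rev = blueLabel w k := by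
  rcases d with ⟨j | c, _ | _⟩
  · cases hj : w j
    · rw [cornerKey_false_of_blue hj] at h; simp at h
    · rw [cornerKey_false_of_red hj] at h; simp at h
    · rw [cornerKey_false_of_green hj] at h
      obtain rfl : j.1 + 1 = k := by simpa using h
      rw [blueLabel_cons (by rw [explState_green hj])]
      exact dartLabel_true_of_green hj
  · by_cases hj : w j = .blue
    · rw [cornerKey_true_of_blue hj] at h
      obtain rfl : j.1 + 1 = k := by simpa using h
      exact dartLabel_false_of_blue hj
    · rw [cornerKey_true_of_ne_blue hj] at h; simp at h
  · cases c <;> simp [cornerKey] at h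
  · cases c <;> simp [cornerKey] at h
    subst h
    rfl

/-- The vertex at a red corner is named only by a later green letter. It suffices to find a time at
which face `k` is `top` and the next letter is not blue: its discovery if its blue corner belongs to
a blue edge or to the outer edge, the moment after it is popped if it belongs to a red edge. -/
theorem dartLabel_of_next_of_blue {d d' : WordDart N} {k : ℕ}
    (h : cornerKey w N d = .inl (k, .blue)) (h' : cornerKey w N d' = .inl (k, .red)) :
    dartLabel w N d' = dartLabel w N d.rev := by
  have key : ∀ {j}, j ≤ N → (j < N → w j ≠ .blue) → (explState w j).top = k →
      dartLabel w N d' = nextLabel w N j := by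
    intro j hj hb ht
    obtain ⟨d'', h1, h2⟩ := hw.exists_redDart hj hb
    rw [ht, ← h'] at h1
    rw [← hw.cornerKey_injective h1, h2]
  rcases d with ⟨j | c, _ | _⟩
  · cases hj : w j
    · obtain ⟨k', i, B, hB, hl, h1, h2, h3, -, h4, -, -, h5, -⟩ := hw.exists_blues j.2 hj
      rw [cornerKey_false_of_blue hj, hB] at h
      obtain rfl : k' = k := by simpa using h
      have hb : w k' ≠ .blue := by
        rcases h1.lt_or_eq with h1 | rfl
        · rw [h5 k' le_rfl h1]; simp
        · rw [h3]; simp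
      rw [key (by omega) (fun _ => hb) (top_eq_of_last_eq h4), nextLabel_of_run h1 (by omega) h5,
        nextLabel_green (by omega) h3]
      exact (hl.symm.trans (dartLabel_true_of_blue hj).symm)
    · obtain ⟨k', R, hR, -⟩ := hw.exists_reds j.2 hj
      rw [cornerKey_false_of_red hj, hR] at h
      obtain rfl : k' = k := by simpa using h
      rw [key (j := j + 1) (by omega) (fun h => hw.no_red_blue j h hj)
        (by rw [explState_red hj, hR]; rfl), ← nextLabel_of_ne_green j.2 (by simp [hj])]
      exact (dartLabel_true_of_ne_blue (by simp [hj])).symm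
    · rw [cornerKey_false_of_green hj] at h; simp at h
  · by_cases hj : w j = .blue
    · rw [cornerKey_true_of_blue hj] at h; simp at h
    · rw [cornerKey_true_of_ne_blue hj] at h; simp at h
  · cases c <;> simp [cornerKey] at h
  · cases c <;> simp [cornerKey] at h
    subst h
    obtain ⟨l1, -, l3, l4⟩ := last_spec w N
    rw [key l1 (fun h => by rw [l3 _ le_rfl h]; simp) (top_eq_of_last_eq l4),
      nextLabel_of_run l1 le_rfl l3, nextLabel_self]
    rfl

/-- The end of a dart is the tail of the next dart along the same face. -/
theorem dartLabel_of_next {d d' : WordDart N} (h : cornerKey w N d' = (cornerKey w N d).next) :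
    dartLabel w N d' = dartLabel w N d.rev := by
  rcases hd : cornerKey w N d with ⟨k, c⟩ | c <;> rw [hd] at h
  · cases c
    · exact hw.dartLabel_of_next_of_blue hd h
    · rw [hw.dartLabel_rev_of_red hd]
      exact dartLabel_of_green h
    · rw [dartLabel_rev_of_green hd]
      exact hw.dartLabel_of_blue h
  · have h1 : d = (.inr c, false) := hw.cornerKey_injective (hd.trans (by cases c <;> rfl))
    have h2 : d' = (.inr c.cw, false) := hw.cornerKey_injective (h.trans (by cases c <;> rfl))
    rw [h1, h2]
    rfl

end IsGoodWord

/-! ### Absence of loops and multiple edges -/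

section Simple

/-- The order in which the vertices are discovered. -/
def vertexRank (N : ℕ) : WordVertex → ℕ
  | .inl i => i + 2
  | .inr .blue => 0
  | .inr .green => 1
  | .inr .red => N + 2

namespace IsGoodWord

variable (hw : IsGoodWord w N)

include hw

theorem vertexRank_redLabel_lt {j : ℕ} (hj : j < N) : vertexRank N (redLabel w j) < j + 2 := by
  rcases hR : (explState w j).reds with _ | ⟨k, R⟩
  · rw [redLabel_nil hR]; simp [vertexRank]
  · rw [redLabel_cons hR]
    obtain ⟨h1, h2, -⟩ := reds_spec (w := w) (j := j) ⟨[], hR.symm⟩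
    obtain ⟨k', i, B, -, h4, -, h5, -⟩ := hw.exists_blues (h1.trans hj) h2
    rw [h4]
    simp only [vertexRank]
    omega

/-- Every edge joins the vertex at which it is closed to one that was discovered earlier. This
excludes loops, and parallel edges must then agree in which end is the later one. -/
theorem vertexRank_lt (j : Fin N) : vertexRank N (dartLabel w N (.inl j, false)) <
    vertexRank N (dartLabel w N (.inl j, true)) := by
  have hr := hw.vertexRank_redLabel_lt j.2
  cases hj : w j
  · obtain ⟨k, i, B, hB, hl, -, -, -, -, -, hBi, -, -, hB1⟩ := hw.exists_blues j.2 hj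
    rw [dartLabel_true_of_blue hj, dartLabel_false_of_blue hj, hl,
      blueLabel_congr (hB1.trans hBi.symm)]
    rcases hB' : (explState w i).blues with _ | ⟨x, B'⟩
    · rw [blueLabel_nil hB']; simp [vertexRank]
    · rw [blueLabel_cons hB']
      have : x.2 < i := mem_blues_lt (w := w) (by rw [hB']; simp)
      simp only [vertexRank]
      omega
  · rw [dartLabel_true_of_ne_blue (by simp [hj]), dartLabel_false_of_ne_blue (by simp [hj])]
    have hj' := j.2
    rcases nextLabel_eq_or w N j with h | ⟨i, h1, h2, h⟩ <;> rw [h] <;> refine hr.trans_le ?_ <;>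
      simp only [vertexRank] <;> omega
  · rw [dartLabel_true_of_green hj, dartLabel_false_of_ne_blue (by simp [hj])]
    exact hr

/-- Edges of one colour are separated by uniqueness of outgoing edges. For different colours the
earlier ends differ: green and red edges lead to vertices already closed, a blue edge to one not yet
closed; and at a given later vertex the red edges pop their vertices before the green edge is drawn.
-/
theorem eq_of_dartLabel_true_eq {i j : Fin N}
    (h1 : dartLabel w N (.inl i, true) = dartLabel w N (.inl j, true))
    (h2 : dartLabel w N (.inl i, false) = dartLabel w N (.inl j, false)) : i = j := by
  have hgb : ∀ i j : Fin N, w i = .green → w j = .blue →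
      dartLabel w N (.inl i, true) = dartLabel w N (.inl j, true) →
      dartLabel w N (.inl i, false) ≠ dartLabel w N (.inl j, false) := by
    intro i j hi hj h1 h2
    obtain ⟨k, i', B, hB, hl, -, -, -, -, -, hBi, -, -, hB1⟩ := hw.exists_blues j.2 hj
    rw [dartLabel_true_of_green hi, dartLabel_true_of_blue hj, hl] at h1
    obtain rfl : i.1 = i' := by simpa using h1
    rw [dartLabel_false_of_ne_blue (by simp [hi]), dartLabel_false_of_blue hj,
      blueLabel_congr (hB1.trans hBi.symm)] at h2
    rcases hR : (explState w i).reds with _ | ⟨k', R⟩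
    · rw [redLabel_nil hR] at h2
      rcases hB' : (explState w i).blues with _ | ⟨x, B'⟩
      · rw [blueLabel_nil hB'] at h2; simp at h2
      · rw [blueLabel_cons hB'] at h2; simp at h2
    · obtain ⟨r1, r2, -⟩ := reds_spec (w := w) (j := i) ⟨[], hR.symm⟩
      rw [redLabel_cons hR] at h2
      exact hw.blueLabel_ne r1 (r1.trans i.2) r2 h2.symm
  have hgr : ∀ i j : Fin N, w i = .green → w j = .red →
      dartLabel w N (.inl i, true) = dartLabel w N (.inl j, true) →
      dartLabel w N (.inl i, false) ≠ dartLabel w N (.inl j, false) := by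
    intro i j hi hj h1 h2
    obtain ⟨k, R, i', hR, hl, r1, r2, hl', -⟩ := hw.exists_reds_label j.2 hj
    have hRk := (reds_spec (w := w) (j := j) ⟨[], hR.symm⟩).2.2
    rw [dartLabel_true_of_green hi, dartLabel_true_of_ne_blue (by simp [hj])] at h1
    have hji : j.1 < i := by
      rcases nextLabel_eq_or w N j with h | ⟨i', h3, -, h⟩ <;> rw [h] at h1
      · simp at h1
      · obtain rfl : i.1 = i' := by simpa using h1
        refine lt_of_le_of_ne h3 fun h => ?_
        rw [← h, hj] at hi; simp at hi
    rw [dartLabel_false_of_ne_blue (by simp [hi]), dartLabel_false_of_ne_blue (by simp [hj]),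
      hl] at h2
    rcases hR' : (explState w i).reds with _ | ⟨k', R'⟩
    · rw [redLabel_nil hR', hl'] at h2; simp at h2
    · obtain ⟨s1, s2, -⟩ := reds_spec (w := w) (j := i) ⟨[], hR'.symm⟩
      rw [redLabel_cons hR'] at h2
      obtain rfl := hw.blueLabel_inj (s1.trans i.2) (r1.trans j.2) s2 r2 h2
      have hmem : k' ∈ (explState w i).reds := by rw [hR']; simp
      -- Face `k'` was popped by letter `j`: entries that remained are below `k'`, later ones are
      -- above `j`.
      rcases mem_reds_of_le (show j.1 + 1 ≤ i from hji) hmem with h3 | h3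
      · rw [explState_red hj, hR, ← hRk] at h3
        have : k' < k' := (mem_reds h3).1
        omega
      · omega
  have hbr : ∀ i j : Fin N, w i = .blue → w j = .red →
      dartLabel w N (.inl i, true) = dartLabel w N (.inl j, true) →
      dartLabel w N (.inl i, false) ≠ dartLabel w N (.inl j, false) := by
    intro i j hi hj h1 h2
    obtain ⟨k, R, i', hR, hl, r1, r2, hl', -⟩ := hw.exists_reds_label j.2 hj
    obtain ⟨k', i'', B, hB, hm, -, -, -, -, -, hBi, -, -, hB1⟩ := hw.exists_blues i.2 hi
    rw [dartLabel_true_of_blue hi, dartLabel_true_of_ne_blue (by simp [hj]), hm] at h1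
    have hji : j.1 ≤ i'' := by
      rcases nextLabel_eq_or w N j with h | ⟨m, h3, -, h⟩ <;> rw [h] at h1
      · simp at h1
      · obtain rfl : i'' = m := by simpa using h1
        exact h3
    rw [dartLabel_false_of_blue hi, dartLabel_false_of_ne_blue (by simp [hj]), hl,
      blueLabel_congr (hB1.trans hBi.symm)] at h2
    exact hw.blueLabel_ne (r1.trans_le hji) (r1.trans j.2) r2 h2
  cases hi : w i <;> cases hj : w j
  · rw [dartLabel_true_of_blue hi, dartLabel_true_of_blue hj] at h1
    exact Fin.ext (hw.blueLabel_inj i.2 j.2 hi hj h1)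
  · exact absurd h2 (hbr i j hi hj h1)
  · exact absurd h2.symm (hgb j i hj hi h1.symm)
  · exact absurd h2.symm (hbr j i hj hi h1.symm)
  · obtain ⟨k, R, i', hR, hl, r1, r2, -⟩ := hw.exists_reds_label i.2 hi
    obtain ⟨k', R', i'', hR', hl', s1, s2, -⟩ := hw.exists_reds_label j.2 hj
    rw [dartLabel_false_of_ne_blue (by simp [hi]), dartLabel_false_of_ne_blue (by simp [hj]), hl,
      hl'] at h2
    obtain rfl := hw.blueLabel_inj (r1.trans i.2) (s1.trans j.2) r2 s2 h2
    have h3 : cornerKey w N (.inl i, false) = cornerKey w N (.inl j, false) := by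
      rw [cornerKey_false_of_red hi, cornerKey_false_of_red hj, hR, hR']; rfl
    simpa using hw.cornerKey_injective h3
  · exact absurd h2.symm (hgr j i hj hi h1.symm)
  · exact absurd h2 (hgb i j hi hj h1)
  · exact absurd h2 (hgr i j hi hj h1)
  · rw [dartLabel_true_of_green hi, dartLabel_true_of_green hj] at h1
    exact Fin.ext (by simpa using h1)

theorem exists_dartLabel_eq_inl (j : Fin N) : ∃ b i, dartLabel w N (.inl j, b) = .inl i := by
  cases hj : w j
  · obtain ⟨k, i, B, hB, hl, -⟩ := hw.exists_blues j.2 hj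
    exact ⟨true, i, by rw [dartLabel_true_of_blue hj, hl]⟩
  · obtain ⟨k, R, i, hR, hl, -, -, hl', -⟩ := hw.exists_reds_label j.2 hj
    exact ⟨false, i, by rw [dartLabel_false_of_ne_blue (by simp [hj]), hl, hl']⟩
  · exact ⟨true, j, dartLabel_true_of_green hj⟩

theorem dartLabel_rev_ne (d : WordDart N) : dartLabel w N d ≠ dartLabel w N d.rev := by
  rcases d with ⟨j | c, _ | _⟩
  · exact fun h => (hw.vertexRank_lt j).ne (congrArg _ h)
  · exact fun h => (hw.vertexRank_lt j).ne' (congrArg _ h)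
  · cases c <;> simp [dartLabel, WordDart.rev, WoodColor.cw]
  · cases c <;> simp [dartLabel, WordDart.rev, WoodColor.cw]

theorem eq_of_dartLabel_eq {d d' : WordDart N} (h1 : dartLabel w N d = dartLabel w N d')
    (h2 : dartLabel w N d.rev = dartLabel w N d'.rev) : d = d' := by
  have hio : ∀ (j : Fin N) b c b', dartLabel w N (.inl j, b) = dartLabel w N (.inr c, b') →
      dartLabel w N (.inl j, !b) ≠ dartLabel w N (.inr c, !b') := by
    intro j b c b' h1 h2
    obtain ⟨b0, i, h⟩ := hw.exists_dartLabel_eq_inl j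
    rcases Bool.eq_or_eq_not b0 b with rfl | rfl
    · rw [h1] at h
      cases b' <;> simp [dartLabel] at h
    · rw [h2] at h
      cases b' <;> simp [dartLabel] at h
  rcases d with ⟨i | c, b⟩ <;> rcases d' with ⟨j | c', b'⟩
  · have hi := hw.vertexRank_lt i
    have hj := hw.vertexRank_lt j
    cases b <;> cases b' <;> simp only [WordDart.rev, Bool.not_false, Bool.not_true] at h1 h2
    · rw [hw.eq_of_dartLabel_true_eq h2 h1]
    · rw [h1, h2] at hi; omega
    · rw [h1, h2] at hi; omega
    · rw [hw.eq_of_dartLabel_true_eq h1 h2]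
  · exact absurd h2 (hio i b c' b' h1)
  · exact absurd h2.symm (hio j b' c b h1.symm)
  · cases b <;> cases b' <;> cases c <;> cases c' <;>
      simp [dartLabel, WordDart.rev, WoodColor.cw] at h1 h2 ⊢

end IsGoodWord

end Simple

end Labels

/-! ### The combinatorial map encoded by a word -/

theorem CombinatorialMap.tail_rot {D : Type} (M : CombinatorialMap D) (d : D) :
    M.tail (M.rot d) = M.tail d :=
  Quotient.sound (Equiv.Perm.SameCycle.symm ⟨1, by simp⟩)

theorem CombinatorialMap.tail_pow_rot {D : Type} (M : CombinatorialMap D) (d : D) (i : ℕ) :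
    M.tail ((M.rot ^ i) d) = M.tail d := by
  induction i with
  | zero => rfl
  | succ i ih => rw [pow_succ', Equiv.Perm.mul_apply, tail_rot, ih]

theorem CornerKey.next_ne (x : CornerKey) : x.next ≠ x := by
  rcases x with ⟨k, c⟩ | c
  · simpa [CornerKey.next] using c.cw_cw_ne
  · simpa [CornerKey.next] using c.cw_ne

theorem WordDart.rev_rev {N : ℕ} (d : WordDart N) : d.rev.rev = d := by
  simp [WordDart.rev]

/-- The permutation of the darts of a word which reverses every dart. -/
def WordDart.revPerm (N : ℕ) : Equiv.Perm (WordDart N) :=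
  ⟨WordDart.rev, WordDart.rev, WordDart.rev_rev, WordDart.rev_rev⟩

/-- Whether the path closes an edge of the given colour at its tail. -/
def WoodColor.closesAtTail : WoodColor → Bool
  | .blue => true
  | .red => false
  | .green => true

/-- The dart `d` has colour `c` and is directed along the orientation. -/
def WordDart.IsOut (w : ℕ → WoodColor) {N : ℕ} (c : WoodColor) (d : WordDart N) : Prop :=
  ∃ j : Fin N, w j = c ∧ d = (.inl j, c.closesAtTail)

/-- The dart `d` has colour `c` and is directed against the orientation. -/
def WordDart.IsIn (w : ℕ → WoodColor) {N : ℕ} (c : WoodColor) (d : WordDart N) : Prop :=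
  ∃ j : Fin N, w j = c ∧ d = (.inl j, !c.closesAtTail)

namespace WordDart

variable {w : ℕ → WoodColor} {N : ℕ} {c c' : WoodColor} {d d' : WordDart N}

theorem isOut_rev : IsOut w c d.rev ↔ IsIn w c d := by
  refine exists_congr fun j => and_congr_right fun _ => ?_
  constructor
  · intro h; rw [← d.rev_rev, h]; rfl
  · intro h; rw [h]; simp [rev]

theorem isIn_rev : IsIn w c d.rev ↔ IsOut w c d := by
  rw [← isOut_rev, rev_rev]

variable (w) in
theorem isOut_or_isIn_or (d : WordDart N) :
    (∃ c, IsOut w c d) ∨ (∃ c, IsIn w c d) ∨ ∃ c b, d = (.inr c, b) := by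
  rcases d with ⟨j | c, b⟩
  · rcases Bool.eq_or_eq_not b (w j).closesAtTail with h | h
    · exact Or.inl ⟨w j, j, rfl, by rw [h]⟩
    · exact Or.inr (Or.inl ⟨w j, j, rfl, by rw [h]⟩)
  · exact Or.inr (Or.inr ⟨c, b, rfl⟩)

theorem IsOut.color_eq (h : IsOut w c d) (h' : IsOut w c' d) : c = c' := by
  obtain ⟨j, rfl, rfl⟩ := h
  obtain ⟨j', rfl, h⟩ := h'
  simp only [Prod.mk.injEq, Sum.inl.injEq] at h
  rw [h.1]

theorem IsOut.not_isIn (h : IsOut w c d) : ¬ IsIn w c' d := by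
  rintro ⟨j', rfl, h'⟩
  obtain ⟨j, rfl, rfl⟩ := h
  simp only [Prod.mk.injEq, Sum.inl.injEq] at h'
  obtain ⟨rfl, h'⟩ := h'
  simp at h'

theorem IsOut.ne_inr {b : Bool} (h : IsOut w c d) : d ≠ (.inr c', b) := by
  obtain ⟨j, -, rfl⟩ := h; simp

theorem IsIn.ne_inr {b : Bool} (h : IsIn w c d) : d ≠ (.inr c', b) := by
  obtain ⟨j, -, rfl⟩ := h; simp

theorem IsIn.exists_cornerKey (h : IsIn w c d) : ∃ k, cornerKey w N d = .inl (k, c) := by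
  obtain ⟨j, hj, rfl⟩ := h
  cases c
  · exact ⟨_, cornerKey_false_of_blue hj⟩
  · exact ⟨_, cornerKey_true_of_ne_blue (by simp [hj])⟩
  · exact ⟨_, cornerKey_false_of_green hj⟩

theorem IsOut.exists_cornerKey (h : IsOut w c d) : ∃ k, cornerKey w N d = .inl (k, c.cw) := by
  obtain ⟨j, hj, rfl⟩ := h
  cases c
  · exact ⟨_, cornerKey_true_of_blue hj⟩
  · exact ⟨_, cornerKey_false_of_red hj⟩
  · exact ⟨_, cornerKey_true_of_ne_blue (by simp [hj])⟩

theorem isIn_or_isOut_of_cornerKey {k : ℕ} (h : cornerKey w N d = .inl (k, c.cw)) :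
    IsIn w c.cw d ∨ IsOut w c d ∨ d = (.inr c, true) := by
  rcases isOut_or_isIn_or w d with ⟨c', h'⟩ | ⟨c', h'⟩ | ⟨c', b, rfl⟩
  · obtain ⟨k', hk⟩ := h'.exists_cornerKey
    rw [hk] at h
    simp only [Sum.inl.injEq, Prod.mk.injEq] at h
    rw [← WoodColor.cw_injective h.2]
    exact Or.inr (Or.inl h')
  · obtain ⟨k', hk⟩ := h'.exists_cornerKey
    rw [hk] at h
    simp only [Sum.inl.injEq, Prod.mk.injEq] at h
    rw [← h.2]
    exact Or.inl h'
  · refine Or.inr (Or.inr ?_)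
    cases b <;> cases c' <;> cases c <;> simp [cornerKey, WoodColor.cw] at h ⊢

end WordDart

open WordDart

namespace IsGoodWord

variable {w : ℕ → WoodColor} {N : ℕ} (hw : IsGoodWord w N)

/-- The next dart along the face on the left of a dart. -/
noncomputable def nextDart (d : WordDart N) : WordDart N :=
  (hw.exists_cornerKey_eq_next d).choose

theorem cornerKey_nextDart (d : WordDart N) :
    cornerKey w N (hw.nextDart d) = (cornerKey w N d).next :=
  (hw.exists_cornerKey_eq_next d).choose_spec

theorem nextDart_injective : Function.Injective hw.nextDart := by
  intro d d' h
  have h' := congrArg (cornerKey w N) h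
  rw [cornerKey_nextDart, cornerKey_nextDart] at h'
  exact hw.cornerKey_injective (CornerKey.next_injective h')

/-- The combinatorial map encoded by a word. -/
noncomputable def map : CombinatorialMap (WordDart N) where
  rot := (WordDart.revPerm N).trans
    (Equiv.ofBijective hw.nextDart (Finite.injective_iff_bijective.1 hw.nextDart_injective))
  rev := WordDart.revPerm N
  rev_rev := WordDart.rev_rev
  rev_ne d h := by
    have : (!d.2) = d.2 := congrArg Prod.snd h
    simp at this

theorem map_rot (d : WordDart N) : hw.map.rot d = hw.nextDart d.rev := rfl

theorem map_face (d : WordDart N) : hw.map.face d = hw.nextDart d := by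
  change hw.nextDart d.rev.rev = _
  rw [WordDart.rev_rev]

theorem cornerKey_face (d : WordDart N) :
    cornerKey w N (hw.map.face d) = (cornerKey w N d).next := by
  rw [map_face, cornerKey_nextDart]

theorem cornerKey_rot (d : WordDart N) :
    cornerKey w N (hw.map.rot d) = (cornerKey w N d.rev).next := by
  rw [map_rot, cornerKey_nextDart]

theorem dartLabel_rot (d : WordDart N) : dartLabel w N (hw.map.rot d) = dartLabel w N d := by
  rw [map_rot, hw.dartLabel_of_next (hw.cornerKey_nextDart _), WordDart.rev_rev]

theorem dartLabel_pow_rot (d : WordDart N) (i : ℕ) :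
    dartLabel w N ((hw.map.rot ^ i) d) = dartLabel w N d := by
  induction i with
  | zero => rfl
  | succ i ih => rw [pow_succ', Equiv.Perm.mul_apply, dartLabel_rot, ih]

theorem dartLabel_eq_of_tail_eq {d d' : WordDart N} (h : hw.map.tail d = hw.map.tail d') :
    dartLabel w N d = dartLabel w N d' := by
  have h' : Equiv.Perm.SameCycle hw.map.rot d d' := Quotient.exact h
  obtain ⟨i, -, rfl⟩ := h'.exists_pow_eq'
  rw [dartLabel_pow_rot]

include hw in
theorem exists_dartLabel_of_isOut {c : WoodColor} {d : WordDart N} (h : IsOut w c d) :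
    ∃ i, dartLabel w N d = .inl i := by
  obtain ⟨j, hj, rfl⟩ := h
  cases c
  · obtain ⟨k, i, B, hB, hl, -⟩ := hw.exists_blues j.2 hj
    exact ⟨i, (dartLabel_true_of_blue hj).trans hl⟩
  · obtain ⟨k, R, i, hR, hl, -, -, hl', -⟩ := hw.exists_reds_label j.2 hj
    exact ⟨i, (dartLabel_false_of_ne_blue (by simp [hj])).trans (hl.trans hl')⟩
  · exact ⟨j, dartLabel_true_of_green hj⟩

include hw in
theorem eq_of_isOut {c : WoodColor} {d d' : WordDart N} (h : IsOut w c d) (h' : IsOut w c d')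
    (hl : dartLabel w N d = dartLabel w N d') : d = d' := by
  obtain ⟨i, hi, rfl⟩ := h
  obtain ⟨j, hj, rfl⟩ := h'
  cases c <;> simp only [WoodColor.closesAtTail] at hl ⊢
  · rw [dartLabel_true_of_blue hi, dartLabel_true_of_blue hj] at hl
    rw [Fin.ext (hw.blueLabel_inj i.2 j.2 hi hj hl)]
  · obtain ⟨k, R, i', hR, hk, r1, r2, -⟩ := hw.exists_reds_label i.2 hi
    obtain ⟨k', R', i'', hR', hk', s1, s2, -⟩ := hw.exists_reds_label j.2 hj
    rw [dartLabel_false_of_ne_blue (by simp [hi]), dartLabel_false_of_ne_blue (by simp [hj]), hk,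
      hk'] at hl
    obtain rfl := hw.blueLabel_inj (r1.trans i.2) (s1.trans j.2) r2 s2 hl
    apply hw.cornerKey_injective
    rw [cornerKey_false_of_red hi, cornerKey_false_of_red hj, hR, hR']
    rfl
  · rw [dartLabel_true_of_green hi, dartLabel_true_of_green hj] at hl
    rw [Fin.ext (Sum.inl.inj hl)]

theorem rot_of_isOut {c : WoodColor} {d : WordDart N} (h : IsOut w c d) :
    IsIn w c.cw.cw (hw.map.rot d) ∨ IsOut w c.cw (hw.map.rot d) := by
  obtain ⟨k, hk⟩ := (isIn_rev.2 h).exists_cornerKey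
  have h1 := hw.cornerKey_rot d
  rw [hk] at h1
  rcases isIn_or_isOut_of_cornerKey h1 with h2 | h2 | h2
  · exact Or.inl h2
  · exact Or.inr h2
  · obtain ⟨i, hi⟩ := hw.exists_dartLabel_of_isOut h
    rw [← hw.dartLabel_rot, h2] at hi
    simp [dartLabel] at hi

theorem rot_of_isIn {c : WoodColor} {d : WordDart N} (h : IsIn w c d) :
    IsIn w c (hw.map.rot d) ∨ IsOut w c.cw.cw (hw.map.rot d) ∨
      hw.map.rot d = (.inr c.cw.cw, true) := by
  obtain ⟨k, hk⟩ := (isOut_rev.2 h).exists_cornerKey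
  have h1 := hw.cornerKey_rot d
  rw [hk] at h1
  have := isIn_or_isOut_of_cornerKey h1
  rwa [WoodColor.cw_cw_cw] at this

/-- Consecutive corner labels force the colours one rotation at a time; the run ends at the first
outgoing dart. -/
theorem exists_run {c : WoodColor} {d : WordDart N} (h : IsOut w c d) : ∃ m : ℕ,
    (∀ j, 0 < j → j ≤ m → IsIn w c.cw.cw ((hw.map.rot ^ j) d)) ∧
      IsOut w c.cw ((hw.map.rot ^ (m + 1)) d) := by
  classical
  have hex : ∃ m : ℕ, ∃ c', IsOut w c' ((hw.map.rot ^ (m + 1)) d) := by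
    -- A full power of the rotation returns to `d`, which is outgoing, so the search for an outgoing
    -- dart ends.
    refine ⟨orderOf hw.map.rot - 1, c, ?_⟩
    rw [Nat.sub_add_cancel (orderOf_pos _), pow_orderOf_eq_one]
    exact h
  obtain ⟨i, hi⟩ := hw.exists_dartLabel_of_isOut h
  have hstep : ∀ j, j ≤ Nat.find hex → (0 < j → IsIn w c.cw.cw ((hw.map.rot ^ j) d)) →
      IsIn w c.cw.cw ((hw.map.rot ^ (j + 1)) d) ∨ IsOut w c.cw ((hw.map.rot ^ (j + 1)) d) := by
    intro j hj hin
    rw [pow_succ', Equiv.Perm.mul_apply]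
    rcases Nat.eq_zero_or_pos j with rfl | h0
    · exact hw.rot_of_isOut h
    · rcases hw.rot_of_isIn (hin h0) with h1 | h1 | h1
      · exact Or.inl h1
      · rw [WoodColor.cw_cw_cw] at h1
        exact Or.inr h1
      · rw [← hw.dartLabel_pow_rot d (j + 1), pow_succ', Equiv.Perm.mul_apply, h1] at hi
        simp [dartLabel] at hi
  have hin : ∀ j, j ≤ Nat.find hex → 0 < j → IsIn w c.cw.cw ((hw.map.rot ^ j) d) := by
    intro j
    induction j with
    | zero => intro _ h; omega
    | succ j ih =>
      intro hj _
      rcases hstep j (by omega) (ih (by omega)) with h1 | h1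
      · exact h1
      · exact absurd ⟨_, h1⟩ (Nat.find_min hex (by omega))
  refine ⟨Nat.find hex, fun j h0 hj => hin j hj h0, ?_⟩
  rcases hstep _ le_rfl (hin _ le_rfl) with h1 | h1
  · obtain ⟨c', h2⟩ := Nat.find_spec hex
    exact absurd h1 h2.not_isIn
  · exact h1

theorem exists_isOut_cw {c : WoodColor} {d : WordDart N} (h : IsOut w c d) :
    ∃ d', IsOut w c.cw d' ∧ hw.map.tail d' = hw.map.tail d := by
  obtain ⟨m, -, hm⟩ := hw.exists_run h
  exact ⟨_, hm, hw.map.tail_pow_rot _ _⟩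

theorem exists_isOut_color {c : WoodColor} {d : WordDart N} (h : IsOut w c d) (c' : WoodColor) :
    ∃ d', IsOut w c' d' ∧ hw.map.tail d' = hw.map.tail d := by
  obtain ⟨d1, h1, t1⟩ := hw.exists_isOut_cw h
  obtain ⟨d2, h2, t2⟩ := hw.exists_isOut_cw h1
  have : c' = c ∨ c' = c.cw ∨ c' = c.cw.cw := by cases c' <;> cases c <;> simp [WoodColor.cw]
  rcases this with rfl | rfl | rfl
  · exact ⟨d, h, rfl⟩
  · exact ⟨d1, h1, t1⟩
  · exact ⟨d2, h2, t2.trans t1⟩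

/-- A quantity which decreases along a run of incoming darts. -/
def runMeasure (N : ℕ) : WoodColor → ℕ → ℕ
  | .blue, k => N - k
  | .red, k => k
  | .green, k => k

/-- Past an incoming blue edge the face number grows, being that of the face found at the edge's
closing; past an incoming red or green edge the path's order is reversed and it drops. -/
theorem runMeasure_lt {c : WoodColor} {d : WordDart N} (h : IsIn w c d) {k : ℕ}
    (hk : cornerKey w N d = .inl (k, c)) :
    ∃ k', cornerKey w N (hw.map.rot d) = .inl (k', c) ∧ runMeasure N c k' < runMeasure N c k := by
  rw [hw.cornerKey_rot]
  obtain ⟨j, hj, rfl⟩ := h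
  have hjN := j.2
  cases c <;> simp only [WoodColor.closesAtTail, WordDart.rev, Bool.not_true, Bool.not_false,
    runMeasure] at hk ⊢
  · obtain ⟨k', i, B, hB, -, h1, h2, -⟩ := hw.exists_blues j.2 hj
    rw [cornerKey_false_of_blue hj, hB] at hk
    obtain rfl : k' = k := by simpa using hk
    rw [cornerKey_true_of_blue hj]
    exact ⟨j + 1, rfl, by omega⟩
  · rw [cornerKey_true_of_ne_blue (by simp [hj])] at hk
    obtain rfl : (explState w j).top = k := by simpa using hk
    obtain ⟨k', R, hR, -⟩ := hw.exists_reds j.2 hj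
    have ht := (hw.top_spec hjN.le).2
    rw [hR] at ht
    rw [cornerKey_false_of_red hj, hR]
    exact ⟨k', rfl, (reds_spec (w := w) ⟨[], ht.symm⟩).1⟩
  · rw [cornerKey_false_of_green hj] at hk
    obtain rfl : j.1 + 1 = k := by simpa using hk
    rw [cornerKey_true_of_ne_blue (by simp [hj])]
    exact ⟨_, rfl, Nat.lt_succ_of_le (hw.top_spec hjN.le).1⟩

theorem rot_inr_true (c : WoodColor) : hw.map.rot (.inr c, true) = (.inr c.cw, false) := by
  apply hw.cornerKey_injective
  rw [hw.cornerKey_rot]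
  cases c <;> rfl

/-- Descent on `runMeasure` excludes rotation cycles that consist of incoming darts only. Such
cycles would be extra vertices invisible to the labels. -/
theorem exists_isOut_or_inr (d : WordDart N) : ∃ d', hw.map.tail d' = hw.map.tail d ∧
    ((∃ c, IsOut w c d') ∨ ∃ c, d' = (.inr c, false)) := by
  have hinr : ∀ c b, ∃ d', hw.map.tail d' = hw.map.tail (.inr c, b) ∧
      ((∃ c, IsOut w c d') ∨ ∃ c, d' = (.inr c, false)) := by
    intro c b
    cases b
    · exact ⟨_, rfl, Or.inr ⟨c, rfl⟩⟩
    · exact ⟨_, hw.map.tail_rot _, Or.inr ⟨_, hw.rot_inr_true c⟩⟩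
  rcases isOut_or_isIn_or w d with h | ⟨c, h⟩ | ⟨c, b, rfl⟩
  · exact ⟨d, rfl, Or.inl h⟩
  · obtain ⟨k, hk⟩ := h.exists_cornerKey
    induction hm : runMeasure N c k using Nat.strong_induction_on generalizing d k with
    | _ m ih =>
      obtain ⟨k', hk', hlt⟩ := hw.runMeasure_lt h hk
      rcases hw.rot_of_isIn h with h1 | h1 | h1
      · obtain ⟨d', h2, h3⟩ := ih _ (hm ▸ hlt) _ h1 k' hk' rfl
        exact ⟨d', h2.trans (hw.map.tail_rot d), h3⟩
      · exact ⟨_, hw.map.tail_rot d, Or.inl ⟨_, h1⟩⟩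
      · obtain ⟨d', h2, h3⟩ := hinr c.cw.cw true
        rw [← h1, hw.map.tail_rot] at h2
        exact ⟨d', h2, h3⟩
  · exact hinr c b

theorem tail_eq_of_dartLabel_eq_inr {d : WordDart N} {c : WoodColor}
    (h : dartLabel w N d = .inr c) : hw.map.tail d = hw.map.tail (.inr c, false) := by
  obtain ⟨d', h1, h2⟩ := hw.exists_isOut_or_inr d
  have h3 := (hw.dartLabel_eq_of_tail_eq h1).trans h
  rcases h2 with ⟨c', h2⟩ | ⟨c', rfl⟩
  · obtain ⟨i, hi⟩ := hw.exists_dartLabel_of_isOut h2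
    rw [hi] at h3; simp at h3
  · obtain rfl : c' = c := by simpa [dartLabel] using h3
    exact h1.symm

theorem exists_isOut_of_dartLabel {d : WordDart N} {i : ℕ} (h : dartLabel w N d = .inl i)
    (c : WoodColor) : ∃ d', IsOut w c d' ∧ hw.map.tail d' = hw.map.tail d := by
  obtain ⟨d', h1, h2⟩ := hw.exists_isOut_or_inr d
  have h3 := (hw.dartLabel_eq_of_tail_eq h1).trans h
  rcases h2 with ⟨c', h2⟩ | ⟨c', rfl⟩
  · obtain ⟨d'', h4, h5⟩ := hw.exists_isOut_color h2 c
    exact ⟨d'', h4, h5.trans h1⟩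
  · simp [dartLabel] at h3

/-- A cycle with an inner label contains an outgoing green dart, and a label has only one; a cycle
with an outer label contains the corresponding outer dart. So labels name the vertices faithfully.
-/
theorem tail_eq_iff {d d' : WordDart N} :
    hw.map.tail d = hw.map.tail d' ↔ dartLabel w N d = dartLabel w N d' := by
  refine ⟨hw.dartLabel_eq_of_tail_eq, fun h => ?_⟩
  rcases hl : dartLabel w N d with i | c
  · obtain ⟨e, h1, h2⟩ := hw.exists_isOut_of_dartLabel hl .green
    obtain ⟨e', h3, h4⟩ := hw.exists_isOut_of_dartLabel (h ▸ hl) .green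
    have h5 := hw.eq_of_isOut h1 h3 ((hw.dartLabel_eq_of_tail_eq h2).trans
      (h.trans (hw.dartLabel_eq_of_tail_eq h4).symm))
    rw [← h2, ← h4, h5]
  · exact (hw.tail_eq_of_dartLabel_eq_inr hl).trans
      (hw.tail_eq_of_dartLabel_eq_inr (h ▸ hl)).symm

theorem isSimple : hw.map.IsSimple := by
  refine ⟨fun d h => ?_, fun d d' h h' => ?_⟩
  · exact hw.dartLabel_rev_ne d (hw.tail_eq_iff.1 h)
  · exact hw.eq_of_dartLabel_eq (hw.tail_eq_iff.1 h) (hw.tail_eq_iff.1 h')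

theorem isTriangulation : hw.map.IsTriangulation := by
  intro d
  constructor
  · intro h
    have h1 := hw.cornerKey_face d
    rw [h] at h1
    exact CornerKey.next_ne _ h1.symm
  · apply hw.cornerKey_injective
    rw [hw.cornerKey_face, hw.cornerKey_face, hw.cornerKey_face]
    rcases cornerKey w N d with ⟨k, c⟩ | c
    · simp only [CornerKey.next, WoodColor.cw_cw_cw]
    · simp only [CornerKey.next, WoodColor.cw_cw_cw]

/-- The dart `d` can be reached from the root. -/
def IsReachable (d : WordDart N) : Prop :=
  ∃ g ∈ Subgroup.closure {hw.map.rot, hw.map.rev}, g (.inr .blue, false) = d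

variable {hw} in
theorem IsReachable.rev {d : WordDart N} (h : hw.IsReachable d) : hw.IsReachable d.rev := by
  obtain ⟨g, hg, rfl⟩ := h
  exact ⟨hw.map.rev * g, Subgroup.mul_mem _ (Subgroup.subset_closure (by simp)) hg, rfl⟩

variable {hw} in
theorem IsReachable.face {d : WordDart N} (h : hw.IsReachable d) :
    hw.IsReachable (hw.map.face d) := by
  obtain ⟨g, hg, h'⟩ := h.rev
  exact ⟨hw.map.rot * g, Subgroup.mul_mem _ (Subgroup.subset_closure (by simp)) hg, by
    rw [Equiv.Perm.mul_apply, h']; rfl⟩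

variable {hw} in
theorem IsReachable.of_cornerKey {d d' : WordDart N} {k : ℕ} {c c' : WoodColor}
    (h : hw.IsReachable d) (hd : cornerKey w N d = .inl (k, c))
    (hd' : cornerKey w N d' = .inl (k, c')) : hw.IsReachable d' := by
  have h1 : cornerKey w N (hw.map.face d) = .inl (k, c.cw.cw) := by
    rw [hw.cornerKey_face, hd]; rfl
  have h2 : cornerKey w N (hw.map.face (hw.map.face d)) = .inl (k, c.cw) := by
    rw [hw.cornerKey_face, h1]; simp only [CornerKey.next, WoodColor.cw_cw_cw]
  have : c' = c ∨ c' = c.cw ∨ c' = c.cw.cw := by cases c' <;> cases c <;> simp [WoodColor.cw]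
  rcases this with rfl | rfl | rfl
  · rwa [hw.cornerKey_injective (hd'.trans hd.symm)]
  · rw [hw.cornerKey_injective (hd'.trans h2.symm)]
    exact h.face.face
  · rw [hw.cornerKey_injective (hd'.trans h1.symm)]
    exact h.face

theorem face_inr (c : WoodColor) : hw.map.face (.inr c, false) = (.inr c.cw, false) :=
  hw.cornerKey_injective ((hw.cornerKey_face _).trans (by cases c <;> rfl))

theorem isReachable_inr (c : WoodColor) : hw.IsReachable (.inr c, false) := by
  have h0 : hw.IsReachable (.inr .blue, false) := ⟨1, Subgroup.one_mem _, rfl⟩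
  have h1 := h0.face
  rw [hw.face_inr] at h1
  have h2 := h1.face
  rw [hw.face_inr] at h2
  cases c
  · exact h0
  · exact h2
  · exact h1

/-- Each inner face other than number zero shares the edge whose closing discovered it with a face
of smaller number; face zero borders the outer face. -/
theorem isReachable_inl (k : ℕ) : ∀ (d : WordDart N) (c : WoodColor),
    cornerKey w N d = .inl (k, c) → hw.IsReachable d := by
  induction k using Nat.strong_induction_on with
  | _ k ih =>
    intro d c hd
    have hmem : cornerKey w N d ∈ wordCorners w N := by
      rw [← hw.image_cornerKey]; exact Finset.mem_image_of_mem _ (Finset.mem_univ _)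
    rw [hd] at hmem
    simp only [wordCorners, Finset.inl_mem_disjSum, Finset.mem_product, Finset.mem_univ,
      and_true, mem_wordFaces] at hmem
    rcases hmem with rfl | ⟨j, hj, hr, rfl⟩
    · exact (hw.isReachable_inr .blue).rev.of_cornerKey (d := (.inr .blue, true)) (c := .green)
        rfl hd
    · cases hc : w j
      · obtain ⟨k, i, B, hB, -, h1, h2, -⟩ := hw.exists_blues hj hc
        have h3 : cornerKey w N (.inl ⟨j, hj⟩, false) = .inl (k, .blue) := by
          rw [cornerKey_false_of_blue hc, hB]; rfl
        exact (ih k (by omega) _ _ h3).rev.of_cornerKey (cornerKey_true_of_blue hc) hd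
      · exact absurd hc hr
      · have h3 : cornerKey w N (.inl ⟨j, hj⟩, true) = .inl ((explState w j).top, .red) :=
          cornerKey_true_of_ne_blue (by simp [hc])
        exact (ih _ (Nat.lt_succ_of_le (hw.top_spec hj.le).1) _ _ h3).rev.of_cornerKey
          (cornerKey_false_of_green hc) hd

theorem isConnected : hw.map.IsConnected := by
  have key : ∀ d, hw.IsReachable d := by
    intro d
    rcases hd : cornerKey w N d with ⟨k, c⟩ | c
    · exact hw.isReachable_inl k d c hd
    · rw [show d = (.inr c, false) from hw.cornerKey_injective (hd.trans (by cases c <;> rfl))]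
      exact hw.isReachable_inr c
  intro d d'
  obtain ⟨g, hg, rfl⟩ := key d
  obtain ⟨g', hg', rfl⟩ := key d'
  exact ⟨g' * g⁻¹, Subgroup.mul_mem _ hg' (Subgroup.inv_mem _ hg), by simp⟩

end IsGoodWord

/-! ### Euler's formula and the encoded Schnyder wood -/

open PlaneTriangulation WordDart

/-- If all the cycles of a permutation have the prime length `p`, then their number is the number
of points divided by `p`. -/
theorem card_eq_mul_card_cycles {D : Type} [Finite D] (f : Equiv.Perm D) (p : ℕ) [Fact p.Prime]
    (hp : ∀ d, f^[p] d = d) (hf : ∀ d, f d ≠ d) :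
    Nat.card D = p * Nat.card (Quotient (Equiv.Perm.SameCycle.setoid f)) := by
  have hper : ∀ d, Function.minimalPeriod f d = p := fun d =>
    Function.minimalPeriod_eq_prime (hp d) (hf d)
  have hfib : ∀ q : Quotient (Equiv.Perm.SameCycle.setoid f),
      Nat.card {d // Quotient.mk (Equiv.Perm.SameCycle.setoid f) d = q} = p := by
    intro q
    obtain ⟨x, rfl⟩ := Quotient.exists_rep q
    have hset : {d | Quotient.mk (Equiv.Perm.SameCycle.setoid f) d = Quotient.mk _ x} =
        (fun i => f^[i] x) '' Set.Iio p := by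
      ext d
      simp only [Set.mem_ofPred_eq, Set.mem_image, Set.mem_Iio]
      constructor
      · intro h
        have h' : Equiv.Perm.SameCycle f x d := (Quotient.exact h).symm
        obtain ⟨i, -, hi⟩ := h'.exists_pow_eq'
        refine ⟨i % p, Nat.mod_lt _ (Fact.out : p.Prime).pos, ?_⟩
        have := Function.iterate_mod_minimalPeriod_eq (f := f) (x := x) (n := i)
        rw [hper] at this
        rw [this, Equiv.Perm.iterate_eq_pow, hi]
      · rintro ⟨i, -, rfl⟩
        refine Quotient.sound (Equiv.Perm.SameCycle.symm ⟨i, ?_⟩)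
        rw [zpow_natCast, ← Equiv.Perm.iterate_eq_pow]
    change Nat.card ↥{d | Quotient.mk (Equiv.Perm.SameCycle.setoid f) d = Quotient.mk _ x} = p
    rw [hset, Nat.card_coe_set_eq, Set.InjOn.ncard_image, ← Finset.coe_Iio,
      Set.ncard_coe_finset, Nat.card_Iio]
    have := Function.iterate_injOn_Iio_minimalPeriod (f := f) (x := x)
    rwa [hper] at this
  let : Fintype (Quotient (Equiv.Perm.SameCycle.setoid f)) := Fintype.ofFinite _
  rw [Nat.card_congr (Equiv.sigmaFiberEquiv
    (Quotient.mk (Equiv.Perm.SameCycle.setoid f))).symm, Nat.card_sigma]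
  simp only [hfib, Finset.sum_const, Finset.card_univ, smul_eq_mul]
  rw [Nat.card_eq_fintype_card, mul_comm]

namespace IsGoodWord

variable {w : ℕ → WoodColor} {N : ℕ} (hw : IsGoodWord w N)

include hw in
theorem card_greens : 3 * Nat.card {j : Fin N // w j = .green} = N := by
  conv_rhs => rw [← hw.card_eq.2]
  congr 1
  rw [← Nat.card_eq_finsetCard]
  refine Nat.card_congr
    ⟨fun j => ⟨j.1.1, by simpa using j.2⟩, fun j => ⟨⟨j.1, ?_⟩, ?_⟩, fun j => rfl, fun j => rfl⟩
  · have := j.2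
    simp only [Finset.mem_filter, Finset.mem_range] at this
    exact this.1
  · have := j.2
    simp only [Finset.mem_filter, Finset.mem_range] at this
    exact this.2

theorem exists_green_tail {d : WordDart N} {i : ℕ} (h : dartLabel w N d = .inl i) :
    ∃ j : Fin N, w j = .green ∧ hw.map.tail (.inl j, true) = hw.map.tail d := by
  obtain ⟨d', ⟨j, h1, rfl⟩, h2⟩ := hw.exists_isOut_of_dartLabel h .green
  exact ⟨j, h1, h2⟩

theorem card_vertex : Nat.card hw.map.Vertex = Nat.card {j : Fin N // w j = .green} + 3 := by
  have h3 : Nat.card WoodColor = 3 := by rw [Nat.card_eq_fintype_card]; rfl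
  rw [← h3, ← Nat.card_sum]
  symm
  refine Nat.card_eq_of_bijective (Sum.elim (fun j => hw.map.tail (.inl j.1, true))
    fun c => hw.map.tail (.inr c, false)) ⟨?_, ?_⟩
  · rintro (⟨i, hi⟩ | c) (⟨j, hj⟩ | c') h <;> simp only [Sum.elim_inl, Sum.elim_inr] at h <;>
      rw [hw.tail_eq_iff] at h
    · rw [dartLabel_true_of_green hi, dartLabel_true_of_green hj] at h
      obtain rfl := Fin.ext (Sum.inl.inj h)
      rfl
    · rw [dartLabel_true_of_green hi] at h
      simp [dartLabel] at h
    · rw [dartLabel_true_of_green hj] at h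
      simp [dartLabel] at h
    · simp only [dartLabel, Sum.inr.injEq] at h
      rw [h]
  · intro v
    obtain ⟨d, rfl⟩ := Quotient.exists_rep v
    rcases hl : dartLabel w N d with i | c
    · obtain ⟨j, h1, h2⟩ := hw.exists_green_tail hl
      exact ⟨.inl ⟨j, h1⟩, h2⟩
    · exact ⟨.inr c, (hw.tail_eq_of_dartLabel_eq_inr hl).symm⟩

/-- For `N = 3n` there are `n + 3` vertices, `3n + 3` edges and, as all faces are triangles, `(6n +
6) / 3 = 2n + 2` faces. -/
theorem isPlanar : hw.map.IsPlanar := by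
  refine ⟨hw.isConnected, ?_⟩
  have h1 := hw.card_vertex
  have h2 := hw.card_greens
  have h3 : Nat.card (WordDart N) = 2 * (N + 3) := by
    rw [Nat.card_eq_fintype_card, Fintype.card_prod, Fintype.card_sum, Fintype.card_fin,
      Fintype.card_bool, mul_comm]
    rfl
  have : Fact (Nat.Prime 2) := ⟨Nat.prime_two⟩
  have : Fact (Nat.Prime 3) := ⟨Nat.prime_three⟩
  have h4 : Nat.card (WordDart N) = 2 * Nat.card hw.map.Edge :=
    card_eq_mul_card_cycles hw.map.rev 2 hw.map.rev_rev hw.map.rev_ne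
  have h5 : Nat.card (WordDart N) = 3 * Nat.card hw.map.Face :=
    card_eq_mul_card_cycles hw.map.face 3 (fun d => (hw.isTriangulation d).2)
      fun d => (hw.isTriangulation d).1
  omega

/-- The plane triangulation encoded by a word. -/
noncomputable def planeTriangulation : PlaneTriangulation (WordDart N) where
  toCombinatorialMap := hw.map
  finite := inferInstance
  planar := hw.isPlanar
  simple := hw.isSimple
  triangulation := hw.isTriangulation
  root := (.inr .blue, false)

theorem outerDart_eq (c : WoodColor) : hw.planeTriangulation.outerDart c = (.inr c, false) := by
  have h1 : hw.planeTriangulation.outerDart .green = (.inr .green, false) := hw.face_inr .blue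
  cases c
  · rfl
  · have h2 : hw.planeTriangulation.outerDart .red =
        hw.map.face (hw.planeTriangulation.outerDart .green) := rfl
    rw [h2, h1, hw.face_inr]
    rfl
  · exact h1

theorem rev_outerDart_eq (c : WoodColor) :
    hw.planeTriangulation.rev (hw.planeTriangulation.outerDart c) = (.inr c, true) := by
  rw [hw.outerDart_eq]; rfl

theorem isOuterEdge_iff {d : WordDart N} :
    hw.planeTriangulation.IsOuterEdge d ↔ ∃ c b, d = (.inr c, b) := by
  constructor
  · rintro ⟨c, rfl | rfl⟩
    · exact ⟨c, false, hw.outerDart_eq c⟩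
    · exact ⟨c, true, hw.rev_outerDart_eq c⟩
  · rintro ⟨c, _ | _, rfl⟩
    · exact ⟨c, Or.inl (hw.outerDart_eq c).symm⟩
    · exact ⟨c, Or.inr (hw.rev_outerDart_eq c).symm⟩

theorem tail_eq_outerVertex_iff {d : WordDart N} {c : WoodColor} :
    hw.planeTriangulation.tail d = hw.planeTriangulation.outerVertex c ↔
      dartLabel w N d = .inr c := by
  have : hw.planeTriangulation.outerVertex c = hw.map.tail (.inr c, false) :=
    congrArg hw.map.tail (hw.outerDart_eq c)
  rw [this]
  exact hw.tail_eq_iff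

theorem isInnerVertex_iff {d : WordDart N} :
    hw.planeTriangulation.IsInnerVertex (hw.planeTriangulation.tail d) ↔
      ∃ i, dartLabel w N d = .inl i := by
  unfold PlaneTriangulation.IsInnerVertex
  simp only [ne_eq, hw.tail_eq_outerVertex_iff]
  rcases dartLabel w N d with i | c <;> simp

theorem size_eq : 3 * hw.planeTriangulation.size = N := by
  refine Eq.trans ?_ hw.card_greens
  congr 1
  symm
  refine Nat.card_eq_of_bijective (fun j => ⟨hw.planeTriangulation.tail (.inl j.1, true),
    hw.isInnerVertex_iff.2 ⟨_, dartLabel_true_of_green j.2⟩⟩) ⟨?_, ?_⟩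
  · rintro ⟨i, hi⟩ ⟨j, hj⟩ h
    have h' := hw.tail_eq_iff.1 (congrArg Subtype.val h)
    simp only at h'
    rw [dartLabel_true_of_green hi, dartLabel_true_of_green hj] at h'
    obtain rfl := Fin.ext (Sum.inl.inj h')
    rfl
  · rintro ⟨v, hv⟩
    obtain ⟨d, rfl⟩ := Quotient.exists_rep v
    obtain ⟨i, hi⟩ := hw.isInnerVertex_iff.1 hv
    obtain ⟨j, h1, h2⟩ := hw.exists_green_tail hi
    exact ⟨⟨j, h1⟩, Subtype.ext h2⟩

/-- The colour of a dart of a word. -/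
def _root_.WordDart.color (w : ℕ → WoodColor) (d : WordDart N) : Option WoodColor :=
  match d.1 with
  | .inl j => some (w j)
  | .inr _ => none

theorem _root_.WordDart.isOut_iff {c : WoodColor} {d : WordDart N} :
    IsOut w c d ↔ (∃ c', IsOut w c' d) ∧ d.color w = some c := by
  constructor
  · intro h
    refine ⟨⟨c, h⟩, ?_⟩
    obtain ⟨j, rfl, rfl⟩ := h
    rfl
  · rintro ⟨⟨c', h⟩, h'⟩
    have : d.color w = some c' := by obtain ⟨j, rfl, rfl⟩ := h; rfl
    rw [this] at h'
    rwa [← Option.some.inj h']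

theorem _root_.WordDart.isIn_iff {c : WoodColor} {d : WordDart N} :
    IsIn w c d ↔ (¬ ∃ c', IsOut w c' d) ∧ d.color w = some c := by
  constructor
  · intro h
    refine ⟨fun ⟨c', h'⟩ => h'.not_isIn h, ?_⟩
    obtain ⟨j, rfl, rfl⟩ := h
    rfl
  · rintro ⟨h, h'⟩
    rcases isOut_or_isIn_or w d with h1 | ⟨c', h1⟩ | ⟨c', b, rfl⟩
    · exact absurd h1 h
    · have : d.color w = some c' := by obtain ⟨j, rfl, rfl⟩ := h1; rfl
      rw [this] at h'
      rwa [← Option.some.inj h']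
    · simp [WordDart.color] at h'

/-- The Schnyder wood encoded by a word. -/
noncomputable def schnyderWood : SchnyderWood hw.planeTriangulation where
  out := {d | ∃ c, IsOut w c d}
  color := WordDart.color w
  color_eq_none_iff d := by
    rw [hw.isOuterEdge_iff]
    rcases d with ⟨j | c, b⟩ <;> simp [WordDart.color]
  color_rev d := rfl
  not_out_of_outer d hd := by
    obtain ⟨c, b, rfl⟩ := hw.isOuterEdge_iff.1 hd
    rintro ⟨c', h⟩
    exact h.ne_inr rfl
  out_rev_iff d hd := by
    rw [hw.isOuterEdge_iff] at hd
    change (∃ c, IsOut w c d.rev) ↔ ¬ ∃ c, IsOut w c d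
    rcases isOut_or_isIn_or w d with h | ⟨c, h⟩ | h
    · obtain ⟨c, h'⟩ := h
      simp only [WordDart.isOut_rev]
      exact ⟨fun ⟨c', h''⟩ => absurd h'' h'.not_isIn, fun h'' => absurd ⟨c, h'⟩ h''⟩
    · exact ⟨fun _ ⟨c', h'⟩ => h'.not_isIn h, fun _ => ⟨c, WordDart.isOut_rev.2 h⟩⟩
    · exact absurd h hd
  out_degree v hv := by
    obtain ⟨d, rfl⟩ := Quotient.exists_rep v
    obtain ⟨i, hi⟩ := hw.isInnerVertex_iff.1 hv
    choose f hf hft using hw.exists_isOut_of_dartLabel hi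
    have hinj : Function.Injective f := fun a b hab => (hf a).color_eq (hab ▸ hf b)
    have hset : {x | hw.planeTriangulation.tail x = Quotient.mk _ d ∧ x ∈ {d | ∃ c, IsOut w c d}} =
        Set.range f := by
      ext x
      constructor
      · rintro ⟨h1, c, h2⟩
        refine ⟨c, hw.eq_of_isOut (hf c) h2 (hw.tail_eq_iff.1 ((hft c).trans h1.symm))⟩
      · rintro ⟨c, rfl⟩
        exact ⟨hft c, c, hf c⟩
    rw [hset, ← Set.image_univ, Set.ncard_image_of_injective _ hinj, Set.ncard_univ,
      Nat.card_eq_fintype_card]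
    rfl
  rule d c _ hd hc := by
    have h := WordDart.isOut_iff.2 ⟨hd, hc⟩
    obtain ⟨m, h1, h2⟩ := hw.exists_run h
    refine ⟨m, fun j h0 hj => WordDart.isIn_iff.1 (h1 j h0 hj), WordDart.isOut_iff.1 h2⟩
  outer_rule d c hd hc := by
    rw [hw.isOuterEdge_iff] at hd
    rw [hw.tail_eq_outerVertex_iff] at hc
    rcases isOut_or_isIn_or w d with ⟨c', h⟩ | ⟨c', h⟩ | h
    · obtain ⟨i, hi⟩ := hw.exists_dartLabel_of_isOut h
      rw [hi] at hc; simp at hc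
    · suffices hcc : c' = c by
        subst hcc
        exact WordDart.isIn_iff.1 h
      obtain ⟨k, hk⟩ := h.exists_cornerKey
      obtain ⟨j, hj, rfl⟩ := h
      cases c'
      · rw [hw.dartLabel_of_blue hk] at hc
        rcases hB : (explState w k).blues with _ | ⟨x, B⟩
        · rw [blueLabel_nil hB] at hc
          exact Sum.inr.inj hc
        · rw [blueLabel_cons hB] at hc; simp at hc
      · rw [show ((Sum.inl j, !WoodColor.closesAtTail .red) : WordDart N) = (.inl j, true) from rfl,
          dartLabel_true_of_ne_blue (by simp [hj])] at hc
        rcases nextLabel_eq_or w N j with h1 | ⟨i, -, -, h1⟩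
        · rw [h1] at hc
          exact Sum.inr.inj hc
        · rw [h1] at hc; simp at hc
      · rw [dartLabel_of_green hk] at hc
        rcases hR : (explState w k).reds with _ | ⟨k', R⟩
        · rw [redLabel_nil hR] at hc
          exact Sum.inr.inj hc
        · rw [redLabel_cons hR] at hc
          obtain ⟨r1, r2, -⟩ := reds_spec (w := w) (j := k) ⟨[], hR.symm⟩
          have hkN : k ≤ N := by
            rw [show ((Sum.inl j, !WoodColor.closesAtTail .green) : WordDart N) = (.inl j, false)
              from rfl, cornerKey_false_of_green hj] at hk
            obtain rfl : j.1 + 1 = k := by simpa using hk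
            exact j.2
          obtain ⟨k'', i, B, -, hl, -⟩ := hw.exists_blues (by omega) r2
          rw [hl] at hc; simp at hc
    · exact absurd h hd

theorem isOut_schnyderWood {c : WoodColor} {d : WordDart N} :
    hw.schnyderWood.IsOut c d ↔ IsOut w c d := WordDart.isOut_iff.symm

theorem isIn_schnyderWood {c : WoodColor} {d : WordDart N} :
    hw.schnyderWood.IsIn c d ↔ IsIn w c d := WordDart.isIn_iff.symm

/-! ### Exploring the encoded map -/

/-- The dart at which the path closes the edge number `j`, where the number zero is that of the
outer edge between `A_g` and `A_b`. -/
def closing (N : ℕ) (j : ℕ) : WordDart N :=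
  if h : 0 < j ∧ j ≤ N then (.inl ⟨j - 1, by omega⟩, true) else (.inr .blue, true)

theorem closing_succ {j : ℕ} (hj : j < N) : closing N (j + 1) = (.inl ⟨j, hj⟩, true) :=
  dif_pos ⟨Nat.succ_pos j, hj⟩

theorem closing_zero : closing N 0 = (.inr .blue, true) := dif_neg (by simp)

theorem isIn_red_closing {j : ℕ} (hj : j ≤ N) :
    IsIn w .red (closing N j) ↔ ∃ i, i + 1 = j ∧ w i = .red := by
  rcases j with _ | j
  · rw [closing_zero]
    refine iff_of_false (fun h => h.ne_inr rfl) (by simp)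
  · rw [closing_succ hj]
    constructor
    · rintro ⟨i, h1, h2⟩
      simp only [Prod.mk.injEq, Sum.inl.injEq] at h2
      rw [← h2.1] at h1
      exact ⟨j, rfl, h1⟩
    · rintro ⟨i, h1, h2⟩
      obtain rfl : i = j := by omega
      exact ⟨_, h2, rfl⟩

/-- The faces as numbered by the path and as numbered by the word agree. It is enough to compare the
green corners, from which `face` gives the others. -/
theorem cornerKey_cornerDart {j : ℕ} (hj : j ≤ N) (hr : ¬ IsIn w .red (closing N j))
    (h : hw.schnyderWood.closingDart j = closing N j) (c : WoodColor) :
    cornerKey w N (hw.schnyderWood.cornerDart j c) = .inl (j, c) := by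
  have hg : cornerKey w N (hw.schnyderWood.cornerDart j .green) = .inl (j, .green) := by
    simp only [SchnyderWood.cornerDart, SchnyderWood.faceDart]
    by_cases hout : hw.schnyderWood.IsOut .green (hw.schnyderWood.closingDart j)
    · rw [if_pos hout]
      rw [hw.isOut_schnyderWood, h] at hout
      rw [h]
      rcases j with _ | j
      · rw [closing_zero] at hout
        exact absurd rfl hout.ne_inr
      · rw [closing_succ hj] at hout ⊢
        obtain ⟨i, h1, h2⟩ := hout
        simp only [Prod.mk.injEq, Sum.inl.injEq] at h2
        rw [← h2.1] at h1
        exact cornerKey_false_of_green (j := ⟨j, hj⟩) h1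
    · rw [if_neg hout]
      rw [hw.isOut_schnyderWood, h] at hout
      rw [h]
      rcases j with _ | j
      · rw [closing_zero]
        rfl
      · rw [isIn_red_closing hj] at hr
        rw [closing_succ hj] at hout ⊢
        refine cornerKey_true_of_blue (j := ⟨j, hj⟩) ?_
        cases h' : w j
        · rfl
        · exact absurd ⟨j, rfl, h'⟩ hr
        · exact absurd ⟨_, h', rfl⟩ hout
  have hf : ∀ d, hw.planeTriangulation.face d = hw.map.face d := fun _ => rfl
  have hb : cornerKey w N (hw.schnyderWood.cornerDart j .blue) = .inl (j, .blue) := by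
    have := hw.schnyderWood.face_cornerDart j .green
    simp only [WoodColor.cw] at this
    rw [← this, hf, hw.cornerKey_face, hg]
    rfl
  cases c
  · exact hb
  · have := hw.schnyderWood.face_cornerDart j .blue
    simp only [WoodColor.cw] at this
    rw [← this, hf, hw.cornerKey_face, hb]
    rfl
  · exact hg

include hw in
-- If the corner belonged to an incoming blue edge, face `j` would have been put on `blues` after
-- red letters followed by a green one; if to the outer edge, only red letters would follow. Neither
-- fits a blue letter `j`.
theorem isOut_red_of_cornerKey {j : ℕ} (hj : j < N) (h : w j = .blue) {d : WordDart N}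
    (hd : cornerKey w N d = .inl (j, .blue)) : IsOut w .red d := by
  rcases isIn_or_isOut_of_cornerKey (c := .red) hd with h1 | h1 | h1
  · obtain ⟨i, hi, rfl⟩ := h1
    obtain ⟨k, i', B, hB, -, b1, b2, b3, -, -, -, -, b4, -⟩ := hw.exists_blues i.2 hi
    rw [show ((Sum.inl i, !WoodColor.closesAtTail (WoodColor.cw .red)) : WordDart N) =
      (.inl i, false) from rfl, cornerKey_false_of_blue hi, hB] at hd
    obtain rfl : k = j := by simpa using hd
    rcases b1.lt_or_eq with b1 | rfl
    · rw [b4 k le_rfl b1] at h; simp at h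
    · rw [b3] at h; simp at h
  · exact h1
  · rw [h1] at hd
    obtain rfl : (explState w N).last = j := by simpa [cornerKey] using hd
    rw [(last_spec w N).2.2.1 _ le_rfl hj] at h
    simp at h

/-- The description of the next closing, proved for every Schnyder wood, is applied to the encoded
one; corner keys then identify the dart. As it is never the final dart of the path, the path lasts
for all `N` closings. -/
theorem closingDart_eq {j : ℕ} (hj : j ≤ N) : hw.schnyderWood.closingDart j = closing N j ∧
    hw.schnyderWood.closingTime j < hw.schnyderWood.pathLength := by
  induction j with
  | zero =>
    rw [closing_zero, SchnyderWood.closingDart_zero, hw.rev_outerDart_eq]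
    exact ⟨rfl, SchnyderWood.closingTime_zero_lt _⟩
  | succ j ih =>
    obtain ⟨h1, h2⟩ := ih (by omega)
    rw [closing_succ hj]
    have hend : ((Sum.inl ⟨j, hj⟩, true) : WordDart N) ≠
        hw.planeTriangulation.rev (hw.planeTriangulation.outerDart .green) := by
      rw [hw.rev_outerDart_eq]; simp
    have hkey := hw.cornerKey_cornerDart (by omega) (h := h1)
    by_cases hb : w j = .blue
    · have hr : ¬ IsIn w .red (closing N j) := by
        rw [isIn_red_closing (by omega)]
        rintro ⟨i, rfl, hi⟩
        exact hw.no_red_blue i hj hi hb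
      have hk := hkey hr .blue
      obtain ⟨n1, n2, n3, -⟩ := SchnyderWood.next_of_isOut_red h2
        (by rwa [h1, hw.isIn_schnyderWood])
        (hw.isOut_schnyderWood.2 (hw.isOut_red_of_cornerKey hj hb hk))
      refine ⟨hw.eq_of_isOut (hw.isOut_schnyderWood.1 n1) ⟨_, hb, rfl⟩ ?_, n3⟩
      rw [hw.dartLabel_eq_of_tail_eq n2, hw.dartLabel_of_blue hk]
      exact (dartLabel_true_of_blue (j := ⟨j, hj⟩) hb).symm
    · have hk := cornerKey_true_of_ne_blue (N := N) (j := ⟨j, hj⟩) hb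
      by_cases hr : IsIn w .red (closing N j)
      · have hrot : hw.planeTriangulation.rot (closing N j) = (.inl ⟨j, hj⟩, true) := by
          apply hw.cornerKey_injective
          obtain ⟨i, rfl, hi⟩ := (isIn_red_closing (by omega)).1 hr
          obtain ⟨k, R, hR, -⟩ := hw.exists_reds (show i < N by omega) hi
          rw [hk, closing_succ (by omega)]
          refine (hw.cornerKey_rot _).trans ?_
          rw [show WordDart.rev ((Sum.inl ⟨i, _⟩, true) : WordDart N) =
            (.inl ⟨i, by omega⟩, false) from rfl, cornerKey_false_of_red hi, explState_red hi]
          rfl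
        have := SchnyderWood.next_of_isIn_red h2 (by rwa [h1, hw.isIn_schnyderWood])
        rw [h1, hrot] at this
        rcases this with ⟨-, n1, n2⟩ | ⟨n1, -⟩
        · exact ⟨n1, n2⟩
        · exact absurd n1 hend
      · have hfresh : (explState w j).top = j := by
          rcases j with _ | j
          · rfl
          · exact top_eq_of_ne_red fun h => hr ((isIn_red_closing (by omega)).2 ⟨j, rfl, h⟩)
        have hc : hw.schnyderWood.cornerDart j .red = (.inl ⟨j, hj⟩, true) := by
          apply hw.cornerKey_injective
          rw [hkey hr, hk, hfresh]
        have hout : ¬ hw.schnyderWood.IsOut .red (hw.schnyderWood.cornerDart j .blue) := by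
          rw [hw.isOut_schnyderWood]
          rintro ⟨i, hi, hi'⟩
          have hk' := hkey hr .blue
          obtain ⟨k, R, hR, -, hkb, -⟩ := hw.exists_reds i.2 hi
          rw [hi', show ((Sum.inl i, WoodColor.closesAtTail .red) : WordDart N) =
            (.inl i, false) from rfl, cornerKey_false_of_red hi, hR] at hk'
          obtain rfl : k = j := by simpa using hk'
          exact hb hkb
        have := (SchnyderWood.next_of_isIn_blue h2 (by rwa [h1, hw.isIn_schnyderWood]) hout).2
        rw [hc] at this
        rcases this with ⟨-, n1, n2⟩ | ⟨n1, -⟩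
        · exact ⟨n1, n2⟩
        · exact absurd n1 hend

/-- The number of closings is known from the size of the triangulation, so only the colours, given
by `closingDart_eq`, have to be compared. -/
theorem walk_schnyderWood : hw.schnyderWood.walk = wordWalk w N := by
  obtain ⟨w', M, h⟩ := hw.schnyderWood.exists_isExploredBy
  obtain rfl : M = N := h.length_eq.trans hw.size_eq
  rw [h.walk_eq]
  refine List.map_congr_left fun j hj => ?_
  have hww : ∀ i < M, w' i = w i := by
    intro i hi
    have h1 := h.color i hi
    rw [(hw.closingDart_eq hi).1, closing_succ hi] at h1
    exact (Option.some.inj h1).symm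
  unfold wordPosition
  rw [explState_congr hww j (by simpa [Nat.lt_succ_iff] using hj)]

end IsGoodWord

/-! ### Words against lattice walks, and the theorem -/

theorem SchnyderWood.colorStep_injective : Function.Injective SchnyderWood.colorStep := by
  intro a b
  cases a <;> cases b <;> simp [SchnyderWood.colorStep]

theorem IsGoodWord.eq_of_wordWalk_eq {w w' : ℕ → WoodColor} {N : ℕ} (hw : IsGoodWord w N)
    (hw' : IsGoodWord w' N) (h : wordWalk w N = wordWalk w' N) : ∀ j < N, w j = w' j := by
  have hp : ∀ j ≤ N, wordPosition w j = wordPosition w' j := fun j hj =>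
    List.map_inj_left.1 h j (List.mem_range.2 (Nat.lt_succ_of_le hj))
  intro j hj
  have h1 := hw.wordPosition_succ hj
  rw [hp j hj.le, hp (j + 1) hj, hw'.wordPosition_succ hj] at h1
  exact (SchnyderWood.colorStep_injective (add_left_cancel h1)).symm

theorem IsGoodWord.wordWalk_mem_latticeWalks {w : ℕ → WoodColor} {n : ℕ}
    (hw : IsGoodWord w (3 * n)) : wordWalk w (3 * n) ∈ latticeWalks n := by
  have hlen : (wordWalk w (3 * n)).length = 3 * n + 1 := by simp [wordWalk]
  have hget : ∀ (j : ℕ) (hj : j < (wordWalk w (3 * n)).length),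
      (wordWalk w (3 * n))[j] = wordPosition w j := by
    intro j hj
    simp [wordWalk]
  have hstep : ∀ j, j < 3 * n →
      wordPosition w (j + 1) - wordPosition w j = SchnyderWood.colorStep (w j) := by
    intro j hj
    rw [hw.wordPosition_succ hj, add_sub_cancel_left]
  refine ⟨hlen, ?_, ?_, ?_, ?_, ?_⟩
  · rw [hget]
    rfl
  · rw [hget, wordPosition, hw.reds_end, hw.blues_end]
    rfl
  · intro p hp
    obtain ⟨j, -, rfl⟩ := List.mem_map.1 hp
    exact ⟨Int.natCast_nonneg _, Int.natCast_nonneg _⟩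
  · intro k hk
    rw [hget, hget, hstep k hk]
    cases w k <;> simp [SchnyderWood.colorStep]
  · rintro k hk ⟨h1, h2⟩
    rw [hget, hget, hstep _ (by omega)] at h1
    rw [hget, hget, hstep _ hk] at h2
    exact hw.no_red_blue k hk (SchnyderWood.colorStep_injective (a₂ := .red) h1)
      (SchnyderWood.colorStep_injective (a₂ := .blue) h2)

theorem exists_isGoodWord_of_mem_latticeWalks {n : ℕ} {Z : List (ℤ × ℤ)}
    (hZ : Z ∈ latticeWalks n) : ∃ w, IsGoodWord w (3 * n) ∧ wordWalk w (3 * n) = Z := by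
  obtain ⟨hlen, h0, hend, hpos, hstep, hno⟩ := hZ
  have hcol : ∀ k : ℕ, ∃ c : WoodColor, ∀ hk : k < 3 * n,
      Z[k + 1] - Z[k] = SchnyderWood.colorStep c := by
    intro k
    by_cases hk : k < 3 * n
    · rcases hstep k hk with h | h | h
      · exact ⟨.green, fun _ => h⟩
      · exact ⟨.red, fun _ => h⟩
      · exact ⟨.blue, fun _ => h⟩
    · exact ⟨.blue, fun h => absurd h hk⟩
  choose w hw using hcol
  have hspec : ∀ j (hj : j ≤ 3 * n), wordPosition w j = Z[j] ∧
      ∀ i < j, (w i = .red → (explState w i).reds ≠ []) ∧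
        (w i = .blue → (explState w i).blues ≠ []) := by
    intro j
    induction j with
    | zero => exact fun _ => ⟨h0.symm, by simp⟩
    | succ j ih =>
      intro hj
      obtain ⟨ih1, ih2⟩ := ih (by omega)
      have hZj : Z[j + 1] = wordPosition w j + SchnyderWood.colorStep (w j) := by
        rw [ih1, ← hw j hj, add_sub_cancel]
      obtain ⟨p1, p2⟩ := hpos Z[j + 1] (List.getElem_mem _)
      rw [hZj] at p1 p2 ⊢
      -- With the relevant stack empty, the step would bring that coordinate to `-1`, outside the
      -- quadrant.
      have hlast : (w j = .red → (explState w j).reds ≠ []) ∧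
          (w j = .blue → (explState w j).blues ≠ []) := by
        constructor <;> intro h hnil <;>
          simp [h, wordPosition, hnil, SchnyderWood.colorStep] at p1 p2
      refine ⟨wordPosition_succ hlast.1 hlast.2, fun i hi => ?_⟩
      rcases Nat.lt_succ_iff_lt_or_eq.1 hi with hi | rfl
      · exact ih2 i hi
      · exact hlast
  have hlast := (hspec (3 * n) le_rfl).1.trans hend
  simp only [wordPosition, Prod.mk.injEq, Nat.cast_eq_zero, List.length_eq_zero_iff] at hlast
  refine ⟨w, ⟨fun j hj => ((hspec (j + 1) hj).2 j (Nat.lt_succ_self j)).1,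
    fun j hj => ((hspec (j + 1) hj).2 j (Nat.lt_succ_self j)).2, fun j hj h1 h2 => ?_,
    hlast.1, hlast.2⟩, ?_⟩
  · refine hno j hj ⟨?_, ?_⟩
    · rw [hw j (by omega), h1]; rfl
    · exact (hw (j + 1) hj).trans (by rw [h2]; rfl)
  · refine List.ext_getElem (by simp [wordWalk, hlen]) fun j hj hj' => ?_
    rw [← (hspec j (by omega)).1]
    simp [wordWalk]

/-- Wooded triangulations which are explored by the same word are isomorphic. -/
noncomputable def WoodedTriangulation.isoOfIsExploredBy {n : ℕ} {S S' : WoodedTriangulation n}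
    {w : ℕ → WoodColor} {M : ℕ} (h : S.wood.IsExploredBy w M) (h' : S'.wood.IsExploredBy w M) :
    Iso S S' := by
  let e := Equiv.ofBijective _ ⟨h.wordDart_injective, h.wordDart_surjective⟩
  let e' := Equiv.ofBijective _ ⟨h'.wordDart_injective, h'.wordDart_surjective⟩
  have he : ∀ x, (e.symm.trans e') (S.wood.wordDart x) = S'.wood.wordDart x := fun x =>
    congrArg e' (e.symm_apply_apply x)
  have hrev : ∀ d, (e.symm.trans e') (S.map.rev d) = S'.map.rev ((e.symm.trans e') d) := by
    intro d
    obtain ⟨x, rfl⟩ := h.wordDart_surjective d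
    rw [← SchnyderWood.wordDart_rev, he, he, SchnyderWood.wordDart_rev]
  have hface : ∀ d, (e.symm.trans e') (S.map.face d) = S'.map.face ((e.symm.trans e') d) := by
    intro d
    obtain ⟨x, rfl⟩ := h.wordDart_surjective d
    obtain ⟨y, hy⟩ := h.isGoodWord.exists_cornerKey_eq_next x
    rw [h.face_wordDart hy, he, he, h'.face_wordDart hy]
  refine ⟨e.symm.trans e', fun d => ?_, hrev, he (.inr .blue, false), fun d => ?_, fun d => ?_⟩
  · have h1 := hface (S.map.rev d)
    rw [hrev] at h1
    simpa [CombinatorialMap.face, CombinatorialMap.rev_rev] using h1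
  · obtain ⟨x, rfl⟩ := h.wordDart_surjective d
    rw [he]
    rcases x with ⟨i | c, b⟩
    · rw [h.wordDart_mem_out_inl, h'.wordDart_mem_out_inl]
    · exact iff_of_false (SchnyderWood.IsExploredBy.wordDart_not_mem_out_inr c b)
        (SchnyderWood.IsExploredBy.wordDart_not_mem_out_inr c b)
  · obtain ⟨x, rfl⟩ := h.wordDart_surjective d
    rw [he]
    rcases x with ⟨i | c, b⟩
    · rw [h.color_wordDart_inl, h'.color_wordDart_inl]
    · rw [SchnyderWood.IsExploredBy.color_wordDart_inr,
        SchnyderWood.IsExploredBy.color_wordDart_inr]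

theorem WoodedTriangulation.exists_isExploredBy {n : ℕ} (S : WoodedTriangulation n) :
    ∃ w, S.wood.IsExploredBy w (3 * n) := by
  obtain ⟨w, M, h⟩ := S.wood.exists_isExploredBy
  have hM := h.length_eq
  rw [S.size_eq] at hM
  exact ⟨w, hM ▸ h⟩

theorem WoodedTriangulation.nonempty_iso_of_walk_eq {n : ℕ} {S S' : WoodedTriangulation n}
    (hS : S.wood.walk = S'.wood.walk) : Nonempty (Iso S S') := by
  obtain ⟨w, h⟩ := S.exists_isExploredBy
  obtain ⟨w', h'⟩ := S'.exists_isExploredBy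
  rw [h.walk_eq, h'.walk_eq] at hS
  have hww := h.isGoodWord.eq_of_wordWalk_eq h'.isGoodWord hS
  exact ⟨isoOfIsExploredBy h ⟨h'.lt_iff, fun j hj => (h'.color j hj).trans (by rw [hww j hj])⟩⟩

theorem theorem1p2 (n : ℕ) :
    (∀ S : WoodedMaps n, woodToWalk n S ∈ latticeWalks n) ∧
      Set.BijOn (woodToWalk n) Set.univ (latticeWalks n) := by
  have hmem : ∀ S : WoodedMaps n, woodToWalk n S ∈ latticeWalks n := by
    refine Quotient.ind fun S => ?_
    obtain ⟨w, h⟩ := S.exists_isExploredBy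
    change S.wood.walk ∈ latticeWalks n
    rw [h.walk_eq]
    exact h.isGoodWord.wordWalk_mem_latticeWalks
  refine ⟨hmem, fun S _ => hmem S, ?_, ?_⟩
  · intro S _ S' _
    induction S, S' using Quotient.ind₂ with
    | _ S S' => exact fun h => Quotient.sound (WoodedTriangulation.nonempty_iso_of_walk_eq h)
  · intro Z hZ
    obtain ⟨w, hw, rfl⟩ := exists_isGoodWord_of_mem_latticeWalks hZ
    have hsize : hw.planeTriangulation.size = n := by
      have := hw.size_eq
      omega
    exact ⟨Quotient.mk _ ⟨_, hw.planeTriangulation, hsize, hw.schnyderWood⟩, trivial,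
      hw.walk_schnyderWood⟩
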